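/- **Setting.** Let $-\infty<a<b<\infty$, $n,N,M\in\mathbb N_0$, $\mathcal X=L^2(a,b;\mathbb C^n)$, and let $P_k,S_k\in\mathbb C^{n\times n}$ ($0\le k\le N$), $J_k\in\mathbb C^{n\times n}$ ($0\le k\le M$) with $J_k=(-1)^{k+1}J_k^H$. On $C_c^\infty(a,b;\mathbb C^n)\subset\mathcal X$ define $$\mathcal P_0x=\sum_{k=0}^N \tfrac{d^k}{d\xi^k}P_k^H\tfrac{d^k}{d\xi^k}x,\qquad \mathcal S_0x=\sum_{k=0}^N \tfrac{d^k}{d\xi^k}S_k^H\tfrac{d^k}{d\xi^k}x,\qquad \mathcal J_0x=\sum_{k=0}^M(-1)^kJ_k^H\tfrac{d^k}{d\xi^k}x,$$ and $\mathcal P=\mathcal P_0^*$, $\mathcal S=\mathcal S_0^*$ with $\operatorname{dom}\left[\begin{smallmatrix}\mathcal P\\ \mathcal S\end{smallmatrix}\right]=\operatorname{dom}\mathcal P\cap\operatorname{dom}\mathcal S$. The adjoint of a linear relation $H\subset\mathcal X\times\mathcal X$ is $H^*=\{(g_1,g_2)\mid\langle g_2,h_1\rangle=\langle g_1,h_2\rangle\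 \forall (h_1,h_2)\in H\}$, and $-H=\{(h_1,-h_2)\mid(h_1,h_2)\in H\}$. Assume: * for some $c>0$, $\big(\|\mathcal Px\|^2+\|\mathcal Sx\|^2\big)^{1/2}\ge c\|x\|$ for all $x\in\operatorname{dom}\left[\begin{smallmatrix}\mathcal P\\ \mathcal S\end{smallmatrix}\right]$; * $\sum_{m=0}^pS_m^HP_{p-m}$ is Hermitian for $p=0,\dots,2N$, where $P_m=S_m=0$ for $m>N$; * the relation $H=(\operatorname{gr}\mathcal P_0)^{-1}(\operatorname{gr}\mathcal S_0)=\{(f_1,f_2)\mid \mathcal S_0f_1=\mathcal P_0f_2\}$ is symmetric, $H\subset H^*$. **Boundary maps.** For $1\le l\le N$, $0\le k\le l-1$ and odd $m$ with $2l-1\le m\le 2N-1$, let $M_{lkm}\in\mathbb C^{2Nn\times2Nn}$ be the block matrix, with $n\times n$ blocks indexed by $0,\dots,2N-1$, whose block at $(m-k,\,m+1-2l+k)$ is $(-1)^kS_{(m+1)/2}^HP_{(m+1-2l)/2}$, whose block at $(m+1-2l+k,\,m-k)$ is $(-1)^kS_{(m+1-2l)/2}^HP_{(m+1)/2}$, and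 whose other blocks vanish. Put $B=\big(\sum_{l,k,m}M_{lkm}\big)^H$ and $A=B-B^H$. Let $Q\in\mathbb C^{Mn\times Mn}$ be the Hermitian matrix with $n\times n$ blocks $Q_{ij}=(-1)^{i-1}J_{i+j-1}$ if $i+j-1\le M$ and $Q_{ij}=0$ otherwise ($i,j=1,\dots,M$). Let $$A=U_{\rm r}D_{\rm r}U_{\rm r}^H,\qquad Q=V_{\rm r}C_{\rm r}V_{\rm r}^H$$ be reduced factorizations: $U_{\rm r}$ and $V_{\rm r}$ have $\operatorname{rk}A$ respectively $\operatorname{rk}Q$ orthonormal columns, and $D_{\rm r},C_{\rm r}$ are square (for instance the spectral factorizations with the nonzero eigenvalues on the diagonal of $D_{\rm r},C_{\rm r}$, or $U_{\rm r}=I$, $D_{\rm r}=A$ if $A$ is invertible). With the traces $\gamma x=(x(b),\dots,x^{(j-1)}(b),x(a),\dots,x^{(j-1)}(a))$ on $H^j(a,b;\mathbb C^n)$, $j=2N$ and $j=M$ respectively, consider $$x\mapsto\tfrac1{\sqrt2}\begin{bmatrix}D_{\rm r}&-D_{\rm r}\\-I&-I\end{bmatrix}\begin{bmatrix}U_{\rm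 r}^H&0\\0&U_{\rm r}^H\end{bmatrix}\gamma x\ \text{ on }H^{2N}(a,b;\mathbb C^n),\qquad x\mapsto\tfrac1{\sqrt2}\begin{bmatrix}C_{\rm r}&-C_{\rm r}\\I&I\end{bmatrix}\begin{bmatrix}V_{\rm r}^H&0\\0&V_{\rm r}^H\end{bmatrix}\gamma x\ \text{ on }H^{M}(a,b;\mathbb C^n).$$ Let $\widetilde\Gamma=\left[\begin{smallmatrix}\widetilde\Gamma_0\\ \widetilde\Gamma_1\end{smallmatrix}\right]$ and $\widehat\Gamma=\left[\begin{smallmatrix}\widehat\Gamma_0\\ \widehat\Gamma_1\end{smallmatrix}\right]$ be their continuous extensions, in the graph norms, to $\operatorname{dom}\left[\begin{smallmatrix}\mathcal P\\ \mathcal S\end{smallmatrix}\right]$ and to $\operatorname{dom}\mathcal J_0^*$, respectively. **Statement.** The extensions are well defined, $(\mathbb C^{\operatorname{rk}A},\widetilde\Gamma_0,\widetilde\Gamma_1)$ is a boundary triplet for $\operatorname{ran}\left[\begin{smallmatrix}\mathcal P\\ \mathcal S\end{smallmatrix}\right]$, i.e. $\widetilde\Gamma$ is linear and onto $\mathbb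 C^{\operatorname{rk}A}\times\mathbb C^{\operatorname{rk}A}$ with $$\langle\mathcal Sx,\mathcal Py\rangle-\langle\mathcal Px,\mathcal Sy\rangle=\langle\widetilde\Gamma_1x,\widetilde\Gamma_0y\rangle-\langle\widetilde\Gamma_0x,\widetilde\Gamma_1y\rangle\qquad\forall x,y\in\operatorname{dom}\left[\begin{smallmatrix}\mathcal P\\ \mathcal S\end{smallmatrix}\right],$$ and $(\mathbb C^{\operatorname{rk}Q},\widehat\Gamma_0,\widehat\Gamma_1)$ is a boundary triplet for $\mathcal J_0^*$, i.e. $\widehat\Gamma$ is linear and onto $\mathbb C^{\operatorname{rk}Q}\times\mathbb C^{\operatorname{rk}Q}$ with $$\langle\mathcal J_0^*x,y\rangle+\langle x,\mathcal J_0^*y\rangle=\langle\widehat\Gamma_1x,\widehat\Gamma_0y\rangle+\langle\widehat\Gamma_0x,\widehat\Gamma_1y\rangle\qquad\forall x,y\in\operatorname{dom}\mathcal J_0^*.$$ Moreover, let $K,L\in\mathbb C^{\operatorname{rk}A\times\operatorname{rk}A}$, $F,E\in\mathbb C^{\operatorname{rk}Q\times\operatorname{rk}Q}$ and put $$\mathcal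 D=\{(x,-\mathcal J_0^*x)\mid x\in\operatorname{dom}\mathcal J_0^*,\ F\widehat\Gamma_0x+E\widehat\Gamma_1x=0\},\qquad \mathcal L=\{(\mathcal Px,\mathcal Sx)\mid x\in\operatorname{dom}\left[\begin{smallmatrix}\mathcal P\\ \mathcal S\end{smallmatrix}\right],\ K\widetilde\Gamma_0x+L\widetilde\Gamma_1x=0\}.$$ Then the product $\mathcal D\mathcal L$ is a generalized port-Hamiltonian system, i.e. $\mathcal D=-\mathcal D^*$ and $\mathcal L=\mathcal L^*$, if and only if $$FE^H=-EF^H,\quad \operatorname{rk}[F\ \ E]=\operatorname{rk}Q,\quad KL^H=LK^H,\quad \operatorname{rk}[K\ \ L]=\operatorname{rk}A.$$ -/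

import Mathlib

open MeasureTheory Filter Topology
open scoped ContDiff Matrix

noncomputable section

namespace ImplicitPHS

/-! ### Linear relations

A linear relation in a Hilbert space `X` is a subspace of `X × X`. Its adjoint is Mathlib's
`Submodule.adjoint`, that is
`H.adjoint = {(g₁, g₂) | ⟪g₂, h₁⟫ = ⟪g₁, h₂⟫ for all (h₁, h₂) ∈ H}`.
A (possibly unbounded) operator is identified with its graph. -/

section Relations

variable {X : Type*} [NormedAddCommGroup X] [InnerProductSpace ℂ X]

/-- The inverse relation `H⁻¹ = {(h₂, h₁) | (h₁, h₂) ∈ H}`. -/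
def relInv (H : Submodule ℂ (X × X)) : Submodule ℂ (X × X) where
  carrier := {q | (q.2, q.1) ∈ H}
  add_mem' := fun h₁ h₂ => H.add_mem h₁ h₂
  zero_mem' := H.zero_mem
  smul_mem' := fun c _ h => H.smul_mem c h

/-- The relation `-H = {(h₁, -h₂) | (h₁, h₂) ∈ H}`. -/
def relNeg (H : Submodule ℂ (X × X)) : Submodule ℂ (X × X) where
  carrier := {q | (q.1, -q.2) ∈ H}
  add_mem' := fun {p q} h₁ h₂ => by
    have h : ((p.1, -p.2) + (q.1, -q.2) : X × X) ∈ H := H.add_mem h₁ h₂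
    simpa [add_comm] using h
  zero_mem' := by
    have h : (0 : X × X) ∈ H := H.zero_mem
    change ((0 : X), -(0 : X)) ∈ H
    rwa [neg_zero]
  smul_mem' := fun c q h => by
    have h' : (c • (q.1, -q.2) : X × X) ∈ H := H.smul_mem c h
    simpa using h'

/-- The product `HK = {(f, h) | ∃ g, (f, g) ∈ K ∧ (g, h) ∈ H}`. -/
def relComp (H K : Submodule ℂ (X × X)) : Submodule ℂ (X × X) where
  carrier := {q | ∃ g, (q.1, g) ∈ K ∧ (g, q.2) ∈ H}
  add_mem' := fun ⟨g, hg₁, hg₂⟩ ⟨k, hk₁, hk₂⟩ =>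
    ⟨g + k, K.add_mem hg₁ hk₁, H.add_mem hg₂ hk₂⟩
  zero_mem' := ⟨0, K.zero_mem, H.zero_mem⟩
  smul_mem' := fun c _ ⟨g, hg₁, hg₂⟩ => ⟨c • g, K.smul_mem c hg₁, H.smul_mem c hg₂⟩

/-- `H` is symmetric: `H ⊆ H*`. -/
def IsSymmetricRel (H : Submodule ℂ (X × X)) : Prop := H ≤ H.adjoint

/-- `H` is self-adjoint: `H = H*`. -/
def IsSelfAdjointRel (H : Submodule ℂ (X × X)) : Prop := H = H.adjoint

/-- `H` is skew-adjoint: `H = -H*`. -/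
def IsSkewAdjointRel (H : Submodule ℂ (X × X)) : Prop := H = relNeg H.adjoint

/-- The product `D L` of two linear relations (the dynamics `(x, ẋ) ∈ D L`) is a generalized
port-Hamiltonian system: the left factor `D` is a Dirac structure (`D = -D*`) and the right
factor `L` is a Lagrangian subspace (`L = L*`). -/
def IsGeneralizedPHS (D L : Submodule ℂ (X × X)) : Prop :=
  IsSkewAdjointRel D ∧ IsSelfAdjointRel L

/-- The column operator `[P; S]`, with domain `dom P ∩ dom S`, as a relation from `X` to
`X × X`. -/
def column (P S : Submodule ℂ (X × X)) : Submodule ℂ (X × (X × X)) where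
  carrier := {q | (q.1, q.2.1) ∈ P ∧ (q.1, q.2.2) ∈ S}
  add_mem' := fun h₁ h₂ => ⟨P.add_mem h₁.1 h₂.1, S.add_mem h₁.2 h₂.2⟩
  zero_mem' := ⟨P.zero_mem, S.zero_mem⟩
  smul_mem' := fun c _ h => ⟨P.smul_mem c h.1, S.smul_mem c h.2⟩

/-- Coercivity of `[P; S]`: for some `c > 0`, `‖[P; S] x‖ ≥ c ‖x‖` on `dom P ∩ dom S`. -/
def IsCoercive (P S : Submodule ℂ (X × X)) : Prop :=
  ∃ c : ℝ, 0 < c ∧ ∀ x p s : X, (x, (p, s)) ∈ column P S →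
    c * ‖x‖ ≤ Real.sqrt (‖p‖ ^ 2 + ‖s‖ ^ 2)

variable {G : Type*} [NormedAddCommGroup G] [InnerProductSpace ℂ G]

/-- `(G, Γ₀, Γ₁)` is a boundary triplet for `ran [P; S]`. The linear map
`Γ = [Γ₀; Γ₁] : dom [P; S] → G × G` is given by its graph. -/
structure IsRangeBoundaryTriplet (P S : Submodule ℂ (X × X)) (Γ : Submodule ℂ (X × (G × G))) :
    Prop where
  /-- the domain of `Γ` is contained in that of `[P; S]` -/
  dom : ∀ x y, (x, y) ∈ Γ → ∃ q, (x, q) ∈ column P S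
  /-- `Γ` is a map defined on all of `dom [P; S]` -/
  map : ∀ x q, (x, q) ∈ column P S → ∃! y, (x, y) ∈ Γ
  surj : ∀ y, ∃ x, (x, y) ∈ Γ
  /-- abstract Green identity -/
  green : ∀ x p s y x' p' s' y', (x, (p, s)) ∈ column P S → (x', (p', s')) ∈ column P S →
    (x, y) ∈ Γ → (x', y') ∈ Γ →
    inner ℂ s p' - inner ℂ p s' = inner ℂ y.2 y'.1 - inner ℂ y.1 y'.2

/-- `(G, Γ₀, Γ₁)` is a boundary triplet for the operator `J` (the adjoint of a skew-symmetric
operator). The linear map `Γ = [Γ₀; Γ₁] : dom J → G × G` is given by its graph. -/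
structure IsSkewBoundaryTriplet (J : Submodule ℂ (X × X)) (Γ : Submodule ℂ (X × (G × G))) :
    Prop where
  /-- the domain of `Γ` is contained in that of `J` -/
  dom : ∀ x y, (x, y) ∈ Γ → ∃ z, (x, z) ∈ J
  /-- `Γ` is a map defined on all of `dom J` -/
  map : ∀ x z, (x, z) ∈ J → ∃! y, (x, y) ∈ Γ
  surj : ∀ y, ∃ x, (x, y) ∈ Γ
  /-- abstract Green identity -/
  green : ∀ x z y x' z' y', (x, z) ∈ J → (x', z') ∈ J → (x, y) ∈ Γ → (x', y') ∈ Γ →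
    inner ℂ z x' + inner ℂ x z' = inner ℂ y.2 y'.1 + inner ℂ y.1 y'.2

/-- The relation `ran ([P; S] |_Θ)`: the range of `[P; S]` restricted to
`{x ∈ dom [P; S] | Γ x ∈ Θ}`. -/
def rangeRestrict (P S : Submodule ℂ (X × X)) (Γ : Submodule ℂ (X × (G × G)))
    (Θ : Submodule ℂ (G × G)) : Submodule ℂ (X × X) where
  carrier := {q | ∃ x y, (x, q) ∈ column P S ∧ (x, y) ∈ Γ ∧ y ∈ Θ}
  add_mem' := fun ⟨x, y, h₁, h₂, h₃⟩ ⟨x', y', h₁', h₂', h₃'⟩ =>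
    ⟨x + x', y + y', (column P S).add_mem h₁ h₁', Γ.add_mem h₂ h₂', Θ.add_mem h₃ h₃'⟩
  zero_mem' := ⟨0, 0, (column P S).zero_mem, Γ.zero_mem, Θ.zero_mem⟩
  smul_mem' := fun c _ ⟨x, y, h₁, h₂, h₃⟩ =>
    ⟨c • x, c • y, (column P S).smul_mem c h₁, Γ.smul_mem c h₂, Θ.smul_mem c h₃⟩

/-- The graph of the restriction of `J` to `{x ∈ dom J | Γ x ∈ Θ}`. -/
def graphRestrict (J : Submodule ℂ (X × X)) (Γ : Submodule ℂ (X × (G × G)))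
    (Θ : Submodule ℂ (G × G)) : Submodule ℂ (X × X) where
  carrier := {q | q ∈ J ∧ ∃ y, (q.1, y) ∈ Γ ∧ y ∈ Θ}
  add_mem' := fun ⟨h₁, y, h₂, h₃⟩ ⟨h₁', y', h₂', h₃'⟩ =>
    ⟨J.add_mem h₁ h₁', y + y', Γ.add_mem h₂ h₂', Θ.add_mem h₃ h₃'⟩
  zero_mem' := ⟨J.zero_mem, 0, Γ.zero_mem, Θ.zero_mem⟩
  smul_mem' := fun c _ ⟨h₁, y, h₂, h₃⟩ =>
    ⟨J.smul_mem c h₁, c • y, Γ.smul_mem c h₂, Θ.smul_mem c h₃⟩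

/-- The continuous extension to `dom T` of a boundary map `Γ` that is defined on part of `dom T`,
with respect to the graph norm of `T`: the extension takes the value `y` at `x` if there are `u j`
in the domain of `Γ` with `u j → x`, `T (u j) → T x` and `Γ (u j) → y`. -/
def graphNormExtension {Y W : Type*} [NormedAddCommGroup Y] [NormedSpace ℂ Y]
    [NormedAddCommGroup W] [NormedSpace ℂ W]
    (T : Submodule ℂ (X × Y)) (Γ : Submodule ℂ (X × W)) : Submodule ℂ (X × W) where
  carrier := {q | ∃ z : Y, (q.1, z) ∈ T ∧ ∃ (u : ℕ → X) (v : ℕ → Y) (w : ℕ → W),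
    (∀ j, (u j, v j) ∈ T ∧ (u j, w j) ∈ Γ) ∧
    Tendsto u atTop (𝓝 q.1) ∧ Tendsto v atTop (𝓝 z) ∧ Tendsto w atTop (𝓝 q.2)}
  add_mem' := fun ⟨z, hz, u, v, w, h, h₁, h₂, h₃⟩ ⟨z', hz', u', v', w', h', h₁', h₂', h₃'⟩ =>
    ⟨z + z', T.add_mem hz hz', u + u', v + v', w + w',
      fun j => ⟨T.add_mem (h j).1 (h' j).1, Γ.add_mem (h j).2 (h' j).2⟩,
      h₁.add h₁', h₂.add h₂', h₃.add h₃'⟩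
  zero_mem' := ⟨0, T.zero_mem, 0, 0, 0, fun _ => ⟨T.zero_mem, Γ.zero_mem⟩,
    tendsto_const_nhds, tendsto_const_nhds, tendsto_const_nhds⟩
  smul_mem' := fun c _ ⟨z, hz, u, v, w, h, h₁, h₂, h₃⟩ =>
    ⟨c • z, T.smul_mem c hz, c • u, c • v, c • w,
      fun j => ⟨T.smul_mem c (h j).1, Γ.smul_mem c (h j).2⟩,
      h₁.const_smul c, h₂.const_smul c, h₃.const_smul c⟩

/-- The relation `ker [K L] = {(y₀, y₁) | K y₀ + L y₁ = 0}` in `ℂʳ`. -/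
def kerPair {r : ℕ} (K L : Matrix (Fin r) (Fin r) ℂ) :
    Submodule ℂ (EuclideanSpace ℂ (Fin r) × EuclideanSpace ℂ (Fin r)) :=
  LinearMap.ker ((Matrix.toEuclideanLin K).coprod (Matrix.toEuclideanLin L))

end Relations

/-! ### Matrix differential operators on `L²(a, b; ℂⁿ)` -/

/-- The Hilbert space `L²(a, b; ℂⁿ)`. -/
abbrev L2 (a b : ℝ) (n : ℕ) : Type :=
  Lp (EuclideanSpace ℂ (Fin n)) 2 (volume.restrict (Set.Ioo a b))

/-- `φ ∈ C_c^∞(a, b; ℂⁿ)`, extended by zero to the real line. -/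
def IsTestFunction (a b : ℝ) {n : ℕ} (φ : ℝ → EuclideanSpace ℂ (Fin n)) : Prop :=
  ContDiff ℝ ∞ φ ∧ HasCompactSupport φ ∧ tsupport φ ⊆ Set.Ioo a b

/-- The formal differential expression `∑ₖ Cₖ φ^(eₖ)`. -/
def diffExpr {n : ℕ} {ι : Type} [Fintype ι] (C : ι → Matrix (Fin n) (Fin n) ℂ) (e : ι → ℕ)
    (φ : ℝ → EuclideanSpace ℂ (Fin n)) : ℝ → EuclideanSpace ℂ (Fin n) :=
  fun t => ∑ k, Matrix.toEuclideanLin (C k) (iteratedDeriv (e k) φ t)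

theorem IsTestFunction.add {a b : ℝ} {n : ℕ} {φ ψ : ℝ → EuclideanSpace ℂ (Fin n)}
    (hφ : IsTestFunction a b φ) (hψ : IsTestFunction a b ψ) : IsTestFunction a b (φ + ψ) :=
  ⟨hφ.1.add hψ.1, hφ.2.1.add hψ.2.1,
    (tsupport_add φ ψ).trans (Set.union_subset hφ.2.2 hψ.2.2)⟩

theorem IsTestFunction.const_smul {a b : ℝ} {n : ℕ} {φ : ℝ → EuclideanSpace ℂ (Fin n)}
    (c : ℂ) (hφ : IsTestFunction a b φ) : IsTestFunction a b (c • φ) := by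
  have hs : tsupport (c • φ) ⊆ tsupport φ := closure_mono (Function.support_const_smul_subset c φ)
  exact ⟨hφ.1.const_smul c, hφ.2.1.mono' (subset_closure.trans hs), hs.trans hφ.2.2⟩

theorem diffExpr_add {n : ℕ} {ι : Type} [Fintype ι] (C : ι → Matrix (Fin n) (Fin n) ℂ)
    (e : ι → ℕ) {φ ψ : ℝ → EuclideanSpace ℂ (Fin n)} (hφ : ContDiff ℝ ∞ φ) (hψ : ContDiff ℝ ∞ ψ) :
    diffExpr C e (φ + ψ) = diffExpr C e φ + diffExpr C e ψ := by
  funext t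
  simp only [diffExpr, Pi.add_apply, ← Finset.sum_add_distrib, ← map_add]
  refine Finset.sum_congr rfl fun k _ => ?_
  rw [iteratedDeriv_add ((hφ.of_le (by exact_mod_cast le_top)).contDiffAt)
    ((hψ.of_le (by exact_mod_cast le_top)).contDiffAt)]

theorem diffExpr_const_smul {n : ℕ} {ι : Type} [Fintype ι] (C : ι → Matrix (Fin n) (Fin n) ℂ)
    (e : ι → ℕ) {φ : ℝ → EuclideanSpace ℂ (Fin n)} (hφ : ContDiff ℝ ∞ φ) (c : ℂ) :
    diffExpr C e (c • φ) = c • diffExpr C e φ := by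
  funext t
  simp only [diffExpr, Pi.smul_apply, Finset.smul_sum, ← map_smul]
  refine Finset.sum_congr rfl fun k _ => ?_
  rw [iteratedDeriv_const_smul ((hφ.of_le (by exact_mod_cast le_top)).contDiffAt)]

/-- The graph of the minimal operator `φ ↦ ∑ₖ Cₖ φ^(eₖ)` in `L²(a, b; ℂⁿ)` with domain
`C_c^∞(a, b; ℂⁿ)`. -/
def minimalOp (a b : ℝ) {n : ℕ} {ι : Type} [Fintype ι] (C : ι → Matrix (Fin n) (Fin n) ℂ)
    (e : ι → ℕ) : Submodule ℂ (L2 a b n × L2 a b n) where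
  carrier := {q | ∃ φ, IsTestFunction a b φ ∧
    q.1 =ᵐ[volume.restrict (Set.Ioo a b)] φ ∧
    q.2 =ᵐ[volume.restrict (Set.Ioo a b)] diffExpr C e φ}
  add_mem' := fun {p q} ⟨φ, hφ, h₁, h₂⟩ ⟨ψ, hψ, h₁', h₂'⟩ => by
    refine ⟨φ + ψ, hφ.add hψ, (Lp.coeFn_add p.1 q.1).trans (h₁.add h₁'), ?_⟩
    rw [diffExpr_add C e hφ.1 hψ.1]
    exact (Lp.coeFn_add p.2 q.2).trans (h₂.add h₂')
  zero_mem' := by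
    refine ⟨0, ⟨contDiff_const, HasCompactSupport.zero, by simp [tsupport]⟩,
      Lp.coeFn_zero _ _ _, ?_⟩
    have h : diffExpr C e (0 : ℝ → EuclideanSpace ℂ (Fin n)) = 0 := by
      have := diffExpr_const_smul C e (φ := (0 : ℝ → EuclideanSpace ℂ (Fin n))) contDiff_const 0
      simpa using this
    rw [h]
    exact Lp.coeFn_zero _ _ _
  smul_mem' := fun c q ⟨φ, hφ, h₁, h₂⟩ => by
    refine ⟨c • φ, hφ.const_smul c, (Lp.coeFn_smul c q.1).trans (h₁.const_smul c), ?_⟩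
    rw [diffExpr_const_smul C e hφ.1]
    exact (Lp.coeFn_smul c q.2).trans (h₂.const_smul c)

/-- The minimal operator `∑ₖ Dᵏ Pₖᴴ Dᵏ = ∑ₖ Pₖᴴ D²ᵏ` on `C_c^∞(a, b; ℂⁿ)`. -/
def minimalEven (a b : ℝ) {n N : ℕ} (P : Fin (N + 1) → Matrix (Fin n) (Fin n) ℂ) :
    Submodule ℂ (L2 a b n × L2 a b n) :=
  minimalOp a b (fun k : Fin (N + 1) => (P k)ᴴ) (fun k => 2 * (k : ℕ))

/-- The maximal operator `∑ₖ Dᵏ Pₖ Dᵏ`, the adjoint of the minimal operator `minimalEven`. -/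
def maximalEven (a b : ℝ) {n N : ℕ} (P : Fin (N + 1) → Matrix (Fin n) (Fin n) ℂ) :
    Submodule ℂ (L2 a b n × L2 a b n) :=
  (minimalEven a b P).adjoint

/-- The relation `H = (gr P₀)⁻¹ (gr S₀)`. -/
def relH (a b : ℝ) {n N : ℕ} (P S : Fin (N + 1) → Matrix (Fin n) (Fin n) ℂ) :
    Submodule ℂ (L2 a b n × L2 a b n) :=
  relComp (relInv (minimalEven a b P)) (minimalEven a b S)

/-- The minimal operator `J₀ = ∑ₖ (-1)ᵏ Jₖᴴ Dᵏ` on `C_c^∞(a, b; ℂⁿ)`. -/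
def minimalSkew (a b : ℝ) {n M : ℕ} (J : Fin (M + 1) → Matrix (Fin n) (Fin n) ℂ) :
    Submodule ℂ (L2 a b n × L2 a b n) :=
  minimalOp a b (fun k : Fin (M + 1) => (-1 : ℂ) ^ (k : ℕ) • (J k)ᴴ) (fun k => (k : ℕ))

/-- The operator `J₀* = ∑ₖ Jₖ Dᵏ`, the adjoint of the minimal operator `minimalSkew`. -/
def maximalSkew (a b : ℝ) {n M : ℕ} (J : Fin (M + 1) → Matrix (Fin n) (Fin n) ℂ) :
    Submodule ℂ (L2 a b n × L2 a b n) :=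
  (minimalSkew a b J).adjoint

/-! ### Sobolev spaces and traces -/

/-- `(x, v) ∈ weakDeriv a b n k` iff `v ∈ L²` is the `k`-th weak derivative of `x ∈ L²`, that is
`⟪φ, v⟫ = ⟪(-1)ᵏ φ^(k), x⟫` for all test functions `φ`. -/
def weakDeriv (a b : ℝ) (n k : ℕ) : Submodule ℂ (L2 a b n × L2 a b n) :=
  (minimalOp a b (fun _ : Unit => (-1 : ℂ) ^ k • (1 : Matrix (Fin n) (Fin n) ℂ))
    (fun _ => k)).adjoint

/-- `x ∈ Hᵐ(a, b; ℂⁿ)`: the weak derivatives up to order `m` exist in `L²`. -/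
def MemSobolev (a b : ℝ) {n : ℕ} (m : ℕ) (x : L2 a b n) : Prop :=
  ∀ k ≤ m, ∃ v, (x, v) ∈ weakDeriv a b n k

/-- The graph of the trace operator on `Hᵐ(a, b; ℂⁿ)`:
`x ↦ ((x(b), x'(b), …, x^(m-1)(b)), (x(a), x'(a), …, x^(m-1)(a)))`, where `x^(k)(b)` and `x^(k)(a)`
are the values of the representative of `x^(k)` which is continuous on `[a, b]`. -/
def traceMap (a b : ℝ) (n m : ℕ) :
    Submodule ℂ (L2 a b n × ((Fin m × Fin n → ℂ) × (Fin m × Fin n → ℂ))) where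
  carrier := {q | MemSobolev a b m q.1 ∧ ∀ k : Fin m, ∃ v, (q.1, v) ∈ weakDeriv a b n k ∧
    ∃ g : ℝ → EuclideanSpace ℂ (Fin n), ContinuousOn g (Set.Icc a b) ∧
      v =ᵐ[volume.restrict (Set.Ioo a b)] g ∧
      (∀ i, q.2.1 (k, i) = g b i) ∧ (∀ i, q.2.2 (k, i) = g a i)}
  add_mem' := fun {p q} ⟨hp, hp'⟩ ⟨hq, hq'⟩ => by
    refine ⟨fun k hk => ?_, fun k => ?_⟩
    · obtain ⟨v, hv⟩ := hp k hk
      obtain ⟨w, hw⟩ := hq k hk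
      exact ⟨v + w, (weakDeriv a b n k).add_mem hv hw⟩
    · obtain ⟨v, hv, g, hg, hvg, h₁, h₂⟩ := hp' k
      obtain ⟨w, hw, f, hf, hwf, h₁', h₂'⟩ := hq' k
      exact ⟨v + w, (weakDeriv a b n k).add_mem hv hw, g + f, hg.add hf,
        (Lp.coeFn_add v w).trans (hvg.add hwf), fun i => by simp [h₁, h₁'],
        fun i => by simp [h₂, h₂']⟩
  zero_mem' := ⟨fun k _ => ⟨0, (weakDeriv a b n k).zero_mem⟩, fun k =>
    ⟨0, (weakDeriv a b n k).zero_mem, 0, continuousOn_const, Lp.coeFn_zero _ _ _,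
      fun i => by simp, fun i => by simp⟩⟩
  smul_mem' := fun c q ⟨hq, hq'⟩ => by
    refine ⟨fun k hk => ?_, fun k => ?_⟩
    · obtain ⟨v, hv⟩ := hq k hk
      exact ⟨c • v, (weakDeriv a b n k).smul_mem c hv⟩
    · obtain ⟨v, hv, g, hg, hvg, h₁, h₂⟩ := hq' k
      exact ⟨c • v, (weakDeriv a b n k).smul_mem c hv, c • g, hg.const_smul c,
        (Lp.coeFn_smul c v).trans (hvg.const_smul c), fun i => by simp [h₁],
        fun i => by simp [h₂]⟩

/-! ### Boundary maps from coefficient matrices -/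

/-- The coefficients as a sequence of matrices, extended by zero. -/
def coeff {n N : ℕ} (P : Fin (N + 1) → Matrix (Fin n) (Fin n) ℂ) (k : ℕ) :
    Matrix (Fin n) (Fin n) ℂ :=
  if h : k < N + 1 then P ⟨k, h⟩ else 0

/-- The symmetry condition on the coefficients: `∑_{m ≤ p} S_mᴴ P_{p-m}` is Hermitian for
`p = 0, …, 2N`, where `P_m = S_m = 0` for `m > N`. -/
def SymmetricCoeffs {n N : ℕ} (P S : Fin (N + 1) → Matrix (Fin n) (Fin n) ℂ) : Prop :=
  ∀ p ≤ 2 * N, (∑ m ∈ Finset.range (p + 1), (coeff S m)ᴴ * coeff P (p - m)).IsHermitian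

/-- The block matrix with block indices `0, …, 2N - 1` (orders of derivatives) whose two possibly
nonzero blocks are `(-1)ᵏ S_iᴴ P_{i-l}` at `(2i - 1 - k, 2(i - l) + k)` and
`(-1)ᵏ S_{i-l}ᴴ P_i` at `(2(i - l) + k, 2i - 1 - k)`. -/
def blockM {n N : ℕ} (P S : Fin (N + 1) → Matrix (Fin n) (Fin n) ℂ) (l k i : ℕ) :
    Matrix (Fin (2 * N) × Fin n) (Fin (2 * N) × Fin n) ℂ :=
  Matrix.of fun r c =>
    if (r.1 : ℕ) = 2 * i - 1 - k ∧ (c.1 : ℕ) = 2 * (i - l) + k then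
      ((-1 : ℂ) ^ k • ((coeff S i)ᴴ * coeff P (i - l))) r.2 c.2
    else if (r.1 : ℕ) = 2 * (i - l) + k ∧ (c.1 : ℕ) = 2 * i - 1 - k then
      ((-1 : ℂ) ^ k • ((coeff S (i - l))ᴴ * coeff P i)) r.2 c.2
    else 0

/-- The matrix `B`. -/
def matB {n N : ℕ} (P S : Fin (N + 1) → Matrix (Fin n) (Fin n) ℂ) :
    Matrix (Fin (2 * N) × Fin n) (Fin (2 * N) × Fin n) ℂ :=
  (∑ l ∈ Finset.Icc 1 N, ∑ k ∈ Finset.range l, ∑ i ∈ Finset.Icc l N, blockM P S l k i)ᴴ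

/-- The skew-Hermitian matrix `A = B - Bᴴ`. -/
def matA {n N : ℕ} (P S : Fin (N + 1) → Matrix (Fin n) (Fin n) ℂ) :
    Matrix (Fin (2 * N) × Fin n) (Fin (2 * N) × Fin n) ℂ :=
  matB P S - (matB P S)ᴴ

/-- The Hermitian matrix `Q`, with blocks `(-1)^i J_{i+j+1}` (zero if `i + j + 1 > M`) for
`i, j = 0, …, M - 1`. -/
def matQ {n M : ℕ} (J : Fin (M + 1) → Matrix (Fin n) (Fin n) ℂ) :
    Matrix (Fin M × Fin n) (Fin M × Fin n) ℂ :=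
  Matrix.of fun r c => ((-1 : ℂ) ^ (r.1 : ℕ) • coeff J (r.1 + c.1 + 1)) r.2 c.2

/-- `A = U D Uᴴ` is a reduced factorization of `A`: the `rk A` columns of `U` are orthonormal.
The spectral factorization (`D` diagonal, consisting of the nonzero eigenvalues of the normal
matrix `A`, and the columns of `U` corresponding eigenvectors) is of this form, and so is, if `A`
is invertible, the trivial one with `U = I` and `D = A`. -/
def IsReducedFactorization {ι : Type} [Fintype ι] [DecidableEq ι] (A : Matrix ι ι ℂ)
    (U : Matrix ι (Fin A.rank) ℂ) (D : Matrix (Fin A.rank) (Fin A.rank) ℂ) : Prop :=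
  Uᴴ * U = 1 ∧ A = U * D * Uᴴ

/-- The linear map which sends the boundary data `(τ_b, τ_a)` to `(y₀, y₁) ∈ ℂʳ × ℂʳ`, where
`y₀ = (D Uᴴ τ_b - D Uᴴ τ_a) / √2` and `y₁ = σ (Uᴴ τ_b + Uᴴ τ_a) / √2`. -/
def boundaryMatrix {ι : Type} [Fintype ι] {r : ℕ} (U : Matrix ι (Fin r) ℂ)
    (D : Matrix (Fin r) (Fin r) ℂ) (σ : ℂ) :
    ((ι → ℂ) × (ι → ℂ)) →ₗ[ℂ] EuclideanSpace ℂ (Fin r) × EuclideanSpace ℂ (Fin r) where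
  toFun τ :=
    (((Real.sqrt 2 : ℝ) : ℂ)⁻¹ • WithLp.toLp 2 (D *ᵥ (Uᴴ *ᵥ (τ.1 - τ.2))),
     (((Real.sqrt 2 : ℝ) : ℂ)⁻¹ * σ) • WithLp.toLp 2 (Uᴴ *ᵥ (τ.1 + τ.2)))
  map_add' τ ρ := by
    ext i <;> simp [Matrix.mulVec_add, Matrix.mulVec_sub] <;> ring
  map_smul' c τ := by
    ext i <;> simp [Matrix.mulVec_add, Matrix.mulVec_sub, Matrix.mulVec_smul] <;> ring

/-- The graph of the boundary map `x ↦ boundaryMatrix U D σ (γ x)` on `Hᵐ(a, b; ℂⁿ)`, where `γ` is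
the trace operator. -/
def boundaryMap (a b : ℝ) (n m : ℕ) {r : ℕ} (U : Matrix (Fin m × Fin n) (Fin r) ℂ)
    (D : Matrix (Fin r) (Fin r) ℂ) (σ : ℂ) :
    Submodule ℂ (L2 a b n × (EuclideanSpace ℂ (Fin r) × EuclideanSpace ℂ (Fin r))) :=
  (traceMap a b n m).map (LinearMap.prodMap LinearMap.id (boundaryMatrix U D σ))

/-- The boundary map for `ran [P; S]`: the continuous extension to `dom [P; S]` of
`x ↦ (1/√2) [D -D; -I -I] [Uᴴ 0; 0 Uᴴ] γ x`, which is defined on `H²ᴺ(a, b; ℂⁿ)`. -/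
def rangeBoundary (a b : ℝ) {n N : ℕ} (P S : Fin (N + 1) → Matrix (Fin n) (Fin n) ℂ) {r : ℕ}
    (U : Matrix (Fin (2 * N) × Fin n) (Fin r) ℂ) (D : Matrix (Fin r) (Fin r) ℂ) :
    Submodule ℂ (L2 a b n × (EuclideanSpace ℂ (Fin r) × EuclideanSpace ℂ (Fin r))) :=
  graphNormExtension (column (maximalEven a b P) (maximalEven a b S))
    (boundaryMap a b n (2 * N) U D (-1))

/-- The boundary map for `J₀*`: the continuous extension to `dom J₀*` of
`x ↦ (1/√2) [C -C; I I] [Vᴴ 0; 0 Vᴴ] γ x`, which is defined on `Hᴹ(a, b; ℂⁿ)`. -/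
def skewBoundary (a b : ℝ) {n M : ℕ} (J : Fin (M + 1) → Matrix (Fin n) (Fin n) ℂ) {r : ℕ}
    (V : Matrix (Fin M × Fin n) (Fin r) ℂ) (C : Matrix (Fin r) (Fin r) ℂ) :
    Submodule ℂ (L2 a b n × (EuclideanSpace ℂ (Fin r) × EuclideanSpace ℂ (Fin r))) :=
  graphNormExtension (maximalSkew a b J) (boundaryMap a b n M V C 1)

end ImplicitPHS

end

noncomputable section

namespace ImplicitPHS

/-! Both relations are instances of one situation. For `κ = 1` or `κ = -1` consider the form `⟪q₂,
q'₁⟫ - κ ⟪q₁, q'₂⟫` on pairs (`bForm`). A relation equals its own complement for this form exactly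
when it is self-adjoint (`κ = 1`) or, up to the sign of the second component, skew-adjoint (`κ =
-1`). The Lagrangian side is `ran [P; S]` with `κ = 1`. The Dirac side is the graph of `J₀*`, read
as `ran [1; J]` with `κ = -1`. In both cases `S† P = κ P† S` for the formal adjoint `dag`.

The coefficients enter only through `IsBoundaryForm`: a surjective linear map of the traces that
satisfies Green's identity on smooth functions. Surjectivity holds because the middle factor of a
reduced factorization is invertible. Green's identity comes from integration by parts, whose
boundary terms are collected in `Q` (`concomitant_polySkew`) and in the matrices whose sum defines
`A` (`hasDerivAt_formM`).

Two analytic facts carry Green's identity to the maximal domains, where the leading coefficients may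
be singular and traces need not exist.

Density (`exists_smooth_tendsto`): smooth functions are dense in the joint graph norm of finitely
many maximal operators. By duality this is a statement about a vector `z` orthogonal to all `(p i
φ)`. On a subinterval, the pairing of `z` with `(f i)` is a limit of boundary terms of
mollifications. The jets in these terms need not converge. A generalized inverse of the boundary
form, however, writes it as a finite sum of products of pairings with fixed vectors, and these
scalars do converge. As the subinterval exhausts `(a, b)`, the factors that belong to `z` tend to
zero.

Range (`exists_mem_maxOp_of_orthogonal`): coercivity, tested on exponentials, shows that `P(z)` and
`S(z)` have no common kernel vector, so `[P; S]` has a polynomial left inverse. Together with `S† P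
= κ P† S` it extends to an invertible block operator, so that the kernel of `[S†, -κ P†]` on smooth
functions is the range of `[P; S]`. Mollification and coercivity transfer this to `L²`.

The boundary value is then a continuous function of `(P x, S x)`, which gives the triplets, and a
restriction by boundary conditions `Θ` equals its complement if and only if `Θ` does
(`IsBoundaryForm.rangeRestrict_iff`). For `Θ = ker [K L]` a dimension count finishes the proof
(`kerPair_lagrangian_iff`). -/

/-- The space `ℂⁿ` with its Euclidean norm. -/
abbrev Vec (n : ℕ) : Type := EuclideanSpace ℂ (Fin n)

/-- Matrix polynomials, that is, differential expressions with constant matrix coefficients. -/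
abbrev MatPoly (n : ℕ) : Type := Polynomial (Matrix (Fin n) (Fin n) ℂ)

/-! ### Matrix differential operators on smooth functions and formal adjoints -/

section Smooth

variable {n : ℕ}

/-- The smooth functions `ℝ → ℂⁿ`. -/
def Smooth (n : ℕ) : Submodule ℂ (ℝ → Vec n) where
  carrier := {φ | ContDiff ℝ ∞ φ}
  add_mem' := fun {φ ψ} (h₁ : ContDiff ℝ ∞ φ) (h₂ : ContDiff ℝ ∞ ψ) => ContDiff.add h₁ h₂
  zero_mem' := show ContDiff ℝ ∞ (fun _ => (0 : Vec n)) from contDiff_const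
  smul_mem' := fun c φ (h : ContDiff ℝ ∞ φ) => ContDiff.const_smul c h

theorem smooth_contDiff (φ : Smooth n) : ContDiff ℝ ∞ φ.1 := φ.2

theorem smooth_continuous (φ : Smooth n) : Continuous φ.1 := (smooth_contDiff φ).continuous

theorem smooth_differentiable (φ : Smooth n) : Differentiable ℝ φ.1 :=
  (smooth_contDiff φ).differentiable (by simp)

/-- Differentiation of smooth functions. -/
def smoothDeriv (n : ℕ) : Module.End ℂ (Smooth n) where
  toFun φ := ⟨deriv φ.1, (contDiff_infty_iff_deriv.1 (smooth_contDiff φ)).2⟩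
  map_add' φ ψ := by
    ext1; funext t
    exact deriv_add ((smooth_differentiable φ) t) ((smooth_differentiable ψ) t)
  map_smul' c φ := by
    ext1; funext t
    exact deriv_const_smul c ((smooth_differentiable φ) t)

theorem smoothDeriv_pow_apply (k : ℕ) (φ : Smooth n) :
    ((smoothDeriv n ^ k) φ).1 = iteratedDeriv k φ.1 := by
  induction k with
  | zero => simp
  | succ k ih =>
    rw [pow_succ', iteratedDeriv_succ, ← ih]
    rfl

theorem contDiff_toEuclideanLin_comp (A : Matrix (Fin n) (Fin n) ℂ) {φ : ℝ → Vec n}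
    (hφ : ContDiff ℝ ∞ φ) : ContDiff ℝ ∞ fun t => Matrix.toEuclideanLin A (φ t) :=
  (((Matrix.toEuclideanLin A).toContinuousLinearMap).restrictScalars ℝ).contDiff.comp hφ

theorem hasDerivAt_toEuclideanLin (A : Matrix (Fin n) (Fin n) ℂ) {φ : ℝ → Vec n} {φ' : Vec n}
    {t : ℝ} (h : HasDerivAt φ φ' t) :
    HasDerivAt (fun t => Matrix.toEuclideanLin A (φ t)) (Matrix.toEuclideanLin A φ') t :=
  (((Matrix.toEuclideanLin A).toContinuousLinearMap).restrictScalars ℝ).hasFDerivAt.comp_hasDerivAt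
    t h

theorem toEuclideanLin_mul_apply (A B : Matrix (Fin n) (Fin n) ℂ) (v : Vec n) :
    Matrix.toEuclideanLin (A * B) v = Matrix.toEuclideanLin A (Matrix.toEuclideanLin B v) := by
  ext i
  simp [Matrix.mulVec_mulVec]

theorem toEuclideanLin_one_apply (v : Vec n) :
    Matrix.toEuclideanLin (1 : Matrix (Fin n) (Fin n) ℂ) v = v := by
  ext i
  simp

theorem inner_toEuclideanLin_left (A : Matrix (Fin n) (Fin n) ℂ) (v w : Vec n) :
    inner ℂ (Matrix.toEuclideanLin A v) w = inner ℂ v (Matrix.toEuclideanLin Aᴴ w) := by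
  rw [Matrix.toEuclideanLin_conjTranspose_eq_adjoint, LinearMap.adjoint_inner_right]

/-- Pointwise multiplication of a smooth function by a matrix. -/
def smoothMul (n : ℕ) : Matrix (Fin n) (Fin n) ℂ →+* Module.End ℂ (Smooth n) where
  toFun A :=
    { toFun := fun φ => ⟨fun t => Matrix.toEuclideanLin A (φ.1 t),
        contDiff_toEuclideanLin_comp A (smooth_contDiff φ)⟩
      map_add' := fun φ ψ => by ext1; funext t; exact map_add _ _ _
      map_smul' := fun c φ => by ext1; funext t; exact map_smul (Matrix.toEuclideanLin A) c _ }
  map_one' := by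
    ext1 φ; ext1; funext t; exact toEuclideanLin_one_apply _
  map_mul' A B := by
    ext1 φ; ext1; funext t; exact toEuclideanLin_mul_apply _ _ _
  map_zero' := by
    ext1 φ; ext1; funext t
    change Matrix.toEuclideanLin 0 (φ.1 t) = 0
    simp
  map_add' A B := by
    ext1 φ; ext1; funext t
    change Matrix.toEuclideanLin (A + B) (φ.1 t) = _
    rw [map_add]; rfl

/-- The matrix is constant, so it passes through the derivative. This makes evaluation of
polynomials with noncommuting coefficients multiplicative, and hence `diffOp` a ring homomorphism.
-/
theorem smoothMul_commute (A : Matrix (Fin n) (Fin n) ℂ) :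
    Commute (smoothMul n A) (smoothDeriv n) := by
  ext1 φ; ext1; funext t
  exact ((hasDerivAt_toEuclideanLin A ((smooth_differentiable φ) t).hasDerivAt).deriv).symm

/-- The differential operator `∑ₖ pₖ Dᵏ` on smooth functions. -/
def diffOp : MatPoly n →+* Module.End ℂ (Smooth n) :=
  Polynomial.eval₂RingHom' (smoothMul n) (smoothDeriv n) smoothMul_commute

theorem diffOp_apply (p : MatPoly n) (φ : Smooth n) (t : ℝ) :
    (diffOp p φ).1 t = p.sum fun k A => Matrix.toEuclideanLin A (iteratedDeriv k φ.1 t) := by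
  change ((Polynomial.eval₂ (smoothMul n) (smoothDeriv n) p) φ).1 t = _
  rw [Polynomial.eval₂_eq_sum, Polynomial.sum, Polynomial.sum, LinearMap.sum_apply,
    Submodule.coe_sum, Finset.sum_apply]
  refine Finset.sum_congr rfl fun k _ => ?_
  rw [← smoothDeriv_pow_apply]
  rfl

theorem diffOp_apply_of_lt {p : MatPoly n} {m : ℕ} (hm : p.natDegree < m) (φ : Smooth n) (t : ℝ) :
    (diffOp p φ).1 t =
      ∑ k ∈ Finset.range m, Matrix.toEuclideanLin (p.coeff k) (iteratedDeriv k φ.1 t) := by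
  rw [diffOp_apply, Polynomial.sum_over_range' _ (fun k => by simp) m hm]

/-- The formal adjoint `∑ₖ (-1)ᵏ pₖᴴ Dᵏ` of `∑ₖ pₖ Dᵏ`. -/
def dag (p : MatPoly n) : MatPoly n :=
  p.sum fun k A => Polynomial.monomial k ((-1 : ℂ) ^ k • Aᴴ)

theorem dag_coeff (p : MatPoly n) (k : ℕ) : (dag p).coeff k = (-1 : ℂ) ^ k • (p.coeff k)ᴴ := by
  rw [dag, Polynomial.sum, Polynomial.finsetSum_coeff]
  simp only [Polynomial.coeff_monomial]
  rw [Finset.sum_ite_eq']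
  split_ifs with h
  · rfl
  · rw [Polynomial.notMem_support_iff.1 h]; simp

theorem dag_natDegree_le (p : MatPoly n) : (dag p).natDegree ≤ p.natDegree := by
  rw [Polynomial.natDegree_le_iff_coeff_eq_zero]
  intro k hk
  rw [dag_coeff, Polynomial.coeff_eq_zero_of_natDegree_lt hk]
  simp

theorem dag_dag (p : MatPoly n) : dag (dag p) = p := by
  ext1 k
  rw [dag_coeff, dag_coeff, Matrix.conjTranspose_smul, smul_smul, Matrix.conjTranspose_conjTranspose]
  simp [← mul_pow]

theorem dag_add (p q : MatPoly n) : dag (p + q) = dag p + dag q := by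
  ext1 k
  simp [dag_coeff]

theorem dag_one : dag (1 : MatPoly n) = 1 := by
  ext1 k
  rw [dag_coeff, Polynomial.coeff_one]
  split_ifs with h
  · subst h; simp
  · simp

/-- The sign is multiplicative in the degree and `ᴴ` reverses products; swapping the antidiagonal
matches the two convolutions. -/
theorem dag_mul (p q : MatPoly n) : dag (p * q) = dag q * dag p := by
  ext1 k
  rw [dag_coeff, Polynomial.coeff_mul, Polynomial.coeff_mul, Matrix.conjTranspose_sum,
    Finset.smul_sum, ← Finset.Nat.sum_antidiagonal_swap]
  refine Finset.sum_congr rfl fun x hx => ?_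
  rw [Finset.HasAntidiagonal.mem_antidiagonal] at hx
  rw [dag_coeff, dag_coeff, Prod.fst_swap, Prod.snd_swap, Matrix.conjTranspose_mul,
    Matrix.smul_mul, Matrix.mul_smul, smul_smul, ← pow_add, hx]

end Smooth

/-! ### Smooth functions inside `L²(a, b; ℂⁿ)` -/

section Embedding

variable (a b : ℝ) {n : ℕ}

theorem memLp_of_continuous {E : Type*} [NormedAddCommGroup E] [SecondCountableTopology E]
    {φ : ℝ → E} (hφ : Continuous φ) :
    MemLp φ 2 (volume.restrict (Set.Ioo a b)) := by
  obtain ⟨C, hC⟩ := (isCompact_Icc (a := a) (b := b)).exists_bound_of_continuousOn hφ.continuousOn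
  refine MemLp.of_bound hφ.aestronglyMeasurable C ?_
  filter_upwards [ae_restrict_mem measurableSet_Ioo] with t ht
  exact hC t (Set.Ioo_subset_Icc_self ht)

/-- A smooth function as an element of `L²(a, b; ℂⁿ)`. -/
def toL2 : Smooth n →ₗ[ℂ] L2 a b n where
  toFun φ := (memLp_of_continuous a b (smooth_continuous φ)).toLp φ.1
  map_add' _ _ := MemLp.toLp_add _ _
  map_smul' c _ := MemLp.toLp_const_smul c _

theorem coeFn_toL2 (φ : Smooth n) : toL2 a b φ =ᵐ[volume.restrict (Set.Ioo a b)] φ.1 :=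
  (memLp_of_continuous a b (smooth_continuous φ)).coeFn_toLp

theorem inner_toL2_right (x : L2 a b n) (φ : Smooth n) :
    inner ℂ x (toL2 a b φ) = ∫ t in Set.Ioo a b, inner ℂ (x t) (φ.1 t) := by
  rw [L2.inner_def]
  refine integral_congr_ae ?_
  filter_upwards [coeFn_toL2 a b φ] with t ht
  rw [ht]

theorem inner_toL2_toL2 (hab : a ≤ b) (φ ψ : Smooth n) :
    inner ℂ (toL2 a b φ) (toL2 a b ψ) = ∫ t in a..b, inner ℂ (φ.1 t) (ψ.1 t) := by
  rw [inner_toL2_right, intervalIntegral.integral_of_le hab, integral_Ioc_eq_integral_Ioo]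
  refine integral_congr_ae ?_
  filter_upwards [coeFn_toL2 a b φ] with t ht
  rw [ht]

/-- Test functions `g • v` with a scalar `g` and a fixed vector `v` suffice: they give `∫ g • x = 0`
for all `g`, and the fundamental lemma of the calculus of variations applies. -/
theorem eq_zero_of_inner_testFunction {x : L2 a b n}
    (h : ∀ φ : Smooth n, IsTestFunction a b φ.1 → inner ℂ x (toL2 a b φ) = 0) : x = 0 := by
  have hx : ∀ᵐ t ∂(volume.restrict (Set.Ioo a b)), t ∈ Set.Ioo a b → x t = 0 := by
    refine isOpen_Ioo.ae_eq_zero_of_integral_contDiff_smul_eq_zero ?_ ?_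
    · exact ((Lp.memLp x).locallyIntegrable (by norm_num)).locallyIntegrableOn _
    · intro g hg hgc hgs
      refine ext_inner_right ℂ fun v => ?_
      have hφ : ContDiff ℝ ∞ fun t => g t • v := hg.smul contDiff_const
      have hs : tsupport (fun t => g t • v) ⊆ tsupport g :=
        closure_mono (Function.support_smul_subset_left g fun _ => v)
      have hφt : IsTestFunction a b fun t => g t • v :=
        ⟨hφ, hgc.mono' (subset_closure.trans hs), hs.trans hgs⟩
      have h1 := h ⟨_, hφ⟩ hφt
      rw [inner_toL2_right] at h1
      rw [inner_zero_left, ← h1]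
      have hint : Integrable (fun t => g t • x t) (volume.restrict (Set.Ioo a b)) := by
        have h2 := (Lp.memLp x).integrable (by norm_num : (1 : ENNReal) ≤ 2)
        obtain ⟨C, hC⟩ := hgc.exists_bound_of_continuous hg.continuous
        exact h2.bdd_smul C hg.continuous.aestronglyMeasurable (Eventually.of_forall hC)
      have h3 := integral_inner (𝕜 := ℂ) hint v
      rw [← inner_conj_symm, ← h3, ← integral_conj]
      refine integral_congr_ae (Eventually.of_forall fun t => ?_)
      simp only [inner_conj_symm]
      rw [← Complex.coe_smul, ← Complex.coe_smul, inner_smul_left, inner_smul_right, Complex.conj_ofReal]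
  refine (Lp.eq_zero_iff_ae_eq_zero).2 ?_
  filter_upwards [hx, ae_restrict_mem measurableSet_Ioo] with t h1 h2 using h1 h2

end Embedding

/-! ### Lagrange's identity -/

section Lagrange

variable {n : ℕ}

/-- The bilinear concomitant of the differential expression `∑ₖ pₖ Dᵏ` of order at most `m`,
evaluated at the jets `u` and `v`. -/
def concomitant (m : ℕ) (p : MatPoly n) (u v : ℕ → Vec n) : ℂ :=
  ∑ k ∈ Finset.range (m + 1), ∑ j ∈ Finset.range k,
    (-1 : ℂ) ^ j * inner ℂ (Matrix.toEuclideanLin (p.coeff k) (u (k - 1 - j))) (v j)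

/-- The sequence of derivatives of `φ` at `t`. -/
def jet (φ : Smooth n) (t : ℝ) (k : ℕ) : Vec n := iteratedDeriv k φ.1 t

theorem hasDerivAt_jet (φ : Smooth n) (t : ℝ) (k : ℕ) :
    HasDerivAt (fun t => jet φ t k) (jet φ t (k + 1)) t := by
  have h : Differentiable ℝ (iteratedDeriv k φ.1) :=
    (smooth_contDiff φ).differentiable_iteratedDeriv k (by exact_mod_cast WithTop.coe_lt_top _)
  have := (h t).hasDerivAt
  rwa [← iteratedDeriv_succ] at this

theorem jet_eq_zero_of_eventually {φ : Smooth n} {t : ℝ} (h : ∀ᶠ s in 𝓝 t, φ.1 s = 0) (k : ℕ) :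
    jet φ t k = 0 := by
  have h' : φ.1 =ᶠ[𝓝 t] fun _ => 0 := h
  rw [jet, h'.iteratedDeriv_eq]
  simp

theorem jet_testFunction {a b : ℝ} {φ : Smooth n} (hφ : IsTestFunction a b φ.1) {t : ℝ}
    (ht : t ∉ Set.Ioo a b) (k : ℕ) : jet φ t k = 0 :=
  jet_eq_zero_of_eventually (notMem_tsupport_iff_eventuallyEq.1 fun h => ht (hφ.2.2 h)) k

/-- For fixed `k` the `j`-th summand has derivative `T j - T (j + 1)` with `T j = (-1)^j ⟪p_k
φ^(k-j), ψ^(j)⟫`. The sum telescopes to `T 0`, a term of `⟪p φ, ψ⟫`, and `T k`, which becomes a term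
of `⟪φ, p† ψ⟫` after moving `p_k` to the other side. -/
theorem hasDerivAt_concomitant {m : ℕ} {p : MatPoly n} (hp : p.natDegree ≤ m) (φ ψ : Smooth n)
    (t : ℝ) :
    HasDerivAt (fun t => concomitant m p (jet φ t) (jet ψ t))
      (inner ℂ ((diffOp p φ).1 t) (ψ.1 t) - inner ℂ (φ.1 t) ((diffOp (dag p) ψ).1 t)) t := by
  have h : ∀ k ∈ Finset.range (m + 1), ∀ j ∈ Finset.range k, HasDerivAt
      (fun t => (-1 : ℂ) ^ j * inner ℂ (Matrix.toEuclideanLin (p.coeff k) (jet φ t (k - 1 - j)))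
        (jet ψ t j))
      ((-1 : ℂ) ^ j * inner ℂ (Matrix.toEuclideanLin (p.coeff k) (jet φ t (k - j))) (jet ψ t j) -
        (-1 : ℂ) ^ (j + 1) * inner ℂ (Matrix.toEuclideanLin (p.coeff k) (jet φ t (k - (j + 1))))
          (jet ψ t (j + 1))) t := by
    intro k _ j hj
    have hj' := Finset.mem_range.1 hj
    have h1 := (hasDerivAt_toEuclideanLin (p.coeff k) (hasDerivAt_jet φ t (k - 1 - j))).inner ℂ
      (hasDerivAt_jet ψ t j)
    have e1 : k - 1 - j + 1 = k - j := by omega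
    have e2 : k - 1 - j = k - (j + 1) := by omega
    rw [e1] at h1
    refine (h1.const_mul ((-1 : ℂ) ^ j)).congr_deriv ?_
    rw [e2, pow_succ]
    ring
  refine (HasDerivAt.fun_sum fun k hk => HasDerivAt.fun_sum (h k hk)).congr_deriv ?_
  rw [diffOp_apply_of_lt (Nat.lt_succ_of_le hp),
    diffOp_apply_of_lt (Nat.lt_succ_of_le ((dag_natDegree_le p).trans hp)), sum_inner, inner_sum,
    ← Finset.sum_sub_distrib]
  refine Finset.sum_congr rfl fun k _ => ?_
  rw [Finset.sum_range_sub' (fun j => (-1 : ℂ) ^ j *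
    inner ℂ (Matrix.toEuclideanLin (p.coeff k) (jet φ t (k - j))) (jet ψ t j)), dag_coeff,
    inner_toEuclideanLin_left _ _ (jet ψ t k)]
  simp only [jet, pow_zero, one_mul, Nat.sub_zero, iteratedDeriv_zero, Nat.sub_self, map_smul,
    LinearMap.smul_apply, inner_smul_right]

theorem integral_lagrange {m : ℕ} {p : MatPoly n} (hp : p.natDegree ≤ m) (φ ψ : Smooth n)
    (s t : ℝ) :
    ∫ x in s..t, (inner ℂ ((diffOp p φ).1 x) (ψ.1 x) - inner ℂ (φ.1 x) ((diffOp (dag p) ψ).1 x)) =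
      concomitant m p (jet φ t) (jet ψ t) - concomitant m p (jet φ s) (jet ψ s) := by
  refine intervalIntegral.integral_eq_sub_of_hasDerivAt
    (fun x _ => hasDerivAt_concomitant hp φ ψ x) (Continuous.intervalIntegrable ?_ _ _)
  exact ((smooth_continuous _).inner (smooth_continuous _)).sub
    ((smooth_continuous _).inner (smooth_continuous _))

theorem concomitant_zero_right (m : ℕ) (p : MatPoly n) (u : ℕ → Vec n) {v : ℕ → Vec n}
    (hv : ∀ k, v k = 0) : concomitant m p u v = 0 := by
  simp [concomitant, hv]

theorem concomitant_zero_left (m : ℕ) (p : MatPoly n) {u : ℕ → Vec n} (v : ℕ → Vec n)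
    (hu : ∀ k, u k = 0) : concomitant m p u v = 0 := by
  simp [concomitant, hu]

theorem concomitant_congr {m : ℕ} (p : MatPoly n) {u u' v v' : ℕ → Vec n}
    (hu : ∀ k < m, u k = u' k) (hv : ∀ k < m, v k = v' k) :
    concomitant m p u v = concomitant m p u' v' := by
  refine Finset.sum_congr rfl fun k hk => Finset.sum_congr rfl fun j hj => ?_
  rw [Finset.mem_range] at hk hj
  rw [hu _ (by omega), hv _ (by omega)]

theorem inner_diffOp_sub_inner_dag {a b : ℝ} (hab : a ≤ b) {m : ℕ} {p : MatPoly n}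
    (hp : p.natDegree ≤ m) (φ ψ : Smooth n) :
    inner ℂ (toL2 a b (diffOp p φ)) (toL2 a b ψ) -
        inner ℂ (toL2 a b φ) (toL2 a b (diffOp (dag p) ψ)) =
      concomitant m p (jet φ b) (jet ψ b) - concomitant m p (jet φ a) (jet ψ a) := by
  rw [← integral_lagrange hp, inner_toL2_toL2 _ _ hab, inner_toL2_toL2 _ _ hab,
    intervalIntegral.integral_sub] <;>
  exact ((smooth_continuous _).inner (smooth_continuous _)).intervalIntegrable _ _

end Lagrange

/-! ### Maximal operators: uniqueness of values and closedness -/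

section MaximalOperator

variable (a b : ℝ) {n : ℕ}

/-- The maximal operator of the differential expression `p`, given by its graph. -/
def maxOp (p : MatPoly n) : Submodule ℂ (L2 a b n × L2 a b n) where
  carrier := {q | ∀ φ : Smooth n, IsTestFunction a b φ.1 →
    inner ℂ q.2 (toL2 a b φ) = inner ℂ q.1 (toL2 a b (diffOp (dag p) φ))}
  add_mem' := fun h₁ h₂ φ hφ => by
    simp only [Prod.fst_add, Prod.snd_add, inner_add_left, h₁ φ hφ, h₂ φ hφ]
  zero_mem' := fun φ _ => by simp
  smul_mem' := fun c q h φ hφ => by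
    simp only [Prod.smul_fst, Prod.smul_snd, inner_smul_left, h φ hφ]

variable {a b}

theorem mem_maxOp {p : MatPoly n} {q : L2 a b n × L2 a b n} :
    q ∈ maxOp a b p ↔ ∀ φ : Smooth n, IsTestFunction a b φ.1 →
      inner ℂ q.2 (toL2 a b φ) = inner ℂ q.1 (toL2 a b (diffOp (dag p) φ)) := Iff.rfl

theorem toL2_mem_maxOp (hab : a ≤ b) (p : MatPoly n) (φ : Smooth n) :
    (toL2 a b φ, toL2 a b (diffOp p φ)) ∈ maxOp a b p := by
  intro ψ hψ
  rw [← sub_eq_zero, inner_diffOp_sub_inner_dag hab le_rfl,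
    concomitant_zero_right _ _ _ (jet_testFunction hψ (by simp)),
    concomitant_zero_right _ _ _ (jet_testFunction hψ (by simp)), sub_zero]

theorem maxOp_unique {p : MatPoly n} {x f f' : L2 a b n} (h : (x, f) ∈ maxOp a b p)
    (h' : (x, f') ∈ maxOp a b p) : f = f' := by
  rw [← sub_eq_zero]
  refine eq_zero_of_inner_testFunction a b fun φ hφ => ?_
  rw [inner_sub_left, h φ hφ, h' φ hφ, sub_self]

theorem maxOp_closed {p : MatPoly n} {x f : ℕ → L2 a b n} {x₀ f₀ : L2 a b n}
    (h : ∀ j, (x j, f j) ∈ maxOp a b p) (hx : Tendsto x atTop (𝓝 x₀))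
    (hf : Tendsto f atTop (𝓝 f₀)) : (x₀, f₀) ∈ maxOp a b p := by
  intro φ hφ
  have h1 := hf.inner (𝕜 := ℂ) (tendsto_const_nhds (x := toL2 a b φ))
  have h2 := hx.inner (𝕜 := ℂ) (tendsto_const_nhds (x := toL2 a b (diffOp (dag p) φ)))
  exact tendsto_nhds_unique h1 (h2.congr fun j => (h j φ hφ).symm)

end MaximalOperator

/-! ### Smooth functions with prescribed derivatives at the endpoints -/

section PrescribedJets

variable {n : ℕ}

/-- One integration per order: the function is `u 0` plus the primitive, vanishing at `c`, of a
smooth function with the shifted jet. -/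
theorem exists_smooth_jet (c : ℝ) (m : ℕ) (u : ℕ → Vec n) :
    ∃ φ : Smooth n, ∀ k < m, jet φ c k = u k := by
  induction m generalizing u with
  | zero => exact ⟨0, by simp⟩
  | succ m ih =>
    obtain ⟨ψ, hψ⟩ := ih fun k => u (k + 1)
    have hd : ∀ t, HasDerivAt (fun t => u 0 + ∫ s in c..t, ψ.1 s) (ψ.1 t) t := fun t =>
      ((smooth_continuous ψ).integral_hasStrictDerivAt c t).hasDerivAt.const_add _
    have hderiv : deriv (fun t => u 0 + ∫ s in c..t, ψ.1 s) = ψ.1 := funext fun t => (hd t).deriv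
    refine ⟨⟨fun t => u 0 + ∫ s in c..t, ψ.1 s, contDiff_infty_iff_deriv.2
      ⟨fun t => (hd t).differentiableAt, by rw [hderiv]; exact smooth_contDiff ψ⟩⟩, fun k hk => ?_⟩
    cases k with
    | zero => simp [jet]
    | succ k =>
      rw [jet, iteratedDeriv_succ', hderiv]
      exact hψ k (by omega)

theorem jet_congr_of_eventually {φ ψ : Smooth n} {t : ℝ} (h : ∀ᶠ s in 𝓝 t, φ.1 s = ψ.1 s)
    (k : ℕ) : jet φ t k = jet ψ t k :=
  Filter.EventuallyEq.iteratedDeriv_eq k h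

theorem exists_smooth_jet_right {a b : ℝ} (hab : a < b) (m : ℕ) (u : ℕ → Vec n) :
    ∃ φ : Smooth n, (∀ k < m, jet φ b k = u k) ∧ ∀ t < a + (b - a) / 3, φ.1 t = 0 := by
  obtain ⟨ψ, hψ⟩ := exists_smooth_jet b m u
  -- The cut-off vanishes on the left third of the interval and is one on the right third. The room
  -- of a third near `a` is needed later, when these functions are translated.
  have hχ : ContDiff ℝ ∞ fun t : ℝ => Real.smoothTransition (3 * (t - a) / (b - a) - 1) :=
    Real.smoothTransition.contDiff.comp (by fun_prop)
  have hba : 0 < b - a := sub_pos.2 hab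
  refine ⟨⟨fun t => Real.smoothTransition (3 * (t - a) / (b - a) - 1) • ψ.1 t,
    hχ.smul (smooth_contDiff ψ)⟩, fun k hk => ?_, fun t ht => ?_⟩
  · rw [← hψ k hk]
    refine jet_congr_of_eventually ?_ k
    filter_upwards [lt_mem_nhds (show a + 2 * (b - a) / 3 < b by linarith)] with t ht
    have : 1 ≤ 3 * (t - a) / (b - a) - 1 := by
      rw [le_sub_iff_add_le, le_div_iff₀ hba]; linarith
    simp [Real.smoothTransition.one_of_one_le this]
  · have : 3 * (t - a) / (b - a) - 1 ≤ 0 := by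
      rw [sub_nonpos, div_le_one hba]; linarith
    simp [Real.smoothTransition.zero_of_nonpos this]

theorem exists_smooth_jet_left {a b : ℝ} (hab : a < b) (m : ℕ) (u : ℕ → Vec n) :
    ∃ φ : Smooth n, (∀ k < m, jet φ a k = u k) ∧ ∀ t > b - (b - a) / 3, φ.1 t = 0 := by
  obtain ⟨ψ, hψ⟩ := exists_smooth_jet a m u
  have hχ : ContDiff ℝ ∞ fun t : ℝ => Real.smoothTransition (3 * (b - t) / (b - a) - 1) :=
    Real.smoothTransition.contDiff.comp (by fun_prop)
  have hba : 0 < b - a := sub_pos.2 hab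
  refine ⟨⟨fun t => Real.smoothTransition (3 * (b - t) / (b - a) - 1) • ψ.1 t,
    hχ.smul (smooth_contDiff ψ)⟩, fun k hk => ?_, fun t ht => ?_⟩
  · rw [← hψ k hk]
    refine jet_congr_of_eventually ?_ k
    filter_upwards [gt_mem_nhds (show a < b - 2 * (b - a) / 3 by linarith)] with t ht
    have : 1 ≤ 3 * (b - t) / (b - a) - 1 := by
      rw [le_sub_iff_add_le, le_div_iff₀ hba]; linarith
    simp [Real.smoothTransition.one_of_one_le this]
  · have : 3 * (b - t) / (b - a) - 1 ≤ 0 := by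
      rw [sub_nonpos, div_le_one hba]; linarith
    simp [Real.smoothTransition.zero_of_nonpos this]

theorem jet_eq_smoothDeriv_pow (φ : Smooth n) (t : ℝ) (k : ℕ) :
    jet φ t k = ((smoothDeriv n ^ k) φ).1 t := by
  rw [jet, smoothDeriv_pow_apply]

theorem jet_add (φ ψ : Smooth n) (t : ℝ) (k : ℕ) : jet (φ + ψ) t k = jet φ t k + jet ψ t k := by
  rw [jet_eq_smoothDeriv_pow, jet_eq_smoothDeriv_pow, jet_eq_smoothDeriv_pow, map_add]
  rfl

theorem jet_smul (c : ℂ) (φ : Smooth n) (t : ℝ) (k : ℕ) : jet (c • φ) t k = c • jet φ t k := by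
  rw [jet_eq_smoothDeriv_pow, jet_eq_smoothDeriv_pow, map_smul]
  rfl

theorem exists_smooth_jets {a b : ℝ} (hab : a < b) (m : ℕ) (u v : ℕ → Vec n) :
    ∃ φ : Smooth n, (∀ k < m, jet φ b k = u k) ∧ ∀ k < m, jet φ a k = v k := by
  obtain ⟨φ, hφ, hφ'⟩ := exists_smooth_jet_right hab m u
  obtain ⟨ψ, hψ, hψ'⟩ := exists_smooth_jet_left hab m v
  refine ⟨φ + ψ, fun k hk => ?_, fun k hk => ?_⟩
  · rw [jet_add, hφ k hk, jet_eq_zero_of_eventually (φ := ψ), add_zero]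
    filter_upwards [lt_mem_nhds (show b - (b - a) / 3 < b by linarith)] with t ht using hψ' t ht
  · rw [jet_add, hψ k hk, jet_eq_zero_of_eventually (φ := φ), zero_add]
    filter_upwards [gt_mem_nhds (show a < a + (b - a) / 3 by linarith)] with t ht using hφ' t ht

end PrescribedJets

/-! ### Mollifiers converge in `L²` -/

section Mollification

variable {E : Type*} [NormedAddCommGroup E] [NormedSpace ℝ E]

/-- Jensen's inequality for the square, obtained from `L¹ ≤ L²` on a probability space. -/
theorem enorm_integral_sq_le_lintegral {α : Type*} [MeasurableSpace α] {ν : Measure α}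
    [IsProbabilityMeasure ν] {h : α → E} (hh : AEStronglyMeasurable h ν) :
    ‖∫ s, h s ∂ν‖ₑ ^ 2 ≤ ∫⁻ s, ‖h s‖ₑ ^ 2 ∂ν := by
  have h1 : ‖∫ s, h s ∂ν‖ₑ ≤ eLpNorm h 2 ν :=
    (enorm_integral_le_lintegral_enorm h).trans (eLpNorm_one_eq_lintegral_enorm.symm.le.trans
      (eLpNorm_le_eLpNorm_of_exponent_le (by norm_num) hh))
  have h2 : eLpNorm h 2 ν ^ 2 = ∫⁻ s, ‖h s‖ₑ ^ 2 ∂ν := by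
    have := eLpNorm_nnreal_pow_eq_lintegral (f := h) (μ := ν) (p := 2) (by norm_num)
    simpa using this
  rw [← h2]
  gcongr

/-- The mollification `ρ ⋆ f`. -/
def moll (ρ : ℝ → ℝ) (f : ℝ → E) : ℝ → E :=
  convolution ρ f (ContinuousLinearMap.lsmul ℝ ℝ) volume

theorem moll_apply_swap (ρ : ℝ → ℝ) (f : ℝ → E) (t : ℝ) :
    moll ρ f t = ∫ s, ρ (t - s) • f s := by
  rw [moll, convolution_eq_swap]
  rfl

/-- Since the kernel has mass one, `f t` is itself an average over the kernel. Writing the error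
against a probability measure prepares for Jensen's inequality. -/
theorem moll_sub_self [CompleteSpace E] {ρ : ℝ → ℝ} (hρ : Continuous ρ) (hc : HasCompactSupport ρ) (h0 : ∀ s, 0 ≤ ρ s)
    (h1 : ∫ s, ρ s = 1) {f : ℝ → E} (hf : LocallyIntegrable f volume) (t : ℝ) :
    moll ρ f t - f t =
      ∫ s, (f (t - s) - f t) ∂(volume.withDensity fun s => ENNReal.ofReal (ρ s)) := by
  rw [integral_withDensity_eq_integral_toReal_smul₀ (by fun_prop) (by simp)]
  have e : ∀ s, (ENNReal.ofReal (ρ s)).toReal = ρ s := fun s => ENNReal.toReal_ofReal (h0 s)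
  simp only [e, smul_sub]
  rw [integral_sub, integral_smul_const, h1, one_smul]
  · rfl
  · exact hc.convolutionExists_left (ContinuousLinearMap.lsmul ℝ ℝ) hρ hf t
  · exact (hρ.integrable_of_hasCompactSupport hc).smul_const _

theorem isProbabilityMeasure_withDensity {ρ : ℝ → ℝ} (hρ : Continuous ρ)
    (hc : HasCompactSupport ρ) (h0 : ∀ s, 0 ≤ ρ s) (h1 : ∫ s, ρ s = 1) :
    IsProbabilityMeasure (volume.withDensity fun s => ENNReal.ofReal (ρ s)) := by
  constructor
  rw [withDensity_apply _ MeasurableSet.univ, Measure.restrict_univ,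
    ← ofReal_integral_eq_lintegral_ofReal (hρ.integrable_of_hasCompactSupport hc)
      (Eventually.of_forall h0), h1, ENNReal.ofReal_one]

/-- Jensen for each `t`, then Tonelli: the squared error is at most the average over `s` of the
squared translation errors, and only `s` in the support of the kernel count. -/
theorem eLpNorm_moll_sub_le [CompleteSpace E] {ρ : ℝ → ℝ} (hρ : Continuous ρ) (hc : HasCompactSupport ρ)
    (h0 : ∀ s, 0 ≤ ρ s) (h1 : ∫ s, ρ s = 1) {f : ℝ → E} (hf : LocallyIntegrable f volume)
    (hm : StronglyMeasurable f) {C : ENNReal}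
    (hC : ∀ s ∈ Function.support ρ, eLpNorm (fun t => f (t - s) - f t) 2 volume ≤ C) :
    eLpNorm (moll ρ f - f) 2 volume ≤ C := by
  set ν := volume.withDensity fun s => ENNReal.ofReal (ρ s) with hν
  have := isProbabilityMeasure_withDensity hρ hc h0 h1
  have hsq : ∀ g : ℝ → E, eLpNorm g 2 volume ^ 2 = ∫⁻ s, ‖g s‖ₑ ^ 2 := fun g => by
    have := eLpNorm_nnreal_pow_eq_lintegral (f := g) (μ := volume) (p := 2) (by norm_num)
    simpa using this
  have hmeas : StronglyMeasurable (Function.uncurry fun t s : ℝ => f (t - s) - f t) :=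
    (hm.comp_measurable (measurable_fst.sub measurable_snd)).sub
      (hm.comp_measurable measurable_fst)
  refine (ENNReal.pow_le_pow_left_iff two_ne_zero).1 ?_
  calc eLpNorm (moll ρ f - f) 2 volume ^ 2
      = ∫⁻ t, ‖∫ s, (f (t - s) - f t) ∂ν‖ₑ ^ 2 := by
        rw [hsq]
        refine lintegral_congr fun t => ?_
        rw [Pi.sub_apply, moll_sub_self hρ hc h0 h1 hf]
    _ ≤ ∫⁻ t, ∫⁻ s, ‖f (t - s) - f t‖ₑ ^ 2 ∂ν := by
        refine lintegral_mono fun t => enorm_integral_sq_le_lintegral ?_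
        exact (hmeas.comp_measurable measurable_prodMk_left).aestronglyMeasurable
    _ = ∫⁻ s, ∫⁻ t, ‖f (t - s) - f t‖ₑ ^ 2 ∂volume ∂ν :=
        lintegral_lintegral_swap (hmeas.enorm.pow_const 2).aemeasurable
    _ ≤ ∫⁻ _, C ^ 2 ∂ν := by
        refine lintegral_mono_ae ?_
        have : ∀ᵐ s ∂ν, ρ s ≠ 0 := by
          rw [hν, ae_withDensity_iff (by fun_prop)]
          refine Eventually.of_forall fun s hs h => hs ?_
          rw [h, ENNReal.ofReal_zero]
        filter_upwards [this] with s hs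
        rw [← hsq]
        gcongr
        exact hC s hs
    _ = C ^ 2 := by simp

/-- Translations form a continuous family of measure-preserving maps, and composition with such a
family is continuous in `L²`. -/
theorem tendsto_eLpNorm_translate_sub {F : Type*} [NormedAddCommGroup F] {f : ℝ → F} (hf : MemLp f 2 volume) :
    Tendsto (fun s : ℝ => eLpNorm (fun t => f (t - s) - f t) 2 volume) (𝓝 0) (𝓝 0) := by
  let g : ℝ → C(ℝ, ℝ) := fun s => ⟨fun t => t - s, by fun_prop⟩
  have hg : Continuous g := ContinuousMap.continuous_of_continuous_uncurry _ (by
    change Continuous fun p : ℝ × ℝ => p.2 - p.1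
    fun_prop)
  have hgm : ∀ s, MeasurePreserving (g s) volume volume := fun s =>
    measurePreserving_sub_right volume s
  have h := (tendsto_const_nhds (x := hf.toLp f) (f := 𝓝 (0 : ℝ))).compMeasurePreservingLp
    (hg.tendsto 0) hgm (hgm 0) (by norm_num)
  rw [Lp.tendsto_Lp_iff_tendsto_eLpNorm'] at h
  refine h.congr fun s => eLpNorm_congr_ae ?_
  have h1 := Lp.coeFn_compMeasurePreserving (hf.toLp f) (hgm s)
  have h2 := Lp.coeFn_compMeasurePreserving (hf.toLp f) (hgm 0)
  have h3 := (hgm s).quasiMeasurePreserving.ae_eq_comp hf.coeFn_toLp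
  have h4 := (hgm 0).quasiMeasurePreserving.ae_eq_comp hf.coeFn_toLp
  filter_upwards [h1, h2, h3, h4] with t h1 h2 h3 h4
  rw [Pi.sub_apply, h1, h2, h3, h4]
  simp [g]

/-- A sequence of mollifiers. -/
def mollifier (j : ℕ) : ContDiffBump (0 : ℝ) where
  rIn := 1 / (2 * ((j : ℝ) + 1))
  rOut := 1 / ((j : ℝ) + 1)
  rIn_pos := by positivity
  rIn_lt_rOut := by
    have : (0 : ℝ) < j + 1 := by positivity
    exact one_div_lt_one_div_of_lt this (by linarith)

/-- The kernel of the `j`-th mollifier. -/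
def kernel (j : ℕ) : ℝ → ℝ := (mollifier j).normed volume

theorem kernel_contDiff (j : ℕ) : ContDiff ℝ ∞ (kernel j) := (mollifier j).contDiff_normed

theorem kernel_compactSupport (j : ℕ) : HasCompactSupport (kernel j) :=
  (mollifier j).hasCompactSupport_normed

theorem kernel_support (j : ℕ) :
    tsupport (kernel j) = Metric.closedBall 0 (1 / ((j : ℝ) + 1)) :=
  (mollifier j).tsupport_normed_eq

theorem tendsto_eLpNorm_moll_sub [CompleteSpace E] {f : ℝ → E} (hf : MemLp f 2 volume) (hm : StronglyMeasurable f) :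
    Tendsto (fun j => eLpNorm (moll (kernel j) f - f) 2 volume) atTop (𝓝 0) := by
  rw [ENNReal.tendsto_nhds_zero]
  intro ε hε
  have h := (ENNReal.tendsto_nhds_zero.1 (tendsto_eLpNorm_translate_sub hf)) ε hε
  obtain ⟨r, hr, hr'⟩ := Metric.eventually_nhds_iff.1 h
  filter_upwards [(tendsto_one_div_add_atTop_nhds_zero_nat (𝕜 := ℝ)).eventually (gt_mem_nhds hr)]
    with j hj
  refine eLpNorm_moll_sub_le (kernel_contDiff j).continuous (kernel_compactSupport j)
    (fun s => (mollifier j).nonneg_normed s) ((mollifier j).integral_normed)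
    (hf.locallyIntegrable (by norm_num)) hm fun s hs => hr' ?_
  have hs' : s ∈ Metric.closedBall (0 : ℝ) (1 / ((j : ℝ) + 1)) :=
    kernel_support j ▸ subset_tsupport _ hs
  exact (Metric.mem_closedBall.1 hs').trans_lt hj

end Mollification

/-! ### Mollification of `L²` functions and differential expressions -/

section MollifyL2

variable {a b : ℝ} {n : ℕ}

/-- The extension by zero of an element of `L²(a, b; ℂⁿ)`. -/
def zeroExt (g : L2 a b n) : ℝ → Vec n := Set.indicator (Set.Ioo a b) g

theorem zeroExt_stronglyMeasurable (g : L2 a b n) : StronglyMeasurable (zeroExt g) :=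
  (Lp.stronglyMeasurable g).indicator measurableSet_Ioo

theorem zeroExt_memLp (g : L2 a b n) : MemLp (zeroExt g) 2 volume :=
  (memLp_indicator_iff_restrict measurableSet_Ioo).2 (Lp.memLp g)

theorem zeroExt_locallyIntegrable (g : L2 a b n) : LocallyIntegrable (zeroExt g) volume :=
  (zeroExt_memLp g).locallyIntegrable (by norm_num)

theorem hasCompactSupport_iteratedDeriv {ρ : ℝ → ℝ} (hc : HasCompactSupport ρ) (k : ℕ) :
    HasCompactSupport (iteratedDeriv k ρ) := by
  induction k with
  | zero => simpa using hc
  | succ k ih => rw [iteratedDeriv_succ]; exact ih.deriv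

theorem contDiff_iteratedDeriv {ρ : ℝ → ℝ} (hρ : ContDiff ℝ ∞ ρ) (k : ℕ) :
    ContDiff ℝ ∞ (iteratedDeriv k ρ) := by
  induction k with
  | zero => simpa using hρ
  | succ k ih => rw [iteratedDeriv_succ]; exact (contDiff_infty_iff_deriv.1 ih).2

/-- The mollification of an element of `L²(a, b; ℂⁿ)`. -/
def mollSmooth (j : ℕ) (g : L2 a b n) : Smooth n :=
  ⟨moll (kernel j) (zeroExt g), (kernel_compactSupport j).contDiff_convolution_left _
    (kernel_contDiff j) (zeroExt_locallyIntegrable g)⟩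

theorem jet_mollSmooth (j : ℕ) (g : L2 a b n) (t : ℝ) (k : ℕ) :
    jet (mollSmooth j g) t k = moll (iteratedDeriv k (kernel j)) (zeroExt g) t := by
  rw [jet]
  revert t
  rw [← funext_iff]
  induction k with
  | zero => simp [mollSmooth]
  | succ k ih =>
    rw [iteratedDeriv_succ, ih]
    funext t
    rw [iteratedDeriv_succ]
    exact ((hasCompactSupport_iteratedDeriv (kernel_compactSupport j) k).hasDerivAt_convolution_left _
      ((contDiff_iteratedDeriv (kernel_contDiff j) k).of_le (by exact_mod_cast le_top))
      (zeroExt_locallyIntegrable g) t).deriv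

theorem tendsto_toL2_mollSmooth (g : L2 a b n) :
    Tendsto (fun j => toL2 a b (mollSmooth j g)) atTop (𝓝 g) := by
  rw [Lp.tendsto_Lp_iff_tendsto_eLpNorm']
  refine tendsto_of_tendsto_of_tendsto_of_le_of_le tendsto_const_nhds
    (tendsto_eLpNorm_moll_sub (zeroExt_memLp g) (zeroExt_stronglyMeasurable g))
    (fun _ => zero_le) fun j => ?_
  refine le_trans (le_of_eq (eLpNorm_congr_ae ?_))
    (eLpNorm_mono_measure _ (Measure.restrict_le_self (s := Set.Ioo a b)))
  filter_upwards [coeFn_toL2 a b (mollSmooth j g), ae_restrict_mem measurableSet_Ioo] with t h1 h2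
  rw [Pi.sub_apply, h1, Pi.sub_apply, zeroExt, Set.indicator_of_mem h2]
  rfl

/-- The function `s ↦ ρ_j (t - s) v`. -/
def kernelVec (j : ℕ) (t : ℝ) (v : Vec n) : Smooth n :=
  ⟨fun s => kernel j (t - s) • v,
    ((kernel_contDiff j).comp (contDiff_const.sub contDiff_id)).smul contDiff_const⟩

theorem jet_kernelVec (j : ℕ) (t : ℝ) (v : Vec n) (s : ℝ) (k : ℕ) :
    jet (kernelVec j t v) s k = ((-1 : ℝ) ^ k * iteratedDeriv k (kernel j) (t - s)) • v := by
  rw [jet, kernelVec, iteratedDeriv_smul_const]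
  · rw [iteratedDeriv_comp_const_sub]; rfl
  · exact (((kernel_contDiff j).comp (contDiff_const.sub contDiff_id)).of_le
      (by exact_mod_cast le_top)).contDiffAt

theorem integrable_smul_L2 {ρ : ℝ → ℝ} (hρ : Continuous ρ) (g : L2 a b n) :
    Integrable (fun s => ρ s • g s) (volume.restrict (Set.Ioo a b)) :=
  memLp_one_iff_integrable.1 ((Lp.memLp g).smul (memLp_of_continuous a b hρ))

/-- The signs from differentiating `ρ_j (t - s)` in `s` cancel those in `dag`. The identity holds
for every real `t`, because `g` is extended by zero and nothing is required of the support of the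
kernel. -/
theorem inner_diffOp_dag_kernelVec (p : MatPoly n) (j : ℕ) (g : L2 a b n) (t : ℝ) (v : Vec n) :
    inner ℂ g (toL2 a b (diffOp (dag p) (kernelVec j t v))) =
      inner ℂ ((diffOp p (mollSmooth j g)).1 t) v := by
  have hcont : ∀ k, Continuous fun s => iteratedDeriv k (kernel j) (t - s) := fun k =>
    (contDiff_iteratedDeriv (kernel_contDiff j) k).continuous.comp (continuous_const.sub continuous_id)
  rw [inner_toL2_right, diffOp_apply_of_lt (Nat.lt_succ_self _), sum_inner]
  have h : ∀ s, inner ℂ (g s) ((diffOp (dag p) (kernelVec j t v)).1 s) =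
      ∑ k ∈ Finset.range (p.natDegree + 1),
        inner ℂ (iteratedDeriv k (kernel j) (t - s) • g s)
          (Matrix.toEuclideanLin (p.coeff k)ᴴ v) := by
    intro s
    rw [diffOp_apply_of_lt (Nat.lt_succ_of_le (dag_natDegree_le p)), inner_sum]
    refine Finset.sum_congr rfl fun k _ => ?_
    have e := jet_kernelVec j t v s k
    rw [jet] at e
    rw [e, dag_coeff, ← Complex.coe_smul, ← Complex.coe_smul, inner_smul_left]
    simp only [map_smul, LinearMap.smul_apply, inner_smul_right, Complex.conj_ofReal]
    push_cast
    rw [mul_right_comm, ← mul_assoc, ← mul_pow, mul_comm]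
    simp
  simp only [h]
  rw [integral_finsetSum]
  · refine Finset.sum_congr rfl fun k _ => ?_
    have h1 := integral_inner (𝕜 := ℂ) (integrable_smul_L2 (hcont k) g)
      (Matrix.toEuclideanLin (p.coeff k)ᴴ v)
    have e := jet_mollSmooth j g t k
    rw [jet] at e
    rw [e, moll_apply_swap, inner_toEuclideanLin_left]
    have h2 : ∫ s, iteratedDeriv k (kernel j) (t - s) • zeroExt g s =
        ∫ s in Set.Ioo a b, iteratedDeriv k (kernel j) (t - s) • g s := by
      rw [← integral_indicator measurableSet_Ioo]
      refine integral_congr_ae (Eventually.of_forall fun s => ?_)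
      by_cases hs : s ∈ Set.Ioo a b <;> simp [zeroExt, hs]
    rw [h2, ← inner_conj_symm, ← h1, ← integral_conj]
    simp only [inner_conj_symm]
  · intro k _
    exact (integrable_smul_L2 (hcont k) g).inner_const _

theorem kernelVec_isTestFunction {j : ℕ} {t : ℝ} (ht : a + 1 / ((j : ℝ) + 1) < t)
    (ht' : t < b - 1 / ((j : ℝ) + 1)) (v : Vec n) : IsTestFunction a b (kernelVec j t v).1 := by
  have hs : tsupport (kernelVec j t v).1 ⊆ Metric.closedBall t (1 / ((j : ℝ) + 1)) := by
    refine closure_minimal (fun s hs => ?_) Metric.isClosed_closedBall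
    have h1 : kernel j (t - s) ≠ 0 := fun h => hs (by simp [kernelVec, h])
    have h2 : t - s ∈ Metric.closedBall (0 : ℝ) (1 / ((j : ℝ) + 1)) :=
      kernel_support j ▸ subset_tsupport _ h1
    rwa [mem_closedBall_zero_iff, ← dist_eq_norm, dist_comm] at h2
  refine ⟨smooth_contDiff _, HasCompactSupport.of_support_subset_isCompact
    (isCompact_closedBall t _) (subset_closure.trans hs), hs.trans fun s hs => ?_⟩
  rw [Metric.mem_closedBall, Real.dist_eq, abs_le] at hs
  constructor <;> linarith [hs.1, hs.2]

/-- At distance more than `1 / (j + 1)` from the endpoints the translated kernel is a test function,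
so the weak equation can be tested with it. -/
theorem diffOp_mollSmooth {p : MatPoly n} {x f : L2 a b n} (h : (x, f) ∈ maxOp a b p) {j : ℕ}
    {t : ℝ} (ht : a + 1 / ((j : ℝ) + 1) < t) (ht' : t < b - 1 / ((j : ℝ) + 1)) :
    (diffOp p (mollSmooth j x)).1 t = (mollSmooth j f).1 t := by
  refine ext_inner_right ℂ fun v => ?_
  have h1 := h _ (kernelVec_isTestFunction ht ht' v)
  rw [inner_diffOp_dag_kernelVec] at h1
  rw [← h1]
  -- The side of `f` is the same identity for the differential expression `1`.
  have h2 := inner_diffOp_dag_kernelVec 1 j f t v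
  rw [dag_one, map_one] at h2
  exact h2

end MollifyL2

/-! ### Factorization of sesquilinear forms through a generalized inverse -/

section RankFactorization

/-- A generalized inverse is a linear extension to `W` of a section of `f` over its range. -/
theorem exists_comp_comp_self {K V W : Type*} [Field K] [AddCommGroup V] [Module K V]
    [AddCommGroup W] [Module K W] (f : V →ₗ[K] W) : ∃ g : W →ₗ[K] V, f ∘ₗ g ∘ₗ f = f := by
  obtain ⟨g, hg⟩ := f.rangeRestrict.exists_rightInverse_of_surjective f.range_rangeRestrict
  obtain ⟨h, hh⟩ := LinearMap.exists_extend g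
  refine ⟨h, LinearMap.ext fun x => ?_⟩
  have h1 : h (f x) = g (f.rangeRestrict x) := by rw [← hh]; rfl
  have h2 := LinearMap.congr_fun hg (f.rangeRestrict x)
  rw [LinearMap.comp_apply, LinearMap.comp_apply, h1]
  exact congrArg Subtype.val h2

theorem exists_matrix_mul_mul_self {p q : Type*} [Fintype p] [Fintype q] [DecidableEq p]
    [DecidableEq q] (M : Matrix p q ℂ) : ∃ G : Matrix q p ℂ, M * G * M = M := by
  obtain ⟨g, hg⟩ := exists_comp_comp_self M.toLin'
  refine ⟨g.toMatrix', Matrix.toLin'.injective ?_⟩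
  rw [Matrix.toLin'_mul, Matrix.toLin'_mul, Matrix.toLin'_toMatrix', LinearMap.comp_assoc, hg]

/-- Insert `M = M G M` for the Gram matrix `M` in two bases. No nondegeneracy is needed. The point
is that `x` and `y` are separated: the form is recovered from its values against fixed vectors only.
-/
theorem exists_rank_factorization {U V : Type*} [AddCommGroup U] [Module ℂ U]
    [FiniteDimensional ℂ U] [AddCommGroup V] [Module ℂ V] [FiniteDimensional ℂ V]
    (β : U →ₗ⋆[ℂ] V →ₗ[ℂ] ℂ) :
    ∃ (c d : ℕ) (u : Fin d → U) (v : Fin c → V) (g : Fin c → Fin d → ℂ),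
      ∀ x y, β x y = ∑ i, ∑ j, g i j * β x (v i) * β (u j) y := by
  let bU := Module.finBasis ℂ U
  let bV := Module.finBasis ℂ V
  obtain ⟨G, hG⟩ := exists_matrix_mul_mul_self (Matrix.of fun i j => β (bU i) (bV j))
  refine ⟨_, _, bU, bV, G, fun x y => ?_⟩
  have hx : ∀ y, β x y = ∑ i, starRingEnd ℂ (bU.repr x i) * β (bU i) y := fun y => by
    conv_lhs => rw [← bU.sum_repr x]
    simp only [map_sum, map_smulₛₗ, LinearMap.sum_apply, LinearMap.smul_apply, smul_eq_mul]
  have hy : ∀ x, β x y = ∑ j, bV.repr y j * β x (bV j) := fun x => by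
    conv_lhs => rw [← bV.sum_repr y]
    simp only [map_sum, map_smul, smul_eq_mul]
  have hM : ∀ i j, β (bU i) (bV j) =
      ∑ k, (∑ l, β (bU i) (bV l) * G l k) * β (bU k) (bV j) := fun i j => by
    have := congrFun (congrFun hG i) j
    simpa [Matrix.mul_apply] using this.symm
  calc β x y = ∑ i, starRingEnd ℂ (bU.repr x i) * ∑ j, bV.repr y j * β (bU i) (bV j) := by
        rw [hx]; simp only [← hy]
    _ = ∑ i, starRingEnd ℂ (bU.repr x i) * ∑ j, bV.repr y j *
          ∑ k, (∑ l, β (bU i) (bV l) * G l k) * β (bU k) (bV j) := by simp only [← hM]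
    _ = ∑ i, starRingEnd ℂ (bU.repr x i) *
          ∑ k, (∑ l, β (bU i) (bV l) * G l k) * β (bU k) y := by
        refine Finset.sum_congr rfl fun i _ => congrArg _ ?_
        simp only [hy (bU _), Finset.mul_sum]
        rw [Finset.sum_comm]
        refine Finset.sum_congr rfl fun k _ => Finset.sum_congr rfl fun j _ => ?_
        ring
    _ = ∑ l, ∑ k, G l k * β x (bV l) * β (bU k) y := by
        simp only [hx (bV _), Finset.mul_sum, Finset.sum_mul]
        rw [Finset.sum_comm_cycle]
        refine Finset.sum_congr rfl fun l _ => ?_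
        rw [Finset.sum_comm]
        refine Finset.sum_congr rfl fun k _ => Finset.sum_congr rfl fun i _ => ?_
        ring

end RankFactorization

/-! ### Inner products over subintervals -/

section Restriction

variable {a b : ℝ} {n : ℕ}

/-- The inner product of the restrictions to `(s, t)`. -/
def cutInner (s t : ℝ) (x y : L2 a b n) : ℂ :=
  inner ℂ (LpToLpRestrictCLM ℝ (Vec n) ℂ (volume.restrict (Set.Ioo a b)) 2 (Set.Ioo s t) x)
    (LpToLpRestrictCLM ℝ (Vec n) ℂ (volume.restrict (Set.Ioo a b)) 2 (Set.Ioo s t) y)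

theorem cutInner_eq (s t : ℝ) (x y : L2 a b n) :
    cutInner s t x y = ∫ r in Set.Ioo s t, inner ℂ (x r) (y r) ∂(volume.restrict (Set.Ioo a b)) := by
  rw [cutInner, L2.inner_def]
  refine integral_congr_ae ?_
  filter_upwards [LpToLpRestrictCLM_coeFn ℂ (Set.Ioo s t) x,
    LpToLpRestrictCLM_coeFn ℂ (Set.Ioo s t) y] with r h1 h2
  rw [h1, h2]

theorem tendsto_cutInner (s t : ℝ) {ι : Type*} {l : Filter ι} {x y : ι → L2 a b n} {x₀ y₀ : L2 a b n}
    (hx : Tendsto x l (𝓝 x₀)) (hy : Tendsto y l (𝓝 y₀)) :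
    Tendsto (fun j => cutInner s t (x j) (y j)) l (𝓝 (cutInner s t x₀ y₀)) :=
  (((ContinuousLinearMap.continuous _).tendsto _).comp hx).inner
    (((ContinuousLinearMap.continuous _).tendsto _).comp hy)

theorem cutInner_toL2_congr {s t : ℝ} {φ ψ : Smooth n} (h : ∀ r ∈ Set.Ioo s t, φ.1 r = ψ.1 r)
    (y : L2 a b n) : cutInner s t (toL2 a b φ) y = cutInner s t (toL2 a b ψ) y := by
  rw [cutInner_eq, cutInner_eq]
  refine integral_congr_ae ?_
  filter_upwards [ae_restrict_of_ae (coeFn_toL2 a b φ), ae_restrict_of_ae (coeFn_toL2 a b ψ),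
    ae_restrict_mem measurableSet_Ioo] with r h1 h2 h3
  rw [h1, h2, h r h3]

theorem cutInner_toL2 {s t : ℝ} (has : a ≤ s) (hst : s ≤ t) (htb : t ≤ b) (φ ψ : Smooth n) :
    cutInner s t (toL2 a b φ) (toL2 a b ψ) = ∫ r in s..t, inner ℂ (φ.1 r) (ψ.1 r) := by
  rw [cutInner_eq, intervalIntegral.integral_of_le hst, integral_Ioc_eq_integral_Ioo]
  have e : (volume.restrict (Set.Ioo a b)).restrict (Set.Ioo s t) = volume.restrict (Set.Ioo s t) :=
    Measure.restrict_restrict_of_subset (Set.Ioo_subset_Ioo has htb)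
  rw [← e]
  refine integral_congr_ae ?_
  filter_upwards [ae_restrict_of_ae (coeFn_toL2 a b φ), ae_restrict_of_ae (coeFn_toL2 a b ψ)]
    with r h1 h2
  rw [h1, h2]

/-- For fixed `x₀, y₀` the intervals exhaust `(a, b)` under an integrable function. The remaining
error is uniform in the interval, because restriction is a contraction. -/
theorem tendsto_cutInner_of_tendsto {s t : ℕ → ℝ} (hs : Tendsto s atTop (𝓝 a))
    (ht : Tendsto t atTop (𝓝 b)) {x y : ℕ → L2 a b n} {x₀ y₀ : L2 a b n}
    (hx : Tendsto x atTop (𝓝 x₀)) (hy : Tendsto y atTop (𝓝 y₀)) :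
    Tendsto (fun j => cutInner (s j) (t j) (x j) (y j)) atTop (𝓝 (inner ℂ x₀ y₀)) := by
  have hle : ∀ j (z : L2 a b n), ‖LpToLpRestrictCLM ℝ (Vec n) ℂ (volume.restrict (Set.Ioo a b)) 2
      (Set.Ioo (s j) (t j)) z‖ ≤ ‖z‖ := fun j z => by
    exact norm_Lp_toLp_restrict_le (Set.Ioo (s j) (t j)) z
  have h1 : Tendsto (fun j => cutInner (s j) (t j) x₀ y₀) atTop (𝓝 (inner ℂ x₀ y₀)) := by
    simp only [cutInner_eq]
    rw [L2.inner_def]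
    exact (aecover_Ioo_of_Ioo hs ht).integral_tendsto_of_countably_generated
      (L2.integrable_inner x₀ y₀)
  have h2 : Tendsto (fun j => cutInner (s j) (t j) (x j) (y j) - cutInner (s j) (t j) x₀ y₀) atTop
      (𝓝 0) := by
    have h3 : Tendsto (fun j => ‖x j - x₀‖ * ‖y j‖ + ‖x₀‖ * ‖y j - y₀‖) atTop (𝓝 0) := by
      have h4 := ((tendsto_iff_norm_sub_tendsto_zero.1 hx).mul hy.norm).add
        ((tendsto_iff_norm_sub_tendsto_zero.1 hy).const_mul ‖x₀‖)
      simpa using h4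
    refine squeeze_zero_norm (fun j => ?_) h3
    have e : cutInner (s j) (t j) (x j) (y j) - cutInner (s j) (t j) x₀ y₀ =
        cutInner (s j) (t j) (x j - x₀) (y j) + cutInner (s j) (t j) x₀ (y j - y₀) := by
      simp only [cutInner, map_sub, inner_sub_left, inner_sub_right]
      ring
    rw [e]
    refine (norm_add_le _ _).trans (add_le_add ?_ ?_) <;>
    exact (norm_inner_le_norm _ _).trans (mul_le_mul (hle _ _) (hle _ _) (norm_nonneg _)
      (norm_nonneg _))
  simpa using h2.add h1

end Restriction

/-! ### Translations of smooth functions -/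

section Shift

variable {n : ℕ}

/-- The translate `t ↦ φ (t + r)`. -/
def shift (r : ℝ) (φ : Smooth n) : Smooth n :=
  ⟨fun t => φ.1 (t + r), (smooth_contDiff φ).comp (contDiff_id.add contDiff_const)⟩

theorem jet_shift (r : ℝ) (φ : Smooth n) (t : ℝ) (k : ℕ) : jet (shift r φ) t k = jet φ (t + r) k :=
  congrFun (iteratedDeriv_comp_add_const k φ.1 r) t

theorem diffOp_shift (p : MatPoly n) (r : ℝ) (φ : Smooth n) :
    diffOp p (shift r φ) = shift r (diffOp p φ) := by
  ext1
  funext t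
  rw [diffOp_apply]
  change _ = (diffOp p φ).1 (t + r)
  rw [diffOp_apply]
  exact Finset.sum_congr rfl fun k _ => congrArg _ (jet_shift r φ t k)

theorem tendsto_toL2_shift (a b : ℝ) (φ : Smooth n) {r : ℕ → ℝ} (hr : Tendsto r atTop (𝓝 0)) :
    Tendsto (fun j => toL2 a b (shift (r j) φ)) atTop (𝓝 (toL2 a b φ)) := by
  rw [Metric.tendsto_atTop]
  intro ε hε
  -- The margin of one keeps all translates by less than one inside a compact interval on which `φ`
  -- is uniformly continuous.
  have hu : UniformContinuousOn φ.1 (Set.Icc (a - 1) (b + 1)) :=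
    isCompact_Icc.uniformContinuousOn_of_continuous (smooth_continuous φ).continuousOn
  set c : ℝ := ((volume.restrict (Set.Ioo a b) Set.univ) ^ (2 : ENNReal).toReal⁻¹).toReal with hc
  have hc0 : 0 ≤ c := ENNReal.toReal_nonneg
  obtain ⟨δ, hδ, hδ'⟩ := Metric.uniformContinuousOn_iff.1 hu (ε / (c + 1)) (by positivity)
  obtain ⟨j₀, hj₀⟩ := Metric.tendsto_atTop.1 hr (min δ 1) (by positivity)
  refine ⟨j₀, fun j hj => ?_⟩
  have hj1 := hj₀ j hj
  rw [Real.dist_eq, sub_zero] at hj1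
  have h1 : |r j| < 1 := hj1.trans_le (min_le_right _ _)
  rw [dist_eq_norm, ← map_sub]
  have hb : ∀ᵐ t ∂(volume.restrict (Set.Ioo a b)),
      ‖(toL2 a b (shift (r j) φ - φ)) t‖ ≤ ε / (c + 1) := by
    filter_upwards [coeFn_toL2 a b (shift (r j) φ - φ), ae_restrict_mem measurableSet_Ioo]
      with t ht ht'
    rw [ht]
    have := hδ' (t + r j) ⟨by linarith [ht'.1, (abs_lt.1 h1).1], by linarith [ht'.2, (abs_lt.1 h1).2]⟩
      t ⟨by linarith [ht'.1], by linarith [ht'.2]⟩ (by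
        rw [Real.dist_eq, add_sub_cancel_left]; exact hj1.trans_le (min_le_left _ _))
    rw [dist_eq_norm] at this
    exact this.le
  have h2 := eLpNorm_le_of_ae_bound (p := 2) hb
  have h3 : (volume.restrict (Set.Ioo a b) Set.univ) ^ (2 : ENNReal).toReal⁻¹ ≠ ⊤ := by
    refine ENNReal.rpow_ne_top_of_nonneg (by positivity) ?_
    rw [Measure.restrict_apply_univ, Real.volume_Ioo]
    exact ENNReal.ofReal_ne_top
  rw [Lp.norm_def]
  refine (ENNReal.toReal_mono (ENNReal.mul_ne_top h3 ENNReal.ofReal_ne_top) h2).trans_lt ?_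
  rw [ENNReal.toReal_mul, ← hc, ENNReal.toReal_ofReal (by positivity), mul_div_assoc',
    div_lt_iff₀ (by positivity)]
  nlinarith

end Shift

/-! ### The boundary form as a form on finite jets -/

section JetForm

variable {n : ℕ} {ι : Type*} [Fintype ι]

/-- The sum of the concomitants of a family of differential expressions. -/
def jetForm (m : ℕ) (p : ι → MatPoly n) (u : ℕ → Vec n) (v : ι → ℕ → Vec n) : ℂ :=
  ∑ i, concomitant m (p i) u (v i)

theorem concomitant_add_left (m : ℕ) (p : MatPoly n) (u u' v : ℕ → Vec n) :
    concomitant m p (fun k => u k + u' k) v = concomitant m p u v + concomitant m p u' v := by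
  simp only [concomitant, map_add, inner_add_left, mul_add, Finset.sum_add_distrib]

theorem concomitant_add_right (m : ℕ) (p : MatPoly n) (u v v' : ℕ → Vec n) :
    concomitant m p u (fun k => v k + v' k) = concomitant m p u v + concomitant m p u v' := by
  simp only [concomitant, inner_add_right, mul_add, Finset.sum_add_distrib]

theorem concomitant_smul_left (m : ℕ) (p : MatPoly n) (c : ℂ) (u v : ℕ → Vec n) :
    concomitant m p (fun k => c • u k) v = starRingEnd ℂ c * concomitant m p u v := by
  simp only [concomitant, map_smul, inner_smul_left, Finset.mul_sum]
  exact Finset.sum_congr rfl fun k _ => Finset.sum_congr rfl fun j _ => mul_left_comm _ _ _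

theorem concomitant_smul_right (m : ℕ) (p : MatPoly n) (c : ℂ) (u v : ℕ → Vec n) :
    concomitant m p u (fun k => c • v k) = c * concomitant m p u v := by
  simp only [concomitant, inner_smul_right, Finset.mul_sum]
  exact Finset.sum_congr rfl fun k _ => Finset.sum_congr rfl fun j _ => mul_left_comm _ _ _

/-- The extension of a finite jet by zero. -/
def extJet {m : ℕ} (u : Fin m → Vec n) (k : ℕ) : Vec n := if h : k < m then u ⟨k, h⟩ else 0

theorem extJet_add {m : ℕ} (u v : Fin m → Vec n) :
    extJet (u + v) = fun k => extJet u k + extJet v k := by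
  funext k
  by_cases h : k < m <;> simp [extJet, h]

theorem extJet_smul {m : ℕ} (c : ℂ) (u : Fin m → Vec n) :
    extJet (c • u) = fun k => c • extJet u k := by
  funext k
  by_cases h : k < m <;> simp [extJet, h]

theorem extJet_restrict {m : ℕ} (u : ℕ → Vec n) {k : ℕ} (hk : k < m) :
    extJet (fun j : Fin m => u j) k = u k := by
  simp [extJet, hk]

/-- `jetForm` as a sesquilinear form on finite jets. -/
def jetSesq (m : ℕ) (p : ι → MatPoly n) :
    (Fin m → Vec n) →ₗ⋆[ℂ] (ι → Fin m → Vec n) →ₗ[ℂ] ℂ :=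
  LinearMap.mk₂'ₛₗ (starRingEnd ℂ) (RingHom.id ℂ)
    (fun u v => jetForm m p (extJet u) fun i => extJet (v i))
    (fun u u' v => by
      simp only [jetForm, extJet_add, concomitant_add_left, Finset.sum_add_distrib])
    (fun c u v => by
      simp only [jetForm, extJet_smul, concomitant_smul_left, Finset.mul_sum, smul_eq_mul])
    (fun u v v' => by
      simp only [jetForm, Pi.add_apply, extJet_add, concomitant_add_right,
        Finset.sum_add_distrib])
    (fun c u v => by
      simp only [jetForm, Pi.smul_apply, extJet_smul, concomitant_smul_right, Finset.mul_sum,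
        smul_eq_mul, RingHom.id_apply])

theorem jetForm_eq_jetSesq (m : ℕ) (p : ι → MatPoly n) (u : ℕ → Vec n) (v : ι → ℕ → Vec n) :
    jetForm m p u v = jetSesq m p (fun k => u k) fun i k => v i k :=
  Finset.sum_congr rfl fun i _ => concomitant_congr _
    (fun _ hk => (extJet_restrict u hk).symm) (fun _ hk => (extJet_restrict (v i) hk).symm)

theorem exists_jetSesq_factorization (m : ℕ) (p : ι → MatPoly n) :
    ∃ (c d : ℕ) (u : Fin d → Fin m → Vec n) (v : Fin c → ι → Fin m → Vec n)
      (g : Fin c → Fin d → ℂ), ∀ x y, jetSesq m p x y =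
        ∑ i, ∑ j, g i j * jetSesq m p x (v i) * jetSesq m p (u j) y :=
  exists_rank_factorization (jetSesq m p)

theorem restrict_extJet {m : ℕ} (w : Fin m → Vec n) : (fun k : Fin m => extJet w k) = w := by
  funext k
  simp [extJet]

/-- The form only sees derivatives of order below `m`, so it lives on a finite-dimensional space,
where the factorization is available; extension by zero returns to sequences. -/
theorem exists_jetForm_factorization (m : ℕ) (p : ι → MatPoly n) :
    ∃ (c d : ℕ) (u : Fin d → ℕ → Vec n) (v : Fin c → ι → ℕ → Vec n) (g : Fin c → Fin d → ℂ),
      ∀ x y, jetForm m p x y = ∑ i, ∑ j, g i j * jetForm m p x (v i) * jetForm m p (u j) y := by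
  obtain ⟨c, d, u, v, g, h⟩ := exists_jetSesq_factorization m p
  refine ⟨c, d, fun j => extJet (u j), fun i k => extJet (v i k), g, fun x y => ?_⟩
  rw [jetForm_eq_jetSesq, h]
  refine Finset.sum_congr rfl fun i _ => Finset.sum_congr rfl fun j _ => ?_
  rw [jetForm_eq_jetSesq m p x, jetForm_eq_jetSesq m p (extJet (u j)) y, restrict_extJet]
  congr 3
  funext k
  exact (restrict_extJet (v i k)).symm

theorem jetForm_congr {m : ℕ} (p : ι → MatPoly n) {u u' : ℕ → Vec n} {v v' : ι → ℕ → Vec n}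
    (hu : ∀ k < m, u k = u' k) (hv : ∀ i, ∀ k < m, v i k = v' i k) :
    jetForm m p u v = jetForm m p u' v' :=
  Finset.sum_congr rfl fun i _ => concomitant_congr _ hu (hv i)

theorem jetForm_zero_left (m : ℕ) (p : ι → MatPoly n) {u : ℕ → Vec n} (v : ι → ℕ → Vec n)
    (hu : ∀ k, u k = 0) : jetForm m p u v = 0 :=
  Finset.sum_eq_zero fun _ _ => concomitant_zero_left _ _ _ hu

theorem jetForm_zero_right (m : ℕ) (p : ι → MatPoly n) (u : ℕ → Vec n) {v : ι → ℕ → Vec n}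
    (hv : ∀ i k, v i k = 0) : jetForm m p u v = 0 :=
  Finset.sum_eq_zero fun i _ => concomitant_zero_right _ _ _ (hv i)

end JetForm

/-! ### Density of smooth functions in joint maximal domains -/

section Density

variable {a b : ℝ} {n : ℕ} {ι : Type*} [Fintype ι]

theorem cutInner_lagrange {s t : ℝ} (has : a ≤ s) (hst : s ≤ t) (htb : t ≤ b) {m : ℕ}
    {p : ι → MatPoly n} (hp : ∀ i, (p i).natDegree ≤ m) (φ : Smooth n) (ψ : ι → Smooth n) :
    ∑ i, (cutInner s t (toL2 a b (diffOp (p i) φ)) (toL2 a b (ψ i)) -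
      cutInner s t (toL2 a b φ) (toL2 a b (diffOp (dag (p i)) (ψ i)))) =
    jetForm m p (jet φ t) (fun i => jet (ψ i) t) - jetForm m p (jet φ s) fun i => jet (ψ i) s := by
  rw [jetForm, jetForm, ← Finset.sum_sub_distrib]
  refine Finset.sum_congr rfl fun i _ => ?_
  rw [← integral_lagrange (hp i), cutInner_toL2 has hst htb, cutInner_toL2 has hst htb,
    intervalIntegral.integral_sub] <;>
  exact ((smooth_continuous _).inner (smooth_continuous _)).intervalIntegrable _ _

/-- The boundary pairing on `(s, t)` of `(x, f)` in the maximal operators with smooth functions. -/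
def leftPairing (s t : ℝ) (p : ι → MatPoly n) (x : L2 a b n) (f : ι → L2 a b n)
    (ψ : ι → Smooth n) : ℂ :=
  ∑ i, (cutInner s t (f i) (toL2 a b (ψ i)) -
    cutInner s t x (toL2 a b (diffOp (dag (p i)) (ψ i))))

/-- The boundary pairing on `(s, t)` of a smooth function with a solution `z` of the adjoint
system. -/
def rightPairing (s t : ℝ) (p : ι → MatPoly n) (z : ι → L2 a b n) (φ : Smooth n) : ℂ :=
  ∑ i, cutInner s t (toL2 a b (diffOp (p i) φ)) (z i)

/-- Orthogonality to all smooth functions, not only to test functions, permits the translated kernel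
at every `t`. Hence the mollified zero extension solves the adjoint equation on the whole line. -/
theorem sum_diffOp_dag_mollSmooth {p : ι → MatPoly n} {z : ι → L2 a b n}
    (hz : ∀ φ : Smooth n, ∑ i, inner ℂ (z i) (toL2 a b (diffOp (p i) φ)) = 0) (j : ℕ) :
    ∑ i, diffOp (dag (p i)) (mollSmooth j (z i)) = 0 := by
  ext1
  funext t
  refine ext_inner_right ℂ fun v => ?_
  rw [Submodule.coe_sum, Finset.sum_apply, sum_inner]
  have h := hz (kernelVec j t v)
  simp only [← inner_diffOp_dag_kernelVec, dag_dag, h]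
  simp

theorem eventually_mollSmooth_eq {s t : ℝ} (has : a < s) (htb : t < b) {p : MatPoly n}
    {x f : L2 a b n} (h : (x, f) ∈ maxOp a b p) :
    ∀ᶠ j in atTop, ∀ y : L2 a b n, cutInner s t (toL2 a b (mollSmooth j f)) y =
      cutInner s t (toL2 a b (diffOp p (mollSmooth j x))) y := by
  have h0 := tendsto_one_div_add_atTop_nhds_zero_nat (𝕜 := ℝ)
  filter_upwards [h0.eventually (gt_mem_nhds (sub_pos.2 has)),
    h0.eventually (gt_mem_nhds (sub_pos.2 htb))] with j h1 h2 y
  refine cutInner_toL2_congr (fun r hr => ?_) y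
  exact (diffOp_mollSmooth h (by linarith [hr.1]) (by linarith [hr.2])).symm

variable {s t : ℝ} {m : ℕ} {p : ι → MatPoly n} {x : L2 a b n} {f z : ι → L2 a b n}

/-- The jets of the mollifications need not converge at `s` and `t`, but their pairing with the jet
of a fixed smooth function does: by Lagrange's identity it is an integral over `(s, t)`, and on this
interval the mollifications eventually satisfy the differential equations exactly. -/
theorem tendsto_leftPairing (has : a < s) (hst : s ≤ t) (htb : t < b)
    (hp : ∀ i, (p i).natDegree ≤ m) (hf : ∀ i, (x, f i) ∈ maxOp a b (p i)) (ψ : ι → Smooth n) :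
    Tendsto (fun j => jetForm m p (jet (mollSmooth j x) t) (fun i => jet (ψ i) t) -
      jetForm m p (jet (mollSmooth j x) s) fun i => jet (ψ i) s) atTop
      (𝓝 (leftPairing s t p x f ψ)) := by
  have h : Tendsto (fun j => leftPairing s t p (toL2 a b (mollSmooth j x))
      (fun i => toL2 a b (mollSmooth j (f i))) ψ) atTop (𝓝 (leftPairing s t p x f ψ)) :=
    tendsto_finsetSum _ fun i _ =>
      (tendsto_cutInner s t (tendsto_toL2_mollSmooth (f i)) tendsto_const_nhds).sub
        (tendsto_cutInner s t (tendsto_toL2_mollSmooth x) tendsto_const_nhds)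
  refine h.congr' ?_
  filter_upwards [eventually_all.2 fun i => eventually_mollSmooth_eq has htb (hf i)] with j hj
  rw [← cutInner_lagrange has.le hst htb.le hp, leftPairing]
  simp only [hj]

theorem tendsto_rightPairing (has : a < s) (hst : s ≤ t) (htb : t < b)
    (hp : ∀ i, (p i).natDegree ≤ m)
    (hz : ∀ φ : Smooth n, ∑ i, inner ℂ (z i) (toL2 a b (diffOp (p i) φ)) = 0) (φ : Smooth n) :
    Tendsto (fun j => jetForm m p (jet φ t) (fun i => jet (mollSmooth j (z i)) t) -
      jetForm m p (jet φ s) fun i => jet (mollSmooth j (z i)) s) atTop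
      (𝓝 (rightPairing s t p z φ)) := by
  have h : Tendsto (fun j => rightPairing s t p (fun i => toL2 a b (mollSmooth j (z i))) φ) atTop
      (𝓝 (rightPairing s t p z φ)) :=
    tendsto_finsetSum _ fun i _ =>
      tendsto_cutInner s t tendsto_const_nhds (tendsto_toL2_mollSmooth (z i))
  refine h.congr fun j => ?_
  rw [← cutInner_lagrange has.le hst htb.le hp, Finset.sum_sub_distrib, rightPairing]
  simp only [cutInner, ← inner_sum, ← map_sum, sum_diffOp_dag_mollSmooth hz j, map_zero,
    inner_zero_right, sub_zero]

theorem tendsto_sum_cutInner (has : a < s) (hst : s ≤ t) (htb : t < b)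
    (hp : ∀ i, (p i).natDegree ≤ m) (hf : ∀ i, (x, f i) ∈ maxOp a b (p i))
    (hz : ∀ φ : Smooth n, ∑ i, inner ℂ (z i) (toL2 a b (diffOp (p i) φ)) = 0) :
    Tendsto (fun j => jetForm m p (jet (mollSmooth j x) t) (fun i => jet (mollSmooth j (z i)) t) -
      jetForm m p (jet (mollSmooth j x) s) fun i => jet (mollSmooth j (z i)) s) atTop
      (𝓝 (∑ i, cutInner s t (f i) (z i))) := by
  have h : Tendsto (fun j => ∑ i, cutInner s t (toL2 a b (mollSmooth j (f i)))
      (toL2 a b (mollSmooth j (z i)))) atTop (𝓝 (∑ i, cutInner s t (f i) (z i))) :=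
    tendsto_finsetSum _ fun i _ =>
      tendsto_cutInner s t (tendsto_toL2_mollSmooth (f i)) (tendsto_toL2_mollSmooth (z i))
  refine h.congr' ?_
  filter_upwards [eventually_all.2 fun i => eventually_mollSmooth_eq has htb (hf i)] with j hj
  rw [← cutInner_lagrange has.le hst htb.le hp, Finset.sum_sub_distrib]
  simp only [hj]
  simp only [cutInner, ← inner_sum, ← map_sum, sum_diffOp_dag_mollSmooth hz j, map_zero,
    inner_zero_right, sub_zero]

/-- The boundary term of two mollifications pairs two sequences of jets of which neither is known to
converge. The factorization splits it into products of convergent scalars. The auxiliary functions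
carry `v i` or `u j` at one endpoint and vanish to infinite order at the other, so that each pairing
isolates one endpoint. -/
theorem sum_cutInner_eq {c d : ℕ} {u : Fin d → ℕ → Vec n} {v : Fin c → ι → ℕ → Vec n}
    {g : Fin c → Fin d → ℂ}
    (hg : ∀ x y, jetForm m p x y =
      ∑ i, ∑ j, g i j * jetForm m p x (v i) * jetForm m p (u j) y)
    (has : a < s) (hst : s ≤ t) (htb : t < b)
    (hp : ∀ i, (p i).natDegree ≤ m) (hf : ∀ i, (x, f i) ∈ maxOp a b (p i))
    (hz : ∀ φ : Smooth n, ∑ i, inner ℂ (z i) (toL2 a b (diffOp (p i) φ)) = 0)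
    {r r' : Fin c → ι → Smooth n} {e e' : Fin d → Smooth n}
    (hr : ∀ i l, ∀ k < m, jet (r i l) t k = v i l k) (hr₀ : ∀ i l k, jet (r i l) s k = 0)
    (hr' : ∀ i l, ∀ k < m, jet (r' i l) s k = v i l k) (hr'₀ : ∀ i l k, jet (r' i l) t k = 0)
    (he : ∀ j, ∀ k < m, jet (e j) t k = u j k) (he₀ : ∀ j k, jet (e j) s k = 0)
    (he' : ∀ j, ∀ k < m, jet (e' j) s k = u j k) (he'₀ : ∀ j k, jet (e' j) t k = 0) :
    ∑ i, cutInner s t (f i) (z i) =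
      (∑ i, ∑ j, g i j * leftPairing s t p x f (r i) * rightPairing s t p z (e j)) -
      ∑ i, ∑ j, g i j * leftPairing s t p x f (r' i) * rightPairing s t p z (e' j) := by
  refine tendsto_nhds_unique (tendsto_sum_cutInner has hst htb hp hf hz) ?_
  have hL : ∀ ψ, _ := fun ψ => tendsto_leftPairing has hst htb hp hf ψ
  have hR : ∀ φ, _ := fun φ => tendsto_rightPairing has hst htb hp hz φ
  have h := (tendsto_finsetSum Finset.univ fun i (_ : i ∈ Finset.univ) =>
      tendsto_finsetSum Finset.univ fun j (_ : j ∈ Finset.univ) =>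
        ((hL (r i)).const_mul (g i j)).mul (hR (e j))).sub
    (tendsto_finsetSum Finset.univ fun i (_ : i ∈ Finset.univ) =>
      tendsto_finsetSum Finset.univ fun j (_ : j ∈ Finset.univ) =>
        ((hL (r' i)).const_mul (g i j)).mul (hR (e' j)))
  refine h.congr fun k => ?_
  rw [hg (jet _ t), hg (jet _ s)]
  congr 1 <;> refine Finset.sum_congr rfl fun i _ => Finset.sum_congr rfl fun j _ => ?_
  · rw [jetForm_congr p (fun _ _ => rfl) (hr i), jetForm_congr p (he j) (fun _ _ _ => rfl),
      jetForm_zero_right m p _ (hr₀ i), jetForm_zero_left m p _ (he₀ j), sub_zero, sub_zero]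
  -- At the lower endpoint both factors carry a minus sign, and these cancel in the product.
  · rw [jetForm_congr p (fun _ _ => rfl) (hr' i), jetForm_congr p (he' j) (fun _ _ _ => rfl),
      jetForm_zero_right m p _ (hr'₀ i), jetForm_zero_left m p _ (he'₀ j)]
    ring

/-- Let `(s, t)` exhaust `(a, b)`. The pairings with `x` converge, while those with `z` tend to the
orthogonality relation, that is, to zero; so every product disappears in the limit. -/
theorem sum_inner_eq_zero_of_orthogonal (hab : a < b)
    (hf : ∀ i, (x, f i) ∈ maxOp a b (p i))
    (hz : ∀ φ : Smooth n, ∑ i, inner ℂ (z i) (toL2 a b (diffOp (p i) φ)) = 0) :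
    ∑ i, inner ℂ (f i) (z i) = 0 := by
  obtain ⟨m, hp⟩ : ∃ m, ∀ i, (p i).natDegree ≤ m :=
    ⟨Finset.univ.sup fun i => (p i).natDegree, fun i =>
      Finset.le_sup (f := fun i => (p i).natDegree) (Finset.mem_univ i)⟩
  obtain ⟨c, d, u, v, g, hg⟩ := exists_jetForm_factorization m p
  choose r hr hr₀ using fun i l => exists_smooth_jet_right hab m (v i l)
  choose r' hr' hr'₀ using fun i l => exists_smooth_jet_left hab m (v i l)
  choose e he he₀ using fun j => exists_smooth_jet_right hab m (u j)
  choose e' he' he'₀ using fun j => exists_smooth_jet_left hab m (u j)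
  -- The auxiliary functions are translated by `±ε`, which moves their prescribed jets from `b` and
  -- `a` to `b - ε` and `a + ε`. At the other end they are evaluated at distance `2 ε ≤ (b - a) / 6`
  -- from the endpoint, still inside the third on which they vanish.
  set ε : ℕ → ℝ := fun k => (b - a) / 12 * (1 / ((k : ℝ) + 1)) with hε
  have hba : 0 < b - a := sub_pos.2 hab
  have hε0 : ∀ k, 0 < ε k := fun k => by positivity
  have hε1 : ∀ k, ε k ≤ (b - a) / 12 := fun k => by
    have : 1 / ((k : ℝ) + 1) ≤ 1 := by
      rw [div_le_one (by positivity)]; linarith [Nat.cast_nonneg (α := ℝ) k]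
    exact mul_le_of_le_one_right (by positivity) this
  have hεt : Tendsto ε atTop (𝓝 0) := by
    have := (tendsto_one_div_add_atTop_nhds_zero_nat (𝕜 := ℝ)).const_mul ((b - a) / 12)
    rwa [mul_zero] at this
  have hεt' : Tendsto (fun k => -ε k) atTop (𝓝 0) := by simpa using hεt.neg
  have hs : Tendsto (fun k => a + ε k) atTop (𝓝 a) := by simpa using hεt.const_add a
  have ht : Tendsto (fun k => b - ε k) atTop (𝓝 b) := by simpa using hεt.const_sub b
  have key : ∀ k, _ := fun k => sum_cutInner_eq (a := a) (b := b) (s := a + ε k) (t := b - ε k)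
    (x := x) (f := f) (z := z) (r := fun i l => shift (ε k) (r i l))
    (r' := fun i l => shift (-ε k) (r' i l)) (e := fun j => shift (ε k) (e j))
    (e' := fun j => shift (-ε k) (e' j)) hg
    (by linarith [hε0 k]) (by linarith [hε1 k]) (by linarith [hε0 k]) hp hf hz
    (fun i l q hq => by rw [jet_shift, sub_add_cancel]; exact hr i l q hq)
    (fun i l q => by
      rw [jet_shift]
      refine jet_eq_zero_of_eventually ?_ q
      filter_upwards [gt_mem_nhds (show a + ε k + ε k < a + (b - a) / 3 by linarith [hε1 k])]
        with y hy using hr₀ i l y hy)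
    (fun i l q hq => by rw [jet_shift, add_neg_cancel_right]; exact hr' i l q hq)
    (fun i l q => by
      rw [jet_shift]
      refine jet_eq_zero_of_eventually ?_ q
      filter_upwards [lt_mem_nhds (show b - (b - a) / 3 < b - ε k + -ε k by linarith [hε1 k])]
        with y hy using hr'₀ i l y hy)
    (fun j q hq => by rw [jet_shift, sub_add_cancel]; exact he j q hq)
    (fun j q => by
      rw [jet_shift]
      refine jet_eq_zero_of_eventually ?_ q
      filter_upwards [gt_mem_nhds (show a + ε k + ε k < a + (b - a) / 3 by linarith [hε1 k])]
        with y hy using he₀ j y hy)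
    (fun j q hq => by rw [jet_shift, add_neg_cancel_right]; exact he' j q hq)
    (fun j q => by
      rw [jet_shift]
      refine jet_eq_zero_of_eventually ?_ q
      filter_upwards [lt_mem_nhds (show b - (b - a) / 3 < b - ε k + -ε k by linarith [hε1 k])]
        with y hy using he'₀ j y hy)
  have hL : ∀ (ψ : ι → Smooth n) (q : ℕ → ℝ), Tendsto q atTop (𝓝 0) → Tendsto
      (fun k => leftPairing (a + ε k) (b - ε k) p x f fun l => shift (q k) (ψ l)) atTop
      (𝓝 (∑ i, (inner ℂ (f i) (toL2 a b (ψ i)) -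
        inner ℂ x (toL2 a b (diffOp (dag (p i)) (ψ i)))))) := fun ψ q hq => by
    refine tendsto_finsetSum _ fun i _ => ?_
    simp only [diffOp_shift]
    exact (tendsto_cutInner_of_tendsto hs ht tendsto_const_nhds (tendsto_toL2_shift a b _ hq)).sub
      (tendsto_cutInner_of_tendsto hs ht tendsto_const_nhds (tendsto_toL2_shift a b _ hq))
  have hR : ∀ (φ : Smooth n) (q : ℕ → ℝ), Tendsto q atTop (𝓝 0) → Tendsto
      (fun k => rightPairing (a + ε k) (b - ε k) p z (shift (q k) φ)) atTop (𝓝 0) :=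
      fun φ q hq => by
    have h0 : ∑ i, inner ℂ (toL2 a b (diffOp (p i) φ)) (z i) = 0 := by
      have := congrArg (starRingEnd ℂ) (hz φ)
      simpa only [map_sum, inner_conj_symm, map_zero] using this
    rw [← h0]
    refine tendsto_finsetSum _ fun i _ => ?_
    simp only [diffOp_shift]
    exact tendsto_cutInner_of_tendsto hs ht (tendsto_toL2_shift a b _ hq) tendsto_const_nhds
  have h1 : Tendsto (fun k => ∑ i, cutInner (a + ε k) (b - ε k) (f i) (z i)) atTop
      (𝓝 (∑ i, inner ℂ (f i) (z i))) :=
    tendsto_finsetSum _ fun i _ =>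
      tendsto_cutInner_of_tendsto hs ht tendsto_const_nhds tendsto_const_nhds
  have h2 := (tendsto_finsetSum Finset.univ fun i (_ : i ∈ Finset.univ) =>
      tendsto_finsetSum Finset.univ fun j (_ : j ∈ Finset.univ) =>
        ((hL (r i) ε hεt).const_mul (g i j)).mul (hR (e j) ε hεt)).sub
    (tendsto_finsetSum Finset.univ fun i (_ : i ∈ Finset.univ) =>
      tendsto_finsetSum Finset.univ fun j (_ : j ∈ Finset.univ) =>
        ((hL (r' i) _ hεt').const_mul (g i j)).mul (hR (e' j) _ hεt'))
  simp only [mul_zero, Finset.sum_const_zero, sub_zero] at h2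
  exact tendsto_nhds_unique h1 (h2.congr fun k => (key k).symm)

/-- Smooth functions are dense in the joint maximal domain of finitely many differential
expressions with respect to the graph norm. -/
theorem exists_smooth_tendsto (hab : a < b) (hf : ∀ i, (x, f i) ∈ maxOp a b (p i)) :
    ∃ φ : ℕ → Smooth n, ∀ i, Tendsto (fun j => toL2 a b (diffOp (p i) (φ j))) atTop (𝓝 (f i)) := by
  let T : Smooth n →ₗ[ℂ] PiLp 2 fun _ : ι => L2 a b n :=
    (WithLp.linearEquiv 2 ℂ (ι → L2 a b n)).symm.toLinearMap ∘ₗ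
      LinearMap.pi fun i => toL2 a b ∘ₗ diffOp (p i)
  have hT : ∀ φ i, (T φ).ofLp i = toL2 a b (diffOp (p i) φ) := fun _ _ => rfl
  have hmem : (WithLp.toLp 2 f : PiLp 2 fun _ : ι => L2 a b n) ∈
      (LinearMap.range T).topologicalClosure := by
    -- The closure of the range is its double orthogonal complement, so only vectors orthogonal to
    -- all smooth data matter.
    rw [← Submodule.orthogonal_orthogonal_eq_closure, Submodule.mem_orthogonal']
    intro z hz
    rw [PiLp.inner_apply]
    refine sum_inner_eq_zero_of_orthogonal hab hf fun φ => ?_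
    have := (Submodule.mem_orthogonal' _ _).1 hz (T φ) ⟨φ, rfl⟩
    rw [PiLp.inner_apply] at this
    simpa only [hT] using this
  rw [← SetLike.mem_coe, Submodule.topologicalClosure_coe, mem_closure_iff_seq_limit] at hmem
  obtain ⟨y, hy, hyt⟩ := hmem
  choose φ hφ using hy
  refine ⟨φ, fun i => ?_⟩
  have h := ((PiLp.continuous_apply 2 (fun _ : ι => L2 a b n) i).tendsto _).comp hyt
  refine h.congr fun j => ?_
  rw [Function.comp_apply, ← hφ, hT]

end Density

/-! ### Polynomial left inverses and completion to an invertible block matrix -/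

section Bezout

-- The ideal is principal and its generator is not a nonzero constant, so the generator has a root;
-- the zero ideal is included.
open Polynomial in
theorem exists_le_span_X_sub_C {I : Ideal ℂ[X]} (hI : I ≠ ⊤) :
    ∃ z : ℂ, ∀ q ∈ I, q.eval z = 0 := by
  obtain ⟨g, hg⟩ := (IsPrincipalIdealRing.principal I).principal
  have hd : g.degree ≠ 0 := fun h => hI <| by
    rw [hg]
    exact Ideal.span_singleton_eq_top.2 (Polynomial.isUnit_iff_degree_eq_zero.2 h)
  obtain ⟨z, hz⟩ := IsAlgClosed.exists_root g hd
  refine ⟨z, fun q hq => ?_⟩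
  rw [hg] at hq
  obtain ⟨r, rfl⟩ := Submodule.mem_span_singleton.1 hq
  rw [smul_eq_mul, Polynomial.eval_mul, hz.eq_zero, mul_zero]

open Polynomial in
/-- A pair of polynomial matrices with trivial joint kernel at every point has a polynomial left
inverse. -/
theorem exists_left_inverse_of_ker {n : ℕ} (P S : Matrix (Fin n) (Fin n) ℂ[X])
    (h : ∀ (z : ℂ) (v : Fin n → ℂ), P.map (eval z) *ᵥ v = 0 → S.map (eval z) *ᵥ v = 0 → v = 0) :
    ∃ X Y : Matrix (Fin n) (Fin n) ℂ[X], X * P + Y * S = 1 := by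
  let T : ((Fin n → ℂ[X]) × (Fin n → ℂ[X])) →ₗ[ℂ[X]] (Fin n → ℂ[X]) :=
    (Matrix.vecMulLinear P).coprod (Matrix.vecMulLinear S)
  have hT : ∀ w, T w = w.1 ᵥ* P + w.2 ᵥ* S := fun _ => rfl
  have htop : LinearMap.range T = ⊤ := by
    by_contra hne
    -- If the rows do not span, they lie in a maximal submodule with quotient `ℂ[X] ⧸ I`. Evaluation
    -- at a common zero `z` of `I` turns the quotient map into `u ↦ ∑ u_i(z) v_i`, and `v` is a
    -- common kernel vector of `P(z)` and `S(z)`.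
    obtain ⟨N, hN, hTN⟩ := (eq_top_or_exists_le_coatom (LinearMap.range T)).resolve_left hne
    have hsimple : IsSimpleModule ℂ[X] ((Fin n → ℂ[X]) ⧸ N) := isSimpleModule_iff_isCoatom.2 hN
    obtain ⟨I, hI, ⟨e⟩⟩ := isSimpleModule_iff_quot_maximal.1 hsimple
    obtain ⟨z, hz⟩ := exists_le_span_X_sub_C hI.ne_top
    let ev : ℂ[X] ⧸ I →+* ℂ := Ideal.Quotient.lift I (evalRingHom z) hz
    let ψ : (Fin n → ℂ[X]) →ₗ[ℂ[X]] ℂ[X] ⧸ I := e.toLinearMap ∘ₗ N.mkQ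
    have hψ : Function.Surjective ψ := e.surjective.comp N.mkQ_surjective
    have hevψ : ∀ u, ev (ψ u) = ∑ i, (u i).eval z * ev (ψ (Pi.single i 1)) := fun u => by
      conv_lhs => rw [pi_eq_sum_univ' u]
      rw [map_sum, map_sum]
      refine Finset.sum_congr rfl fun i _ => ?_
      rw [map_smul]
      change ev (Ideal.Quotient.mk I (u i) * _) = _
      rw [map_mul]
      rfl
    have hker : ∀ w, ψ (T w) = 0 := fun w => by
      have : T w ∈ N := hTN ⟨w, rfl⟩
      change e (N.mkQ (T w)) = 0
      rw [(Submodule.Quotient.mk_eq_zero N).2 this |> fun h => (h : N.mkQ (T w) = 0), map_zero]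
    have hrow : ∀ w, ∑ i, (T w i).eval z * ev (ψ (Pi.single i 1)) = 0 := fun w => by
      rw [← hevψ, hker, map_zero]
    have hv := h z (fun i => ev (ψ (Pi.single i 1)))
      (funext fun j => by
        have := hrow (Pi.single j 1, 0)
        simpa [hT, Matrix.mulVec, dotProduct] using this)
      (funext fun j => by
        have := hrow (0, Pi.single j 1)
        simpa [hT, Matrix.mulVec, dotProduct] using this)
    -- Surjectivity of the quotient map contradicts `v = 0`.
    obtain ⟨u, hu⟩ := hψ 1
    have h1 := hevψ u
    rw [hu, map_one] at h1
    simp [fun i => congrFun hv i] at h1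
  choose w hw using fun i : Fin n => LinearMap.range_eq_top.1 htop (Pi.single i 1)
  refine ⟨Matrix.of fun i => (w i).1, Matrix.of fun i => (w i).2, ?_⟩
  ext1 i j
  have := congrFun (hw i) j
  rw [hT] at this
  rw [Matrix.one_eq_pi_single, ← this]
  rfl

/-- Over a commutative ring a one-sided inverse of a square matrix is two-sided; this is applied to
the `2 × 2` block matrices. -/
theorem block_inverse_comm {n : ℕ} {R : Type*} [CommRing R]
    {X Y C D P A S B : Matrix (Fin n) (Fin n) R} (h₁ : X * P + Y * S = 1)
    (h₂ : X * A + Y * B = 0) (h₃ : C * P + D * S = 0) (h₄ : C * A + D * B = 1) :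
    (P * X + A * C = 1 ∧ P * Y + A * D = 0) ∧ S * X + B * C = 0 ∧ S * Y + B * D = 1 := by
  have h : Matrix.fromBlocks X Y C D * Matrix.fromBlocks P A S B = 1 := by
    rw [Matrix.fromBlocks_multiply, h₁, h₂, h₃, h₄, Matrix.fromBlocks_one]
  rw [mul_eq_one_comm, Matrix.fromBlocks_multiply, ← Matrix.fromBlocks_one,
    Matrix.fromBlocks_inj] at h
  exact ⟨⟨h.1, h.2.1⟩, h.2.2.1, h.2.2.2⟩

/-- Matrix polynomials do not commute, but they are matrices over the commutative ring `ℂ[X]`, where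
the preceding argument is valid. -/
theorem block_inverse_comm_matPoly {n : ℕ} {X Y C D P A S B : MatPoly n}
    (h₁ : X * P + Y * S = 1) (h₂ : X * A + Y * B = 0) (h₃ : C * P + D * S = 0)
    (h₄ : C * A + D * B = 1) :
    (P * X + A * C = 1 ∧ P * Y + A * D = 0) ∧ S * X + B * C = 0 ∧ S * Y + B * D = 1 := by
  let e := (matPolyEquiv (n := Fin n) (R := ℂ)).symm
  have h := block_inverse_comm (X := e X) (Y := e Y) (C := e C) (D := e D) (P := e P) (A := e A)
    (S := e S) (B := e B) (by rw [← map_mul, ← map_mul, ← map_add, h₁, map_one])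
    (by rw [← map_mul, ← map_mul, ← map_add, h₂, map_zero])
    (by rw [← map_mul, ← map_mul, ← map_add, h₃, map_zero])
    (by rw [← map_mul, ← map_mul, ← map_add, h₄, map_one])
  simp only [← map_mul, ← map_add, EmbeddingLike.map_eq_one_iff, EmbeddingLike.map_eq_zero_iff] at h
  exact h

/-- By `h'` the column `(Y', -κ⁻¹ X')` is a right inverse of the row `(S', -κ P')`. Subtracting `(P,
S) Z`, with `Z` its image under `(X, Y)`, makes it vanish under `(X, Y)`. The second row is not
affected, since by `hs` it annihilates `(P, S)`. -/
theorem block_relations {R : Type*} [Ring R] [Algebra ℂ R] {X Y P S P' S' X' Y' : R} {κ : ℂ}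
    (hκ : κ ≠ 0) (h : X * P + Y * S = 1) (h' : P' * X' + S' * Y' = 1) (hs : S' * P = κ • (P' * S)) :
    ∃ A B : R, X * A + Y * B = 0 ∧ S' * P + (-κ) • P' * S = 0 ∧ S' * A + (-κ) • P' * B = 1 := by
  have e : κ * κ⁻¹ = 1 := mul_inv_cancel₀ hκ
  set Z : R := X * Y' + Y * ((-κ⁻¹) • X') with hZ
  have h₃ : S' * P + (-κ) • P' * S = 0 := by
    rw [hs, smul_mul_assoc, ← add_smul, add_neg_cancel, zero_smul]
  refine ⟨Y' - P * Z, (-κ⁻¹) • X' - S * Z, ?_, h₃, ?_⟩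
  · rw [mul_sub, mul_sub, sub_add_sub_comm, ← mul_assoc, ← mul_assoc, ← add_mul, h, one_mul, hZ,
      sub_self]
  · rw [mul_sub, mul_sub, sub_add_sub_comm, ← mul_assoc, ← mul_assoc, ← add_mul, h₃, zero_mul,
      sub_zero, smul_mul_assoc, mul_smul_comm, smul_smul, neg_mul_neg, e, one_smul, add_comm, h']

/-- If `[P; S]` has a left inverse and `S† P = κ P† S`, then the kernel of `[S†, -κ P†]` is the
range of `[P; S]`. -/
theorem eq_diffOp_of_left_inverse {n : ℕ} {P S X Y : MatPoly n} {κ : ℂ} (hκ : κ ≠ 0)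
    (hXY : X * P + Y * S = 1) (hPS : dag S * P = κ • (dag P * S)) {g h : Smooth n}
    (hgh : diffOp (dag S) g = κ • diffOp (dag P) h) :
    diffOp P (diffOp X g + diffOp Y h) = g ∧ diffOp S (diffOp X g + diffOp Y h) = h := by
  have hd : dag P * dag X + dag S * dag Y = 1 := by
    rw [← dag_mul, ← dag_mul, ← dag_add, hXY, dag_one]
  obtain ⟨A, B, h₂, h₃, h₄⟩ := block_relations hκ hXY hd hPS
  obtain ⟨⟨e₁, e₂⟩, e₃, e₄⟩ := block_inverse_comm_matPoly hXY h₂ h₃ h₄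
  have happ : ∀ (p q : MatPoly n) (φ : Smooth n), diffOp p (diffOp q φ) = diffOp (p * q) φ :=
    fun p q φ => by rw [map_mul]; rfl
  have hsmul : ∀ (c : ℂ) (p : MatPoly n) (φ : Smooth n), diffOp (c • p) φ = c • diffOp p φ := by
    intro c p φ
    ext1; funext t
    rw [diffOp_apply_of_lt (Nat.lt_succ_of_le (Polynomial.natDegree_smul_le c p))]
    change _ = c • (diffOp p φ).1 t
    rw [diffOp_apply_of_lt (Nat.lt_succ_self _), Finset.smul_sum]
    exact Finset.sum_congr rfl fun k _ => by simp
  -- The expression `S† g - κ P† h` is zero, so it may be added under `A` and under `B`; this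
  -- supplies the missing terms of the reversed block product.
  have f : ∀ (p : MatPoly n), diffOp p (diffOp (dag S) g) + diffOp p (diffOp ((-κ) • dag P) h) = 0 :=
    fun p => by
      rw [hgh, hsmul, ← map_add, ← add_smul, add_neg_cancel, zero_smul, map_zero]
  have one : ∀ φ : Smooth n, diffOp (1 : MatPoly n) φ = φ := fun φ => by rw [map_one]; rfl
  constructor
  · calc diffOp P (diffOp X g + diffOp Y h)
        = diffOp P (diffOp X g + diffOp Y h) + (diffOp A (diffOp (dag S) g) +
            diffOp A (diffOp ((-κ) • dag P) h)) := by rw [f, add_zero]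
      _ = diffOp (P * X + A * dag S) g +
            diffOp (P * Y + A * ((-κ) • dag P)) h := by
          simp only [map_add, happ, LinearMap.add_apply]; abel
      _ = g := by rw [e₁, e₂, one, map_zero, LinearMap.zero_apply, add_zero]
  · calc diffOp S (diffOp X g + diffOp Y h)
        = diffOp S (diffOp X g + diffOp Y h) + (diffOp B (diffOp (dag S) g) +
            diffOp B (diffOp ((-κ) • dag P) h)) := by rw [f, add_zero]
      _ = diffOp (S * X + B * dag S) g +
            diffOp (S * Y + B * ((-κ) • dag P)) h := by
          simp only [map_add, happ, LinearMap.add_apply]; abel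
      _ = h := by rw [e₃, e₄, one, map_zero, LinearMap.zero_apply, zero_add]

end Bezout

/-! ### Pairs orthogonal to smooth data lie in the range -/

section Range

variable {a b : ℝ} {n : ℕ} {P S : MatPoly n}

/-- The exponential function `t ↦ exp (z t) v`. -/
def expSmooth (z : ℂ) (v : Vec n) : Smooth n :=
  ⟨fun t => Complex.exp (z * t) • v,
    show ContDiff ℝ ∞ fun t : ℝ => Complex.exp (z * t) • v from
      (Complex.contDiff_exp.comp (contDiff_const.mul Complex.ofRealCLM.contDiff)).smul contDiff_const⟩

theorem smoothDeriv_expSmooth (z : ℂ) (v : Vec n) :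
    smoothDeriv n (expSmooth z v) = z • expSmooth z v := by
  ext1; funext t
  have h1 : HasDerivAt (fun t : ℝ => z * (t : ℂ)) z t := by
    simpa using (Complex.ofRealCLM.hasDerivAt (x := t)).const_mul z
  have h2 := (h1.cexp.smul_const v).deriv
  change deriv (fun t : ℝ => Complex.exp (z * t) • v) t = z • (Complex.exp (z * t) • v)
  rw [h2, smul_smul, mul_comm]

/-- On exponentials the derivative is multiplication by `z`, so the operator acts as the matrix
`p(z)`. -/
theorem diffOp_expSmooth (p : MatPoly n) (z : ℂ) (v : Vec n) (t : ℝ) :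
    (diffOp p (expSmooth z v)).1 t = Complex.exp (z * t) •
      WithLp.toLp 2 ((matPolyEquiv.symm p).map (Polynomial.eval z) *ᵥ v.ofLp) := by
  have hk : ∀ k, jet (expSmooth z v) t k = (z ^ k * Complex.exp (z * t)) • v := fun k => by
    have h : (smoothDeriv n ^ k) (expSmooth z v) = z ^ k • expSmooth z v := by
      induction k with
      | zero => simp
      | succ k ih =>
        rw [pow_succ, Module.End.mul_apply, smoothDeriv_expSmooth, map_smul, ih, smul_smul, pow_succ']
    rw [jet_eq_smoothDeriv_pow, h, mul_smul]
    rfl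
  rw [diffOp_apply_of_lt (Nat.lt_succ_self _)]
  ext i
  have hd : ∀ j, (matPolyEquiv.symm p i j).natDegree < p.natDegree + 1 := fun j => by
    rw [Nat.lt_succ_iff, Polynomial.natDegree_le_iff_coeff_eq_zero]
    intro k hk
    rw [matPolyEquiv_symm_apply_coeff, Polynomial.coeff_eq_zero_of_natDegree_lt hk]
    rfl
  have hk' : ∀ k, iteratedDeriv k (expSmooth z v).1 t = (z ^ k * Complex.exp (z * t)) • v := hk
  simp only [hk', map_smul, PiLp.smul_apply, smul_eq_mul, Matrix.mulVec, dotProduct, Matrix.map_apply,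
    Polynomial.eval_eq_sum_range' (hd _), matPolyEquiv_symm_apply_coeff, WithLp.ofLp_sum,
    Finset.sum_apply, WithLp.ofLp_smul, Pi.smul_apply, Matrix.ofLp_toLpLin, Matrix.toLin'_apply,
    Finset.sum_mul, Finset.mul_sum]
  rw [Finset.sum_comm]
  exact Finset.sum_congr rfl fun j _ => Finset.sum_congr rfl fun k _ => by ring

/-- A common kernel vector `v` of `P(z)` and `S(z)` gives an exponential that both operators
annihilate. Coercivity makes it vanish almost everywhere on a nonempty interval, which forces `v =
0`. -/
theorem exists_left_inverse_of_coercive (hab : a < b)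
    (hc : IsCoercive (maxOp a b P) (maxOp a b S)) : ∃ X Y : MatPoly n, X * P + Y * S = 1 := by
  obtain ⟨c, hc0, hc⟩ := hc
  obtain ⟨X, Y, h⟩ := exists_left_inverse_of_ker (matPolyEquiv.symm P) (matPolyEquiv.symm S)
    fun z v h₁ h₂ => by
      set φ := expSmooth z (WithLp.toLp 2 v) with hφ
      have hP : diffOp P φ = 0 := by
        ext1; funext t
        rw [diffOp_expSmooth, h₁]
        simp
      have hS : diffOp S φ = 0 := by
        ext1; funext t
        rw [diffOp_expSmooth, h₂]
        simp
      have h := hc _ _ _ ⟨toL2_mem_maxOp hab.le P φ, toL2_mem_maxOp hab.le S φ⟩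
      rw [hP, hS, map_zero] at h
      have h0 : toL2 a b φ = 0 := by
        rw [← norm_le_zero_iff]
        have h' : c * ‖toL2 a b φ‖ ≤ 0 := by simpa using h
        exact nonpos_of_mul_nonpos_right h' hc0
      have h1 : φ.1 =ᵐ[volume.restrict (Set.Ioo a b)] fun _ => 0 := by
        have h2 := coeFn_toL2 a b φ
        rw [h0] at h2
        exact h2.symm.trans (Lp.coeFn_zero _ _ _)
      obtain ⟨t, -, ht⟩ : ∃ t ∈ Set.Ioo a b, φ.1 t = 0 := by
        by_contra hcon
        push Not at hcon
        have h3 : ∀ᵐ t ∂(volume.restrict (Set.Ioo a b)), False := by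
          filter_upwards [h1, ae_restrict_mem measurableSet_Ioo] with t h4 h5 using hcon t h5 h4
        rw [Filter.eventually_false_iff_eq_bot, ae_eq_bot, Measure.restrict_eq_zero,
          Real.volume_Ioo, ENNReal.ofReal_eq_zero] at h3
        linarith
      have h4 : Complex.exp (z * t) • (WithLp.toLp 2 v : Vec n) = 0 := ht
      rw [smul_eq_zero] at h4
      have h5 := h4.resolve_left (Complex.exp_ne_zero _)
      exact (WithLp.toLp_eq_zero 2).1 h5
  refine ⟨matPolyEquiv X, matPolyEquiv Y, ?_⟩
  have := congrArg matPolyEquiv h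
  simpa using this

/-- A pair which is orthogonal to the range of `[P; S]` on smooth functions belongs to the
range of `[P; S]`. -/
theorem exists_mem_maxOp_of_orthogonal (hab : a < b)
    (hc : IsCoercive (maxOp a b P) (maxOp a b S)) {κ : ℂ} (hκ : κ = 1 ∨ κ = -1)
    (hPS : dag S * P = κ • (dag P * S)) {g h : L2 a b n}
    (hgh : ∀ φ : Smooth n, inner ℂ h (toL2 a b (diffOp P φ)) =
      κ * inner ℂ g (toL2 a b (diffOp S φ))) :
    ∃ x, (x, g) ∈ maxOp a b P ∧ (x, h) ∈ maxOp a b S := by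
  obtain ⟨X, Y, hXY⟩ := exists_left_inverse_of_coercive hab hc
  obtain ⟨c, hc0, hc⟩ := hc
  have hκ0 : κ ≠ 0 := by rcases hκ with rfl | rfl <;> simp
  have hκ2 : κ * κ = 1 := by rcases hκ with rfl | rfl <;> simp
  have hκc : starRingEnd ℂ κ = κ := by rcases hκ with rfl | rfl <;> simp
  -- Testing with the translated kernels gives the adjoint equation for the mollifications on the
  -- whole line.
  have hm : ∀ j, diffOp (dag S) (mollSmooth j g) = κ • diffOp (dag P) (mollSmooth j h) := by
    intro j
    ext1; funext t
    refine ext_inner_right ℂ fun v => ?_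
    have e := hgh (kernelVec j t v)
    have e₁ := inner_diffOp_dag_kernelVec (dag P) j h t v
    have e₂ := inner_diffOp_dag_kernelVec (dag S) j g t v
    rw [dag_dag] at e₁ e₂
    rw [e₁, e₂] at e
    change _ = inner ℂ (κ • (diffOp (dag P) (mollSmooth j h)).1 t) v
    rw [inner_smul_left, hκc, e, ← mul_assoc, hκ2, one_mul]
  -- The left inverse yields exact smooth preimages of the mollified pairs; coercivity makes them a
  -- Cauchy sequence.
  set x : ℕ → Smooth n := fun j => diffOp X (mollSmooth j g) + diffOp Y (mollSmooth j h) with hx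
  have hPx : ∀ j, diffOp P (x j) = mollSmooth j g := fun j =>
    (eq_diffOp_of_left_inverse hκ0 hXY hPS (hm j)).1
  have hSx : ∀ j, diffOp S (x j) = mollSmooth j h := fun j =>
    (eq_diffOp_of_left_inverse hκ0 hXY hPS (hm j)).2
  have hg := tendsto_toL2_mollSmooth g
  have hh := tendsto_toL2_mollSmooth h
  have hle : ∀ i j, c * ‖toL2 a b (x i) - toL2 a b (x j)‖ ≤
      ‖toL2 a b (mollSmooth i g) - toL2 a b (mollSmooth j g)‖ +
      ‖toL2 a b (mollSmooth i h) - toL2 a b (mollSmooth j h)‖ := fun i j => by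
    have h1 := hc _ _ _ ⟨toL2_mem_maxOp hab.le P (x i - x j), toL2_mem_maxOp hab.le S (x i - x j)⟩
    simp only [map_sub, hPx, hSx] at h1
    refine h1.trans ((Real.sqrt_le_sqrt ?_).trans_eq (Real.sqrt_sq (by positivity)))
    nlinarith [norm_nonneg (toL2 a b (mollSmooth i g) - toL2 a b (mollSmooth j g)),
      norm_nonneg (toL2 a b (mollSmooth i h) - toL2 a b (mollSmooth j h))]
  have hcau : CauchySeq fun j => toL2 a b (x j) := by
    rw [Metric.cauchySeq_iff]
    intro ε hε
    obtain ⟨N₁, h₁⟩ := Metric.cauchySeq_iff.1 hg.cauchySeq (c * ε / 2) (by positivity)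
    obtain ⟨N₂, h₂⟩ := Metric.cauchySeq_iff.1 hh.cauchySeq (c * ε / 2) (by positivity)
    refine ⟨max N₁ N₂, fun i hi j hj => ?_⟩
    have h3 := h₁ i (le_of_max_le_left hi) j (le_of_max_le_left hj)
    have h4 := h₂ i (le_of_max_le_right hi) j (le_of_max_le_right hj)
    rw [dist_eq_norm] at h3 h4 ⊢
    exact lt_of_mul_lt_mul_left ((hle i j).trans_lt (by linarith)) hc0.le
  obtain ⟨x₀, hx₀⟩ := cauchySeq_tendsto_of_complete hcau
  refine ⟨x₀, maxOp_closed (fun j => ?_) hx₀ hg, maxOp_closed (fun j => ?_) hx₀ hh⟩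
  · rw [← hPx]; exact toL2_mem_maxOp hab.le P (x j)
  · rw [← hSx]; exact toL2_mem_maxOp hab.le S (x j)

end Range

/-! ### Minimal operators, their adjoints and weak derivatives -/

section Adjoints

variable {a b : ℝ} {n : ℕ}

theorem diffOp_monomial (k : ℕ) (A : Matrix (Fin n) (Fin n) ℂ) (φ : Smooth n) (t : ℝ) :
    (diffOp (Polynomial.monomial k A) φ).1 t =
      Matrix.toEuclideanLin A (iteratedDeriv k φ.1 t) := by
  rw [diffOp_apply, Polynomial.sum_monomial_index _ _ (by simp)]

theorem diffOp_sum_monomial {ι : Type} [Fintype ι] (C : ι → Matrix (Fin n) (Fin n) ℂ) (e : ι → ℕ)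
    (φ : Smooth n) : (diffOp (∑ k, Polynomial.monomial (e k) (C k)) φ).1 = diffExpr C e φ.1 := by
  funext t
  rw [map_sum, LinearMap.sum_apply, Submodule.coe_sum, Finset.sum_apply]
  exact Finset.sum_congr rfl fun k _ => diffOp_monomial _ _ _ _

/-- The adjoint of a minimal operator is the maximal operator of the formal adjoint. -/
theorem adjoint_minimalOp {ι : Type} [Fintype ι] (C : ι → Matrix (Fin n) (Fin n) ℂ) (e : ι → ℕ)
    {p : MatPoly n} (hp : dag p = ∑ k, Polynomial.monomial (e k) (C k)) :
    (minimalOp a b C e).adjoint = maxOp a b p := by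
  ext q
  rw [Submodule.mem_adjoint_iff, mem_maxOp]
  constructor
  · intro h φ hφ
    have h1 := h (toL2 a b φ) (toL2 a b (diffOp (dag p) φ))
      ⟨φ.1, hφ, coeFn_toL2 a b φ, by
        rw [← diffOp_sum_monomial, ← hp]; exact coeFn_toL2 a b _⟩
    rw [← inner_conj_symm, ← inner_conj_symm q.1, ← sub_eq_zero.1 h1]
  · rintro h u v ⟨φ, hφ, hu, hv⟩
    have hu' : u = toL2 a b ⟨φ, hφ.1⟩ := Lp.ext (hu.trans (coeFn_toL2 a b ⟨φ, hφ.1⟩).symm)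
    have hv' : v = toL2 a b (diffOp (dag p) ⟨φ, hφ.1⟩) := Lp.ext (hv.trans (by
      have := coeFn_toL2 a b (diffOp (dag p) ⟨φ, hφ.1⟩)
      rw [hp, diffOp_sum_monomial] at this
      rw [hp]
      exact this.symm))
    have h1 := h ⟨φ, hφ.1⟩ hφ
    rw [hu', hv', sub_eq_zero, ← inner_conj_symm, ← inner_conj_symm (toL2 a b _) q.2, h1]

theorem dag_X_pow (k : ℕ) : dag (Polynomial.X ^ k : MatPoly n) =
    Polynomial.monomial k ((-1 : ℂ) ^ k • (1 : Matrix (Fin n) (Fin n) ℂ)) := by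
  ext1 j
  rw [dag_coeff, Polynomial.coeff_X_pow, Polynomial.coeff_monomial]
  by_cases h : j = k
  · subst h; simp
  · simp [h, Ne.symm h]

theorem weakDeriv_eq_maxOp (k : ℕ) : weakDeriv a b n k = maxOp a b (Polynomial.X ^ k) :=
  adjoint_minimalOp _ _ (by simp [dag_X_pow])

theorem diffOp_X_pow (k : ℕ) (φ : Smooth n) (t : ℝ) :
    (diffOp (Polynomial.X ^ k : MatPoly n) φ).1 t = jet φ t k := by
  rw [← Polynomial.monomial_one_right_eq_X_pow, diffOp_monomial, toEuclideanLin_one_apply]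
  rfl

end Adjoints

/-! ### Traces and approximation in Sobolev spaces -/

section Traces

variable {a b : ℝ} {n : ℕ}

/-- A constant function. -/
def constSmooth (v : Vec n) : Smooth n := ⟨fun _ => v, show ContDiff ℝ ∞ fun _ : ℝ => v from contDiff_const⟩

/-- The function `t ↦ (t - a) v`. -/
def linearSmooth (a : ℝ) (v : Vec n) : Smooth n :=
  ⟨fun t => (t - a) • v, show ContDiff ℝ ∞ fun t : ℝ => (t - a) • v from
    (contDiff_id.sub contDiff_const).smul contDiff_const⟩

theorem hasDerivAt_smooth (φ : Smooth n) (t : ℝ) :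
    HasDerivAt φ.1 ((smoothDeriv n φ).1 t) t := (smooth_differentiable φ t).hasDerivAt

theorem inner_smooth_sub (φ : Smooth n) (v : Vec n) {t : ℝ} (hat : a ≤ t) (htb : t ≤ b) :
    inner ℂ (φ.1 t) v = inner ℂ (φ.1 b) v -
      cutInner t b (toL2 a b (smoothDeriv n φ)) (toL2 a b (constSmooth v)) := by
  rw [cutInner_toL2 hat htb le_rfl]
  have h := intervalIntegral.integral_eq_sub_of_hasDerivAt (a := t) (b := b)
    (f := fun r => inner ℂ (φ.1 r) v) (f' := fun r => inner ℂ ((smoothDeriv n φ).1 r) v)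
    (fun r _ => by simpa using (hasDerivAt_smooth φ r).inner ℂ (hasDerivAt_const r v))
    (((smooth_continuous _).inner continuous_const).intervalIntegrable _ _)
  change _ = _ - ∫ r in t..b, inner ℂ ((smoothDeriv n φ).1 r) v
  rw [h]
  ring

/-- Integrate the derivative of `⟪φ t, (t - a) v⟫`. The weight removes the contribution of `a`, so
the value at `b` is controlled by `φ` and `φ'` in `L²`. -/
theorem inner_smooth_endpoint (hab : a ≤ b) (φ : Smooth n) (v : Vec n) :
    (b - a) * inner ℂ (φ.1 b) v =
      inner ℂ (toL2 a b (smoothDeriv n φ)) (toL2 a b (linearSmooth a v)) +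
        inner ℂ (toL2 a b φ) (toL2 a b (constSmooth v)) := by
  rw [inner_toL2_toL2 a b hab, inner_toL2_toL2 a b hab, ← intervalIntegral.integral_add]
  · have hd : ∀ r, HasDerivAt (linearSmooth a v).1 v r := fun r => by
      have h := ((hasDerivAt_id r).sub_const a).smul_const v
      rw [one_smul] at h
      exact h
    have hc : ∀ r, inner ℂ ((smoothDeriv n φ).1 r) ((linearSmooth a v).1 r) +
        inner ℂ (φ.1 r) ((constSmooth v).1 r) = inner ℂ (φ.1 r) v +
          inner ℂ ((smoothDeriv n φ).1 r) ((linearSmooth a v).1 r) := fun r => add_comm _ _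
    simp only [hc]
    rw [intervalIntegral.integral_eq_sub_of_hasDerivAt
        (fun r _ => (hasDerivAt_smooth φ r).inner ℂ (hd r))]
    · change _ = inner ℂ _ ((b - a) • v) - inner ℂ _ ((a - a) • v)
      rw [sub_self, zero_smul, inner_zero_right, sub_zero, ← Complex.coe_smul, inner_smul_right]
      push_cast
      ring
    · exact (((smooth_continuous _).inner continuous_const).add
        ((smooth_continuous _).inner (smooth_continuous _))).intervalIntegrable _ _
  · exact ((smooth_continuous _).inner (smooth_continuous _)).intervalIntegrable _ _
  · exact ((smooth_continuous _).inner (smooth_continuous _)).intervalIntegrable _ _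

/-- Convergence in `H¹` implies convergence of the values of continuous representatives. -/
theorem tendsto_value_of_tendsto_toL2 (hab : a < b) {φ : ℕ → Smooth n} {v w : L2 a b n}
    (hv : Tendsto (fun j => toL2 a b (φ j)) atTop (𝓝 v))
    (hw : Tendsto (fun j => toL2 a b (smoothDeriv n (φ j))) atTop (𝓝 w)) {g : ℝ → Vec n}
    (hg : ContinuousOn g (Set.Icc a b)) (hvg : v =ᵐ[volume.restrict (Set.Ioo a b)] g) {t : ℝ}
    (ht : t ∈ Set.Icc a b) : Tendsto (fun j => (φ j).1 t) atTop (𝓝 (g t)) := by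
  have hweak : ∀ c : Vec n, Tendsto (fun j => inner ℂ ((φ j).1 t) c) atTop (𝓝 (inner ℂ (g t) c)) := by
    intro c
    set L : ℂ := ((b : ℂ) - a)⁻¹ * (inner ℂ w (toL2 a b (linearSmooth a c)) +
      inner ℂ v (toL2 a b (constSmooth c))) with hL
    have hba : (b : ℂ) - a ≠ 0 := by
      rw [← Complex.ofReal_sub]; exact Complex.ofReal_ne_zero.2 (sub_pos.2 hab).ne'
    have h1 : Tendsto (fun j => inner ℂ ((φ j).1 b) c) atTop (𝓝 L) := by
      have h2 := ((hw.inner (𝕜 := ℂ) (tendsto_const_nhds (x := toL2 a b (linearSmooth a c)))).add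
        (hv.inner (𝕜 := ℂ) (tendsto_const_nhds (x := toL2 a b (constSmooth c))))).const_mul
        ((b : ℂ) - a)⁻¹
      refine h2.congr fun j => ?_
      rw [← inner_smooth_endpoint hab.le, inv_mul_cancel_left₀ hba]
    set G : ℝ → ℂ := fun r => L - ∫ q in r..b, inner ℂ (w q) c with hG
    have hcut : ∀ r, a ≤ r → r ≤ b → cutInner r b w (toL2 a b (constSmooth c)) =
        ∫ q in r..b, inner ℂ (w q) c := fun r har hrb => by
      rw [cutInner_eq, intervalIntegral.integral_of_le hrb, integral_Ioc_eq_integral_Ioo,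
        Measure.restrict_restrict_of_subset (Set.Ioo_subset_Ioo_left har)]
      refine integral_congr_ae ?_
      have h3 := coeFn_toL2 a b (constSmooth c)
      have h4 := ae_restrict_of_ae_restrict_of_subset (Set.Ioo_subset_Ioo_left (b := b) har) h3
      filter_upwards [h4] with q hq
      rw [hq]
      rfl
    have h5 : ∀ r ∈ Set.Icc a b, Tendsto (fun j => inner ℂ ((φ j).1 r) c) atTop (𝓝 (G r)) := by
      intro r hr
      rw [hG]
      simp only
      rw [← hcut r hr.1 hr.2]
      exact (h1.sub (tendsto_cutInner r b hw tendsto_const_nhds)).congr fun j =>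
        (inner_smooth_sub (φ j) c hr.1 hr.2).symm
    have hGc : ContinuousOn G (Set.Icc a b) := by
      rw [← Set.uIcc_of_le hab.le]
      refine continuousOn_const.sub (intervalIntegral.continuousOn_primitive_interval_left ?_)
      rw [Set.uIcc_of_le hab.le, integrableOn_Icc_iff_integrableOn_Ioo]
      exact ((Lp.memLp w).integrable (by norm_num)).inner_const c
    -- The pointwise limit `G` is continuous. An almost everywhere convergent subsequence identifies
    -- it with `⟪g, c⟫` almost everywhere, hence by continuity on the closed interval.
    obtain ⟨ns, hmono, hns⟩ := (tendstoInMeasure_of_tendsto_Lp hv).exists_seq_tendsto_ae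
    have hae : (fun r => inner ℂ (g r) c) =ᵐ[volume.restrict (Set.Ioo a b)] G := by
      have h6 : ∀ᵐ r ∂(volume.restrict (Set.Ioo a b)), ∀ j, toL2 a b (φ j) r = (φ j).1 r :=
        ae_all_iff.2 fun j => coeFn_toL2 a b (φ j)
      filter_upwards [hns, hvg, h6, ae_restrict_mem measurableSet_Ioo] with r h7 h8 h9 h10
      simp only [h9] at h7
      rw [h8] at h7
      have h11 := (h5 r (Set.Ioo_subset_Icc_self h10)).comp
        hmono.tendsto_atTop
      exact tendsto_nhds_unique (h7.inner tendsto_const_nhds) h11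
    have heq := Measure.eqOn_Icc_of_ae_eq volume hab.ne
      (by rw [← restrict_Ioo_eq_restrict_Icc]; exact hae) (hg.inner continuousOn_const) hGc
    have e : inner ℂ (g t) c = G t := heq ht
    rw [e]
    exact h5 t ht
  have hc : ∀ i, Tendsto (fun j => (φ j).1 t i) atTop (𝓝 (g t i)) := fun i => by
    have h1 := (Complex.continuous_conj.tendsto _).comp (hweak (EuclideanSpace.single i 1))
    have h2 : ∀ z : Vec n, starRingEnd ℂ (inner ℂ z (EuclideanSpace.single i (1 : ℂ))) = z i :=
      fun z => by rw [inner_conj_symm, EuclideanSpace.inner_single_left]; simp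
    simpa only [Function.comp_def, h2] using h1
  have h := ((PiLp.continuous_toLp 2 (fun _ : Fin n => ℂ)).tendsto _).comp (tendsto_pi_nhds.2 hc)
  exact h

/-- The boundary values of the derivatives of order less than `m` of a smooth function. -/
def smoothTrace (a b : ℝ) (m : ℕ) :
    Smooth n →ₗ[ℂ] (Fin m × Fin n → ℂ) × (Fin m × Fin n → ℂ) where
  toFun φ := (fun k => jet φ b k.1 k.2, fun k => jet φ a k.1 k.2)
  map_add' φ ψ := by ext k <;> simp [jet_add]
  map_smul' c φ := by ext k <;> simp [jet_smul]

theorem smoothTrace_surjective (hab : a < b) (m : ℕ) :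
    Function.Surjective (smoothTrace (n := n) a b m) := by
  rintro ⟨τ, τ'⟩
  obtain ⟨φ, h, h'⟩ := exists_smooth_jets (n := n) hab m
    (extJet fun k : Fin m => WithLp.toLp 2 fun i => τ (k, i))
    (extJet fun k : Fin m => WithLp.toLp 2 fun i => τ' (k, i))
  refine ⟨φ, Prod.ext (funext fun k => ?_) (funext fun k => ?_)⟩
  · change jet φ b k.1 k.2 = _
    rw [h _ k.1.2, extJet, dif_pos k.1.2]
  · change jet φ a k.1 k.2 = _
    rw [h' _ k.1.2, extJet, dif_pos k.1.2]

theorem toL2_mem_traceMap (hab : a ≤ b) (m : ℕ) (φ : Smooth n) :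
    (toL2 a b φ, smoothTrace a b m φ) ∈ traceMap a b n m := by
  have h : ∀ k, (toL2 a b φ, toL2 a b (diffOp (Polynomial.X ^ k) φ)) ∈ weakDeriv a b n k :=
    fun k => by rw [weakDeriv_eq_maxOp]; exact toL2_mem_maxOp hab _ φ
  refine ⟨fun k _ => ⟨_, h k⟩, fun k => ⟨_, h k, (diffOp (Polynomial.X ^ (k : ℕ)) φ).1,
    (smooth_continuous _).continuousOn, coeFn_toL2 a b _, fun i => ?_, fun i => ?_⟩⟩ <;>
  · rw [diffOp_X_pow]
    rfl

/-- Functions in `Hᵐ` which belong to given maximal domains are approximated by smooth functions,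
in the graph norm and together with their traces. -/
theorem exists_smooth_tendsto_traceMap (hab : a < b) {ι : Type*} [Fintype ι] {p : ι → MatPoly n}
    {m : ℕ} {x : L2 a b n} {f : ι → L2 a b n}
    {τ : (Fin m × Fin n → ℂ) × (Fin m × Fin n → ℂ)} (hf : ∀ i, (x, f i) ∈ maxOp a b (p i))
    (hτ : (x, τ) ∈ traceMap a b n m) :
    ∃ φ : ℕ → Smooth n,
      (∀ i, Tendsto (fun j => toL2 a b (diffOp (p i) (φ j))) atTop (𝓝 (f i))) ∧
      Tendsto (fun j => smoothTrace a b m (φ j)) atTop (𝓝 τ) := by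
  obtain ⟨hs, ht⟩ := hτ
  choose v hv using fun k : Fin (m + 1) => hs k (Nat.lt_succ_iff.1 k.2)
  -- Adding the weak derivatives of orders `0, …, m` to the family forces convergence in `Hᵐ`. Order
  -- `m` is needed for the boundary values of order `m - 1`.
  obtain ⟨φ, hφ⟩ := exists_smooth_tendsto (ι := ι ⊕ Fin (m + 1)) (x := x)
    (p := Sum.elim p fun k => Polynomial.X ^ (k : ℕ)) (f := Sum.elim f v) hab (by
      rintro (i | k)
      · exact hf i
      · have := hv k
        rwa [weakDeriv_eq_maxOp] at this)
  have hD : ∀ k : ℕ, ∀ ψ : Smooth n,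
      smoothDeriv n (diffOp (Polynomial.X ^ k) ψ) = diffOp (Polynomial.X ^ (k + 1)) ψ :=
    fun k ψ => by
      ext1; funext t
      rw [diffOp_X_pow]
      have h : (diffOp (Polynomial.X ^ k : MatPoly n) ψ).1 = fun t => jet ψ t k :=
        funext fun t => diffOp_X_pow k ψ t
      change deriv (diffOp (Polynomial.X ^ k : MatPoly n) ψ).1 t = _
      rw [h]
      exact (hasDerivAt_jet ψ t k).deriv
  have hval : ∀ (k : Fin m), ∃ g : ℝ → Vec n, (∀ i, τ.1 (k, i) = g b i) ∧
      (∀ i, τ.2 (k, i) = g a i) ∧ ∀ t ∈ Set.Icc a b,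
        Tendsto (fun j => jet (φ j) t k) atTop (𝓝 (g t)) := fun k => by
    obtain ⟨w, hw, g, hg, hwg, hb, ha⟩ := ht k
    refine ⟨g, hb, ha, fun t ht => ?_⟩
    have h1 := hφ (Sum.inr k.castSucc)
    have h2 := hφ (Sum.inr k.succ)
    have hwv : w = v k.castSucc := by
      have h3 := hv k.castSucc
      rw [weakDeriv_eq_maxOp] at hw h3
      exact maxOp_unique hw h3
    rw [hwv] at hwg
    have h4 := tendsto_value_of_tendsto_toL2 hab (φ := fun j => diffOp (Polynomial.X ^ (k : ℕ)) (φ j))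
      h1 (show Tendsto (fun j => toL2 a b (smoothDeriv n (diffOp (Polynomial.X ^ (k : ℕ)) (φ j))))
        atTop (𝓝 (v k.succ)) by simp only [hD]; exact h2) hg hwg ht
    simpa only [diffOp_X_pow] using h4
  choose g hgb hga hg using hval
  refine ⟨φ, fun i => hφ (Sum.inl i), ?_⟩
  have hcoord : ∀ (k : Fin m) (i : Fin n), ∀ t ∈ Set.Icc a b,
      Tendsto (fun j => jet (φ j) t k i) atTop (𝓝 (g k t i)) := fun k i t ht =>
    ((PiLp.continuous_apply 2 (fun _ : Fin n => ℂ) i).tendsto _).comp (hg k t ht)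
  refine Tendsto.prodMk_nhds (tendsto_pi_nhds.2 fun k => ?_) (tendsto_pi_nhds.2 fun k => ?_)
  · rw [show τ.1 k = g k.1 b k.2 from hgb k.1 k.2]
    exact hcoord k.1 k.2 b (Set.right_mem_Icc.2 hab.le)
  · rw [show τ.2 k = g k.1 a k.2 from hga k.1 k.2]
    exact hcoord k.1 k.2 a (Set.left_mem_Icc.2 hab.le)

end Traces

/-! ### The boundary form on `G × G` -/

section BoundaryForm

variable {G : Type*} [NormedAddCommGroup G] [InnerProductSpace ℂ G]

/-- The sesquilinear form `⟪y₁, y₀'⟫ - κ ⟪y₀, y₁'⟫` on `G × G`. -/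
def bForm (κ : ℂ) (y y' : G × G) : ℂ := inner ℂ y.2 y'.1 - κ * inner ℂ y.1 y'.2

theorem bForm_sub_left (κ : ℂ) (y z y' : G × G) :
    bForm κ (y - z) y' = bForm κ y y' - bForm κ z y' := by
  simp only [bForm, Prod.fst_sub, Prod.snd_sub, inner_sub_left]
  ring

theorem bForm_ext {κ : ℂ} (hκ : κ ≠ 0) {y z : G × G} (h : ∀ θ, bForm κ y θ = bForm κ z θ) :
    y = z := by
  have h1 : ∀ θ, bForm κ (y - z) θ = 0 := fun θ => by rw [bForm_sub_left, h, sub_self]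
  have h2 := h1 ((y - z).2, 0)
  have h3 := h1 (0, (y - z).1)
  simp only [bForm, inner_zero_right, mul_zero, sub_zero, zero_sub, neg_eq_zero, mul_eq_zero, hκ,
    false_or, inner_self_eq_zero] at h2 h3
  exact sub_eq_zero.1 (Prod.ext h3 h2)

/-- The linear functional `bForm κ y`. -/
def bFormRight (κ : ℂ) (y : G × G) : G × G →ₗ[ℂ] ℂ where
  toFun := bForm κ y
  map_add' z z' := by simp only [bForm, Prod.fst_add, Prod.snd_add, inner_add_right]; ring
  map_smul' c z := by
    simp only [bForm, Prod.smul_fst, Prod.smul_snd, inner_smul_right, RingHom.id_apply,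
      smul_eq_mul]
    ring

theorem exists_inner_eq [FiniteDimensional ℂ G] (f : G →ₗ[ℂ] ℂ) : ∃ z : G, ∀ x, inner ℂ z x = f x :=
  have := FiniteDimensional.complete ℂ G
  ⟨(InnerProductSpace.toDual ℂ G).symm (LinearMap.toContinuousLinearMap f), fun x => by
    rw [InnerProductSpace.toDual_symm_apply]; rfl⟩

theorem exists_bForm_eq [FiniteDimensional ℂ G] {κ : ℂ} (hκ : κ ≠ 0) (f : G × G →ₗ[ℂ] ℂ) :
    ∃ y, ∀ θ, bForm κ y θ = f θ := by
  obtain ⟨y₁, h₁⟩ := exists_inner_eq (f ∘ₗ LinearMap.inl ℂ G G)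
  obtain ⟨y₀, h₀⟩ := exists_inner_eq ((-κ⁻¹) • (f ∘ₗ LinearMap.inr ℂ G G))
  refine ⟨(y₀, y₁), fun θ => ?_⟩
  have h : f θ = f (θ.1, 0) + f (0, θ.2) := by rw [← map_add]; simp
  rw [h, bForm, h₁, h₀]
  simp [hκ]

theorem continuous_bForm (κ : ℂ) : Continuous fun y : (G × G) × (G × G) => bForm κ y.1 y.2 := by
  unfold bForm
  fun_prop

end BoundaryForm

/-! ### Lagrangian kernels `ker [K L]` -/

section KerPair

variable {r : ℕ}

/-- The map `z ↦ (-κ Lᴴ z, Kᴴ z)`. -/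
def kerPairDual (κ : ℂ) (K L : Matrix (Fin r) (Fin r) ℂ) : Vec r →ₗ[ℂ] Vec r × Vec r :=
  LinearMap.prod ((-κ) • Matrix.toEuclideanLin Lᴴ) (Matrix.toEuclideanLin Kᴴ)

theorem bForm_kerPairDual {κ : ℂ} (hκ : κ = 1 ∨ κ = -1) (K L : Matrix (Fin r) (Fin r) ℂ)
    (z : Vec r) (θ : Vec r × Vec r) : bForm κ (kerPairDual κ K L z) θ =
      inner ℂ z ((Matrix.toEuclideanLin K).coprod (Matrix.toEuclideanLin L) θ) := by
  have h : ∀ w, kerPairDual κ K L w =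
      ((-κ) • Matrix.toEuclideanLin Lᴴ w, Matrix.toEuclideanLin Kᴴ w) := fun _ => rfl
  rw [h, bForm, LinearMap.coprod_apply, inner_add_right, inner_smul_left,
    inner_toEuclideanLin_left, inner_toEuclideanLin_left, Matrix.conjTranspose_conjTranspose,
    Matrix.conjTranspose_conjTranspose]
  rcases hκ with rfl | rfl <;> simp

/-- The orthogonal complement of `kerPair K L` with respect to `bForm`. -/
theorem bForm_eq_zero_on_kerPair_iff {κ : ℂ} (hκ : κ = 1 ∨ κ = -1)
    (K L : Matrix (Fin r) (Fin r) ℂ) (y : Vec r × Vec r) :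
    (∀ θ ∈ kerPair K L, bForm κ y θ = 0) ↔ y ∈ LinearMap.range (kerPairDual κ K L) := by
  have hκ0 : κ ≠ 0 := by rcases hκ with rfl | rfl <;> simp
  constructor
  · intro h
    have h1 : bFormRight κ y ∈
        (LinearMap.ker ((Matrix.toEuclideanLin K).coprod
          (Matrix.toEuclideanLin L))).dualAnnihilator :=
      (Submodule.mem_dualAnnihilator _).2 h
    rw [← LinearMap.range_dualMap_eq_dualAnnihilator_ker] at h1
    obtain ⟨f, hf⟩ := h1
    obtain ⟨z, hz⟩ := exists_inner_eq f
    refine ⟨z, bForm_ext hκ0 fun θ => ?_⟩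
    rw [bForm_kerPairDual hκ, hz]
    exact LinearMap.congr_fun hf θ
  · rintro ⟨z, rfl⟩ θ hθ
    rw [bForm_kerPairDual hκ, LinearMap.mem_ker.1 hθ, inner_zero_right]

theorem rank_fromCols_eq_iff (K L : Matrix (Fin r) (Fin r) ℂ) :
    (Matrix.fromCols K L).rank = r ↔
      Function.Surjective ((Matrix.toEuclideanLin K).coprod (Matrix.toEuclideanLin L)) := by
  have h1 : (Matrix.fromCols K L).rank = r ↔
      Function.Surjective (Matrix.fromCols K L).mulVecLin := by
    rw [← LinearMap.range_eq_top, Matrix.rank]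
    constructor
    · intro h
      exact Submodule.eq_top_of_finrank_eq (by rw [h]; simp)
    · intro h
      rw [h]
      simp
  rw [h1]
  constructor
  · intro h z
    obtain ⟨w, hw⟩ := h z.ofLp
    refine ⟨(WithLp.toLp 2 (w ∘ Sum.inl), WithLp.toLp 2 (w ∘ Sum.inr)), ?_⟩
    rw [Matrix.mulVecLin_apply, ← Sum.elim_comp_inl_inr w, Matrix.fromCols_mulVec_sumElim] at hw
    ext i
    rw [← hw]
    rfl
  · intro h z
    obtain ⟨w, hw⟩ := h (WithLp.toLp 2 z)
    refine ⟨Sum.elim w.1.ofLp w.2.ofLp, ?_⟩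
    rw [Matrix.mulVecLin_apply, Matrix.fromCols_mulVec_sumElim]
    exact congrArg WithLp.ofLp hw

/-- `ker [K L]` is Lagrangian if and only if `K Lᴴ = κ L Kᴴ` and `[K L]` has full rank. -/
theorem kerPair_lagrangian_iff {κ : ℂ} (hκ : κ = 1 ∨ κ = -1) (K L : Matrix (Fin r) (Fin r) ℂ) :
    (∀ y, y ∈ kerPair K L ↔ ∀ θ ∈ kerPair K L, bForm κ y θ = 0) ↔
      K * Lᴴ = κ • (L * Kᴴ) ∧ (Matrix.fromCols K L).rank = r := by
  have hκ2 : κ * κ = 1 := by rcases hκ with rfl | rfl <;> simp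
  have hκ0 : κ ≠ 0 := by rcases hκ with rfl | rfl <;> simp
  rw [rank_fromCols_eq_iff]
  simp only [bForm_eq_zero_on_kerPair_iff hκ]
  rw [← SetLike.ext_iff, kerPair]
  set T := (Matrix.toEuclideanLin K).coprod (Matrix.toEuclideanLin L) with hT
  set R := kerPairDual κ K L with hR
  have hTR : K * Lᴴ = κ • (L * Kᴴ) ↔ T ∘ₗ R = 0 := by
    have h1 : T ∘ₗ R = Matrix.toEuclideanLin ((-κ) • (K * Lᴴ) + L * Kᴴ) := by
      refine LinearMap.ext fun z => ?_
      rw [map_add, map_smul, LinearMap.add_apply, LinearMap.smul_apply, toEuclideanLin_mul_apply,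
        toEuclideanLin_mul_apply, ← map_smul (Matrix.toEuclideanLin K)]
      rfl
    rw [h1, map_eq_zero_iff _ (LinearEquiv.injective _)]
    constructor
    · intro h
      rw [h, smul_smul, neg_mul, hκ2, neg_one_smul, neg_add_cancel]
    · intro h
      rw [neg_smul, neg_add_eq_zero] at h
      rw [← h, smul_smul, hκ2, one_smul]
  rw [hTR, LinearMap.range_le_ker_iff.symm]
  -- The claim is now: `ker T = ran R` if and only if `T R = 0` and `T` is onto. Since `ran R` has
  -- dimension at most `r`, equality forces `T` to have rank `r`. Conversely, if `T` is onto, then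
  -- `R`, its adjoint for the form, is injective, and both spaces have dimension `r`.
  have hd := LinearMap.finrank_range_add_finrank_ker T
  have hdR := LinearMap.finrank_range_le R
  have hdT := LinearMap.finrank_range_add_finrank_ker R
  simp only [Module.finrank_prod, finrank_euclideanSpace, Fintype.card_fin] at hd hdR hdT
  constructor
  · intro h
    refine ⟨h.ge, ?_⟩
    rw [← LinearMap.range_eq_top]
    refine Submodule.eq_top_of_finrank_eq (le_antisymm (Submodule.finrank_le _) ?_)
    rw [h] at hd
    rw [finrank_euclideanSpace, Fintype.card_fin]
    exact Nat.le_of_add_le_add_right (b := Module.finrank ℂ (LinearMap.range R))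
      (hd.ge.trans' (Nat.add_le_add_left hdR r))
  · rintro ⟨h, hs⟩
    have hinj : LinearMap.ker R = ⊥ := by
      rw [LinearMap.ker_eq_bot']
      intro z hz
      obtain ⟨θ, hθ⟩ := hs z
      have h1 := bForm_kerPairDual hκ K L z θ
      rw [← hR, hz, ← hT, hθ] at h1
      simpa [bForm] using h1.symm
    refine (Submodule.eq_of_le_of_finrank_eq h ?_).symm
    rw [LinearMap.range_eq_top.2 hs, finrank_top, finrank_euclideanSpace, Fintype.card_fin] at hd
    rw [hinj, finrank_bot, add_zero] at hdT
    exact hdT.trans (Nat.add_left_cancel hd).symm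

end KerPair

/-! ### Abstract boundary triplets for the range of `[P; S]` -/

section BoundaryTriplet

variable {a b : ℝ} {n m r : ℕ} {κ : ℂ} {P S : MatPoly n}

/-- The pairing of `(p, s) ∈ L² × L²` with the pair `(P φ, S φ)` for smooth `φ`. -/
def pairing (κ : ℂ) (P S : MatPoly n) (q : L2 a b n × L2 a b n) : Smooth n →ₗ[ℂ] ℂ :=
  bFormRight κ q ∘ₗ LinearMap.prod (toL2 a b ∘ₗ diffOp P) (toL2 a b ∘ₗ diffOp S)

theorem pairing_apply (κ : ℂ) (P S : MatPoly n) (q : L2 a b n × L2 a b n) (φ : Smooth n) :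
    pairing κ P S q φ = bForm κ q (toL2 a b (diffOp P φ), toL2 a b (diffOp S φ)) := rfl

/-- The data of a boundary map for the range of `[P; S]`: a surjective linear map `Λ` of the
boundary values of the derivatives of order less than `m` which satisfies Green's identity on
smooth functions. -/
structure IsBoundaryForm (a b : ℝ) (κ : ℂ) (P S : MatPoly n)
    (Λ : ((Fin m × Fin n → ℂ) × (Fin m × Fin n → ℂ)) →ₗ[ℂ] Vec r × Vec r) : Prop where
  lt : a < b
  sign : κ = 1 ∨ κ = -1
  surjective : Function.Surjective Λ
  green : ∀ φ ψ : Smooth n, pairing κ P S (toL2 a b (diffOp P φ), toL2 a b (diffOp S φ)) ψ =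
    bForm κ (Λ (smoothTrace a b m φ)) (Λ (smoothTrace a b m ψ))

/-- The continuous extension of the boundary map `Λ ∘ γ` to the domain of `[P; S]`. -/
def extBoundary (a b : ℝ) (P S : MatPoly n)
    (Λ : ((Fin m × Fin n → ℂ) × (Fin m × Fin n → ℂ)) →ₗ[ℂ] Vec r × Vec r) :
    Submodule ℂ (L2 a b n × (Vec r × Vec r)) :=
  graphNormExtension (column (maxOp a b P) (maxOp a b S))
    ((traceMap a b n m).map (LinearMap.prodMap LinearMap.id Λ))

variable {Λ : ((Fin m × Fin n → ℂ) × (Fin m × Fin n → ℂ)) →ₗ[ℂ] Vec r × Vec r}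

theorem IsBoundaryForm.ne_zero (h : IsBoundaryForm a b κ P S Λ) : κ ≠ 0 := by
  rcases h.sign with rfl | rfl <;> simp

theorem IsBoundaryForm.exists_trace_eq (h : IsBoundaryForm a b κ P S Λ) (y : Vec r × Vec r) :
    ∃ φ : Smooth n, Λ (smoothTrace a b m φ) = y :=
  (h.surjective.comp (smoothTrace_surjective h.lt m)) y

theorem IsBoundaryForm.eq_of_forall (h : IsBoundaryForm a b κ P S Λ) {y z : Vec r × Vec r}
    (hyz : ∀ φ : Smooth n, bForm κ y (Λ (smoothTrace a b m φ)) =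
      bForm κ z (Λ (smoothTrace a b m φ))) : y = z :=
  bForm_ext h.ne_zero fun θ => by
    obtain ⟨φ, rfl⟩ := h.exists_trace_eq θ
    exact hyz φ

/-- The boundary value of `x` as a continuous function of `(P x, S x)`. -/
def boundaryValue (κ : ℂ) (P S : MatPoly n) (ρ : Vec r × Vec r → Smooth n)
    (q : L2 a b n × L2 a b n) : Vec r × Vec r :=
  (WithLp.toLp 2 fun i =>
      starRingEnd ℂ (-κ * pairing κ P S q (ρ (0, EuclideanSpace.single i 1))),
    WithLp.toLp 2 fun i => starRingEnd ℂ (pairing κ P S q (ρ (EuclideanSpace.single i 1, 0))))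

theorem continuous_pairing (φ : Smooth n) :
    Continuous fun q : L2 a b n × L2 a b n => pairing κ P S q φ :=
  (continuous_bForm κ).comp (continuous_id.prodMk continuous_const)

theorem continuous_boundaryValue (ρ : Vec r × Vec r → Smooth n) :
    Continuous (boundaryValue (a := a) (b := b) κ P S ρ) := by
  refine Continuous.prodMk ?_ ?_ <;>
  refine (PiLp.continuous_toLp 2 _).comp (continuous_pi fun i => Complex.continuous_conj.comp ?_)
  · exact continuous_const.mul (continuous_pairing _)
  · exact continuous_pairing _

/-- Pairing with smooth functions whose boundary data are unit vectors in one factor reads off the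
coordinates of `y`. The conjugation compensates for antilinearity in the first argument. -/
theorem IsBoundaryForm.boundaryValue_eq (h : IsBoundaryForm a b κ P S Λ)
    {ρ : Vec r × Vec r → Smooth n} (hρ : ∀ θ, Λ (smoothTrace a b m (ρ θ)) = θ)
    {q : L2 a b n × L2 a b n} {y : Vec r × Vec r}
    (hq : ∀ φ, pairing κ P S q φ = bForm κ y (Λ (smoothTrace a b m φ))) :
    boundaryValue κ P S ρ q = y := by
  refine Prod.ext (PiLp.ext fun i => ?_) (PiLp.ext fun i => ?_)
  · change starRingEnd ℂ _ = _
    rw [hq, hρ]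
    simp only [bForm, inner_zero_right, EuclideanSpace.inner_single_right]
    rcases h.sign with rfl | rfl <;> simp
  · change starRingEnd ℂ _ = _
    rw [hq, hρ]
    simp only [bForm, inner_zero_right, EuclideanSpace.inner_single_right]
    simp

/-- Green's identity passes from smooth functions to `Hᵐ`, because there the approximation converges
in the graph norm and in the traces simultaneously. -/
theorem IsBoundaryForm.pairing_eq_of_mem_map (h : IsBoundaryForm a b κ P S Λ) {u : L2 a b n}
    {q : L2 a b n × L2 a b n} {w : Vec r × Vec r}
    (hq : (u, q) ∈ column (maxOp a b P) (maxOp a b S))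
    (hw : (u, w) ∈ (traceMap a b n m).map (LinearMap.prodMap LinearMap.id Λ)) (φ : Smooth n) :
    pairing κ P S q φ = bForm κ w (Λ (smoothTrace a b m φ)) := by
  obtain ⟨⟨u', τ⟩, hτ, hE⟩ := hw
  obtain ⟨rfl, rfl⟩ : u' = u ∧ Λ τ = w := Prod.ext_iff.1 hE
  obtain ⟨ψ, h₁, h₂⟩ := exists_smooth_tendsto_traceMap h.lt (p := fun i : Bool => cond i P S)
    (f := fun i : Bool => cond i q.1 q.2) (by rintro (_ | _); exacts [hq.2, hq.1]) hτ
  have h₃ := ((continuous_pairing (κ := κ) (P := P) (S := S) φ).tendsto q).comp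
    ((h₁ true).prodMk_nhds (h₁ false))
  have h₄ := ((continuous_bForm κ).tendsto (Λ τ, Λ (smoothTrace a b m φ))).comp
    (((Λ.continuous_of_finiteDimensional.tendsto τ).comp h₂).prodMk_nhds tendsto_const_nhds)
  exact tendsto_nhds_unique (h₃.congr fun j => h.green (ψ j) φ) h₄

/-- The expression `1` is added to the family so that the functions themselves converge, too. -/
theorem exists_smooth_tendsto_column (hab : a < b) {x : L2 a b n} {q : L2 a b n × L2 a b n}
    (hq : (x, q) ∈ column (maxOp a b P) (maxOp a b S)) :
    ∃ ψ : ℕ → Smooth n, Tendsto (fun j => toL2 a b (ψ j)) atTop (𝓝 x) ∧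
      Tendsto (fun j => (toL2 a b (diffOp P (ψ j)), toL2 a b (diffOp S (ψ j)))) atTop (𝓝 q) := by
  obtain ⟨ψ, hψ⟩ := exists_smooth_tendsto hab (x := x)
    (p := fun i : Option Bool => i.elim 1 fun i => cond i P S)
    (f := fun i : Option Bool => i.elim x fun i => cond i q.1 q.2) (by
      rintro (_ | _ | _)
      · intro φ _
        simp only [Option.elim, dag_one, map_one, Module.End.one_apply]
      · exact hq.2
      · exact hq.1)
  refine ⟨ψ, ?_, (hψ (some true)).prodMk_nhds (hψ (some false))⟩
  simpa only [Option.elim, map_one, Module.End.one_apply] using hψ none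

theorem toL2_mem_column (hab : a < b) (φ : Smooth n) :
    (toL2 a b φ, (toL2 a b (diffOp P φ), toL2 a b (diffOp S φ))) ∈
      column (maxOp a b P) (maxOp a b S) :=
  ⟨toL2_mem_maxOp hab.le P φ, toL2_mem_maxOp hab.le S φ⟩

theorem toL2_mem_map (hab : a < b) (φ : Smooth n) : (toL2 a b φ, Λ (smoothTrace a b m φ)) ∈
    (traceMap a b n m).map (LinearMap.prodMap LinearMap.id Λ) :=
  ⟨_, toL2_mem_traceMap hab.le m φ, rfl⟩

theorem column_unique {x : L2 a b n} {q q' : L2 a b n × L2 a b n}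
    (h : (x, q) ∈ column (maxOp a b P) (maxOp a b S))
    (h' : (x, q') ∈ column (maxOp a b P) (maxOp a b S)) : q = q' :=
  Prod.ext (maxOp_unique h.1 h'.1) (maxOp_unique h.2 h'.2)

theorem IsBoundaryForm.exists_column (h : IsBoundaryForm a b κ P S Λ) {x : L2 a b n}
    {y : Vec r × Vec r} (hy : (x, y) ∈ extBoundary a b P S Λ) :
    ∃ q, (x, q) ∈ column (maxOp a b P) (maxOp a b S) ∧
      ∀ φ, pairing κ P S q φ = bForm κ y (Λ (smoothTrace a b m φ)) := by
  obtain ⟨q, hq, u, v, w, huvw, -, hv, hw⟩ := hy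
  refine ⟨q, hq, fun φ => ?_⟩
  have h₃ := ((continuous_pairing (κ := κ) (P := P) (S := S) φ).tendsto q).comp hv
  have h₄ := ((continuous_bForm κ).tendsto (y, Λ (smoothTrace a b m φ))).comp
    (hw.prodMk_nhds tendsto_const_nhds)
  exact tendsto_nhds_unique
    (h₃.congr fun j => h.pairing_eq_of_mem_map (huvw j).1 (huvw j).2 φ) h₄

/-- On smooth functions the boundary data are a continuous function of `(P φ, S φ)`. They therefore
converge along every smooth approximation in the graph norm, although the traces need not. -/
theorem IsBoundaryForm.exists_boundaryValue (h : IsBoundaryForm a b κ P S Λ) {x : L2 a b n}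
    {q : L2 a b n × L2 a b n} (hq : (x, q) ∈ column (maxOp a b P) (maxOp a b S)) :
    ∃ y, (x, y) ∈ extBoundary a b P S Λ := by
  choose ρ hρ using h.exists_trace_eq
  obtain ⟨ψ, h₁, h₂⟩ := exists_smooth_tendsto_column h.lt hq
  refine ⟨boundaryValue κ P S ρ q, q, hq, _, _, _, fun j => ⟨toL2_mem_column h.lt (ψ j),
    toL2_mem_map h.lt (ψ j)⟩, h₁, h₂, ?_⟩
  exact (((continuous_boundaryValue ρ).tendsto q).comp h₂).congr fun j =>
    h.boundaryValue_eq hρ (h.green (ψ j))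

/-- The extended boundary map is determined by Green's identity with smooth functions. -/
theorem IsBoundaryForm.mem_extBoundary_iff (h : IsBoundaryForm a b κ P S Λ) {x : L2 a b n}
    {q : L2 a b n × L2 a b n} (hq : (x, q) ∈ column (maxOp a b P) (maxOp a b S))
    {y : Vec r × Vec r} : (x, y) ∈ extBoundary a b P S Λ ↔
      ∀ φ, pairing κ P S q φ = bForm κ y (Λ (smoothTrace a b m φ)) := by
  constructor
  · intro hy
    obtain ⟨q', hq', hy'⟩ := h.exists_column hy
    rwa [column_unique hq hq']
  · intro hy
    obtain ⟨z, hz⟩ := h.exists_boundaryValue hq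
    obtain ⟨q', hq', hz'⟩ := h.exists_column hz
    rw [column_unique hq' hq] at hz'
    rwa [h.eq_of_forall fun φ => (hy φ).symm.trans (hz' φ)]

theorem IsBoundaryForm.toL2_mem (h : IsBoundaryForm a b κ P S Λ) (φ : Smooth n) :
    (toL2 a b φ, Λ (smoothTrace a b m φ)) ∈ extBoundary a b P S Λ :=
  (h.mem_extBoundary_iff (toL2_mem_column h.lt φ)).2 (h.green φ)

theorem IsBoundaryForm.existsUnique (h : IsBoundaryForm a b κ P S Λ) {x : L2 a b n}
    {q : L2 a b n × L2 a b n} (hq : (x, q) ∈ column (maxOp a b P) (maxOp a b S)) :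
    ∃! y, (x, y) ∈ extBoundary a b P S Λ := by
  obtain ⟨y, hy⟩ := h.exists_boundaryValue hq
  exact ⟨y, hy, fun z hz => h.eq_of_forall fun φ => by
    rw [← (h.mem_extBoundary_iff hq).1 hy, ← (h.mem_extBoundary_iff hq).1 hz]⟩

theorem IsBoundaryForm.exists_mem (h : IsBoundaryForm a b κ P S Λ) (y : Vec r × Vec r) :
    ∃ x, (x, y) ∈ extBoundary a b P S Λ := by
  obtain ⟨φ, rfl⟩ := h.exists_trace_eq y
  exact ⟨_, h.toL2_mem φ⟩

/-- Green's identity. -/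
theorem IsBoundaryForm.bForm_eq (h : IsBoundaryForm a b κ P S Λ) {x x' : L2 a b n}
    {q q' : L2 a b n × L2 a b n} {y y' : Vec r × Vec r}
    (hq : (x, q) ∈ column (maxOp a b P) (maxOp a b S))
    (hq' : (x', q') ∈ column (maxOp a b P) (maxOp a b S))
    (hy : (x, y) ∈ extBoundary a b P S Λ) (hy' : (x', y') ∈ extBoundary a b P S Λ) :
    bForm κ q q' = bForm κ y y' := by
  choose ρ hρ using h.exists_trace_eq
  obtain ⟨ψ, -, h₂⟩ := exists_smooth_tendsto_column h.lt hq'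
  have h₃ : Tendsto (fun j => Λ (smoothTrace a b m (ψ j))) atTop (𝓝 y') := by
    rw [← h.boundaryValue_eq hρ ((h.mem_extBoundary_iff hq').1 hy')]
    exact (((continuous_boundaryValue ρ).tendsto q').comp h₂).congr fun j =>
      h.boundaryValue_eq hρ (h.green (ψ j))
  have h₄ := ((continuous_bForm κ).tendsto (y, y')).comp (tendsto_const_nhds.prodMk_nhds h₃)
  have h₅ := ((continuous_bForm κ).tendsto (q, q')).comp (tendsto_const_nhds.prodMk_nhds h₂)
  exact tendsto_nhds_unique (h₅.congr fun j => (h.mem_extBoundary_iff hq).1 hy (ψ j)) h₄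

/-- The adjoint of the restriction of `[P; S]` by boundary conditions `Θ`. -/
theorem IsBoundaryForm.forall_rangeRestrict_iff (h : IsBoundaryForm a b κ P S Λ)
    (hc : IsCoercive (maxOp a b P) (maxOp a b S)) (hPS : dag S * P = κ • (dag P * S))
    (Θ : Submodule ℂ (Vec r × Vec r)) (g : L2 a b n × L2 a b n) :
    (∀ q ∈ rangeRestrict (maxOp a b P) (maxOp a b S) (extBoundary a b P S Λ) Θ,
      bForm κ g q = 0) ↔
    ∃ x y, (x, g) ∈ column (maxOp a b P) (maxOp a b S) ∧ (x, y) ∈ extBoundary a b P S Λ ∧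
      ∀ θ ∈ Θ, bForm κ y θ = 0 := by
  constructor
  · intro hg
    -- Smooth functions that satisfy the boundary conditions are among the tested elements, in
    -- particular those with vanishing boundary data.
    have h0 : ∀ φ : Smooth n, Λ (smoothTrace a b m φ) ∈ Θ → pairing κ P S g φ = 0 := fun φ hφ =>
      hg _ ⟨_, _, toL2_mem_column h.lt φ, h.toL2_mem φ, hφ⟩
    set T := Λ ∘ₗ smoothTrace (n := n) a b m with hT
    have hTs : Function.Surjective T := h.exists_trace_eq
    obtain ⟨ρ, hρ⟩ := T.exists_rightInverse_of_surjective (LinearMap.range_eq_top.2 hTs)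
    have hρ' : ∀ θ, T (ρ θ) = θ := fun θ => LinearMap.congr_fun hρ θ
    -- The pairing with `g` vanishes on the kernel of `T`, so it factors through the boundary data.
    -- Nondegeneracy represents it by a vector `y`, the future boundary value.
    obtain ⟨y, hy⟩ := exists_bForm_eq h.ne_zero (pairing κ P S g ∘ₗ ρ)
    have hy' : ∀ φ, pairing κ P S g φ = bForm κ y (Λ (smoothTrace a b m φ)) := fun φ => by
      rw [hy]
      have h1 : pairing κ P S g (φ - ρ (T φ)) = 0 := h0 _ (by
        change T (φ - ρ (T φ)) ∈ Θ
        rw [map_sub, hρ', sub_self]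
        exact Θ.zero_mem)
      rw [map_sub, sub_eq_zero] at h1
      exact h1
    -- Removing a smooth function with boundary value `y` leaves a pair orthogonal to the data of
    -- all smooth functions, which therefore lies in the range.
    obtain ⟨φ₀, hφ₀⟩ := h.exists_trace_eq y
    obtain ⟨x, hx₁, hx₂⟩ := exists_mem_maxOp_of_orthogonal h.lt hc h.sign hPS
      (g := g.1 - toL2 a b (diffOp P φ₀)) (h := g.2 - toL2 a b (diffOp S φ₀)) (fun φ => by
        have h1 := h.green φ₀ φ
        rw [hφ₀, ← hy', pairing_apply, pairing_apply] at h1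
        have h2 := bForm_sub_left κ g (toL2 a b (diffOp P φ₀), toL2 a b (diffOp S φ₀))
          (toL2 a b (diffOp P φ), toL2 a b (diffOp S φ))
        rw [h1, sub_self] at h2
        exact sub_eq_zero.1 h2)
    have hx : (x + toL2 a b φ₀, g) ∈ column (maxOp a b P) (maxOp a b S) := by
      have h1 := (column (maxOp a b P) (maxOp a b S)).add_mem
        (show (x, (g.1 - toL2 a b (diffOp P φ₀), g.2 - toL2 a b (diffOp S φ₀))) ∈
          column (maxOp a b P) (maxOp a b S) from ⟨hx₁, hx₂⟩)
        (toL2_mem_column h.lt φ₀)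
      simpa using h1
    refine ⟨_, y, hx, (h.mem_extBoundary_iff hx).2 hy', fun θ hθ => ?_⟩
    obtain ⟨φ, rfl⟩ := h.exists_trace_eq θ
    rw [← hy', h0 φ hθ]
  · rintro ⟨x, y, hx, hy, hθ⟩ q ⟨x', y', hx', hy', hy'Θ⟩
    rw [h.bForm_eq hx hx' hy hy', hθ _ hy'Θ]

/-- The restriction of `[P; S]` by boundary conditions `Θ` has self-adjoint (for `κ = 1`) or
skew-adjoint (for `κ = -1`) range if and only if `Θ` is Lagrangian. -/
theorem IsBoundaryForm.rangeRestrict_iff (h : IsBoundaryForm a b κ P S Λ)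
    (hc : IsCoercive (maxOp a b P) (maxOp a b S)) (hPS : dag S * P = κ • (dag P * S))
    (Θ : Submodule ℂ (Vec r × Vec r)) :
    (∀ g, g ∈ rangeRestrict (maxOp a b P) (maxOp a b S) (extBoundary a b P S Λ) Θ ↔
      ∀ q ∈ rangeRestrict (maxOp a b P) (maxOp a b S) (extBoundary a b P S Λ) Θ,
        bForm κ g q = 0) ↔ ∀ y, y ∈ Θ ↔ ∀ θ ∈ Θ, bForm κ y θ = 0 := by
  simp only [h.forall_rangeRestrict_iff hc hPS]
  constructor
  · intro hg y
    obtain ⟨φ, hφ⟩ := h.exists_trace_eq y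
    -- The boundary value depends on the pair in the range alone, not on the chosen preimage `x`.
    have hu : ∀ x z, (x, (toL2 a b (diffOp P φ), toL2 a b (diffOp S φ))) ∈
        column (maxOp a b P) (maxOp a b S) → (x, z) ∈ extBoundary a b P S Λ → z = y :=
      fun x z hx hz => h.eq_of_forall fun ψ => by
        rw [← (h.mem_extBoundary_iff hx).1 hz, h.green, hφ]
    have hm := toL2_mem_column (P := P) (S := S) h.lt φ
    have hb := h.toL2_mem φ
    rw [hφ] at hb
    have h1 := hg (toL2 a b (diffOp P φ), toL2 a b (diffOp S φ))
    constructor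
    · intro hy
      obtain ⟨x, z, hx, hz, hzΘ⟩ := h1.1 ⟨_, _, hm, hb, hy⟩
      rwa [← hu x z hx hz]
    · intro hy
      obtain ⟨x, z, hx, hz, hzΘ⟩ := h1.2 ⟨_, _, hm, hb, hy⟩
      rwa [← hu x z hx hz]
  · intro hΘ g
    constructor
    · rintro ⟨x, y, hx, hy, hyΘ⟩
      exact ⟨x, y, hx, hy, (hΘ y).1 hyΘ⟩
    · rintro ⟨x, y, hx, hy, hyΘ⟩
      exact ⟨x, y, hx, hy, (hΘ y).2 hyΘ⟩

end BoundaryTriplet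

/-! ### Rearrangement and telescoping of finite sums -/

section Sums

theorem sum_range_antidiagonal {α : Type*} [AddCommMonoid α] (M : ℕ) (h : ℕ → ℕ → α)
    (h0 : ∀ i j, M ≤ i + j → h i j = 0) :
    ∑ k ∈ Finset.range M, ∑ j ∈ Finset.range (k + 1), h j (k - j) =
      ∑ i ∈ Finset.range M, ∑ j ∈ Finset.range M, h i j := by
  rw [Finset.sum_range_diag_flip]
  refine Finset.sum_congr rfl fun i hi => ?_
  refine Finset.sum_subset (Finset.range_mono (Nat.sub_le _ _)) fun j _ hj => h0 i j ?_
  rw [Finset.mem_range] at hi hj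
  omega

theorem sum_range_square_eq_sum_antidiagonal {α : Type*} [AddCommMonoid α] (N : ℕ) (h : ℕ → ℕ → α)
    (h0 : ∀ i j, N < i ∨ N < j → h i j = 0) :
    ∑ i ∈ Finset.range (N + 1), ∑ j ∈ Finset.range (N + 1), h i j =
      ∑ p ∈ Finset.range (2 * N + 1), ∑ m ∈ Finset.range (p + 1), h m (p - m) := by
  rw [sum_range_antidiagonal _ _ fun i j hij => h0 i j (by omega)]
  have hs : Finset.range (N + 1) ⊆ Finset.range (2 * N + 1) := Finset.range_mono (by omega)
  have h1 : ∀ i, ∑ j ∈ Finset.range (N + 1), h i j = ∑ j ∈ Finset.range (2 * N + 1), h i j :=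
    fun i => Finset.sum_subset hs fun j _ hj => h0 i j (by rw [Finset.mem_range] at hj; omega)
  simp only [h1]
  refine Finset.sum_subset hs fun i _ hi => Finset.sum_eq_zero fun j _ => h0 i j ?_
  rw [Finset.mem_range] at hi
  omega

theorem sum_range_square_eq_sum_lower (N : ℕ) (c : ℕ → ℕ → ℂ) (hc : ∀ i, c i i = 0) :
    ∑ i ∈ Finset.range N, ∑ j ∈ Finset.range N, c i j =
      ∑ i ∈ Finset.range N, ∑ j ∈ Finset.range i, (c i j + c j i) := by
  induction N with
  | zero => simp
  | succ N ih =>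
    simp only [Finset.sum_range_succ, Finset.sum_add_distrib, hc] at ih ⊢
    rw [ih]
    ring

/-- Off-diagonal pairs are indexed by their larger entry `i` and the distance `l`, which is the
indexing of the matrices `M_{lkm}`. -/
theorem sum_range_square_eq_sum_Icc (N : ℕ) (c : ℕ → ℕ → ℂ) (hc : ∀ i, c i i = 0) :
    ∑ i ∈ Finset.range (N + 1), ∑ j ∈ Finset.range (N + 1), c i j =
      ∑ l ∈ Finset.Icc 1 N, ∑ i ∈ Finset.Icc l N, (c i (i - l) + c (i - l) i) := by
  rw [sum_range_square_eq_sum_lower _ _ hc]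
  symm
  rw [Finset.sum_comm' (s' := fun i => Finset.Icc 1 i)
    (t' := Finset.range (N + 1)) (by simp only [Finset.mem_Icc, Finset.mem_range]; omega)]
  refine Finset.sum_congr rfl fun i _ => ?_
  refine Finset.sum_nbij' (fun l => i - l) (fun j => i - j) ?_ ?_ ?_ ?_ ?_ <;>
    intro j hj <;> simp only [Finset.mem_Icc, Finset.mem_range] at hj ⊢
  · omega
  · omega
  · omega
  · omega

/-- Repeated integration by parts in abstract form: `l` derivatives move from the first slot to the
second, one at a time. -/
theorem sum_telescope (g : ℕ → ℕ → ℂ) (p q l : ℕ) (hl : l ≤ p) :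
    ∑ k ∈ Finset.range l, (-1 : ℂ) ^ k *
      (g (p - k) (q + k) + g (p - 1 - k) (q + k + 1)) =
      g p q - (-1) ^ l * g (p - l) (q + l) := by
  induction l with
  | zero => simp
  | succ l ih =>
    rw [Finset.sum_range_succ, ih (by omega), show p - 1 - l = p - (l + 1) by omega, pow_succ]
    ring_nf

end Sums

/-! ### The boundary matrix: Green's form and surjectivity -/

section BoundaryMatrix

variable {ι : Type} [Fintype ι] {r : ℕ}

theorem inner_toLp (v w : Fin r → ℂ) :
    inner ℂ (WithLp.toLp 2 v : Vec r) (WithLp.toLp 2 w) = star v ⬝ᵥ w := by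
  rw [EuclideanSpace.inner_toLp_toLp, dotProduct_comm]

theorem star_dotProduct_mulVec_mul (U : Matrix ι (Fin r) ℂ) (D : Matrix (Fin r) (Fin r) ℂ)
    (v w : ι → ℂ) : star v ⬝ᵥ (U * D * Uᴴ) *ᵥ w = star (Uᴴ *ᵥ v) ⬝ᵥ D *ᵥ (Uᴴ *ᵥ w) := by
  rw [Matrix.star_mulVec, Matrix.conjTranspose_conjTranspose, ← Matrix.dotProduct_mulVec,
    Matrix.mulVec_mulVec, Matrix.mulVec_mulVec, Matrix.mul_assoc]

/-- With `y₀` built from the difference and `y₁` from the sum of the endpoint values, the symmetry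
of `D` makes the products of values at different endpoints cancel and those at equal endpoints
double. -/
theorem bForm_boundaryMatrix {κ : ℂ} (hκ : κ = 1 ∨ κ = -1) (U : Matrix ι (Fin r) ℂ)
    {D : Matrix (Fin r) (Fin r) ℂ} (hD : Dᴴ = -κ • D) (τ τ' : (ι → ℂ) × (ι → ℂ)) :
    bForm κ (boundaryMatrix U D (-κ) τ) (boundaryMatrix U D (-κ) τ') =
      -κ * (star τ.1 ⬝ᵥ (U * D * Uᴴ) *ᵥ τ'.1 - star τ.2 ⬝ᵥ (U * D * Uᴴ) *ᵥ τ'.2) := by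
  have h2 : ((Real.sqrt 2 : ℝ) : ℂ)⁻¹ * ((Real.sqrt 2 : ℝ) : ℂ)⁻¹ = 1 / 2 := by
    rw [← mul_inv, ← Complex.ofReal_mul, Real.mul_self_sqrt (by norm_num)]
    norm_num
  have hκc : starRingEnd ℂ κ = κ := by rcases hκ with rfl | rfl <;> simp
  have hκ2 : κ * κ = 1 := by rcases hκ with rfl | rfl <;> simp
  have hsD : ∀ v w : Fin r → ℂ, star (D *ᵥ v) ⬝ᵥ w = -κ * (star v ⬝ᵥ D *ᵥ w) := fun v w => by
    rw [Matrix.star_mulVec, ← Matrix.dotProduct_mulVec, hD, Matrix.smul_mulVec, dotProduct_smul,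
      smul_eq_mul]
  have hm : ∀ τ, boundaryMatrix U D (-κ) τ =
      (((Real.sqrt 2 : ℝ) : ℂ)⁻¹ • WithLp.toLp 2 (D *ᵥ (Uᴴ *ᵥ (τ.1 - τ.2))),
        (((Real.sqrt 2 : ℝ) : ℂ)⁻¹ * -κ) • WithLp.toLp 2 (Uᴴ *ᵥ (τ.1 + τ.2))) := fun _ => rfl
  rw [star_dotProduct_mulVec_mul, star_dotProduct_mulVec_mul, hm, hm]
  simp only [bForm, inner_smul_left, inner_smul_right, inner_toLp, map_mul, map_neg, map_inv₀,
    Complex.conj_ofReal, hκc, hsD, Matrix.mulVec_sub, Matrix.mulVec_add, star_add, star_sub,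
    add_dotProduct, sub_dotProduct, dotProduct_add, dotProduct_sub]
  -- What remains is linear in four scalars, with the square of `1 / √2` as the only coefficient to
  -- evaluate.
  generalize star (Uᴴ *ᵥ τ.1) ⬝ᵥ D *ᵥ Uᴴ *ᵥ τ'.1 = z₁
  generalize star (Uᴴ *ᵥ τ.1) ⬝ᵥ D *ᵥ Uᴴ *ᵥ τ'.2 = z₂
  generalize star (Uᴴ *ᵥ τ.2) ⬝ᵥ D *ᵥ Uᴴ *ᵥ τ'.1 = z₃
  generalize star (Uᴴ *ᵥ τ.2) ⬝ᵥ D *ᵥ Uᴴ *ᵥ τ'.2 = z₄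
  generalize ((Real.sqrt 2 : ℝ) : ℂ)⁻¹ = s at h2 ⊢
  rcases hκ with rfl | rfl
  · linear_combination (-2 * (z₁ - z₄)) * h2
  · linear_combination (2 * (z₁ - z₄)) * h2

/-- The middle factor is invertible, since `rk A = rk (U D Uᴴ) ≤ rk D` and `D` has size `rk A`. Sum
and difference of the endpoint values can then be prescribed separately, and `U` lifts them because
`Uᴴ U = 1`. -/
theorem boundaryMatrix_surjective {κ : ℂ} (hκ : κ ≠ 0) [DecidableEq ι] {A : Matrix ι ι ℂ}
    {U : Matrix ι (Fin A.rank) ℂ} {D : Matrix (Fin A.rank) (Fin A.rank) ℂ}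
    (h : IsReducedFactorization A U D) : Function.Surjective (boundaryMatrix U D κ) := by
  obtain ⟨hU, hA⟩ := h
  have hD : Function.Surjective D.mulVecLin := by
    rw [← LinearMap.range_eq_top]
    refine Submodule.eq_top_of_finrank_eq (le_antisymm (Submodule.finrank_le _) ?_)
    have h1 : (U * D * Uᴴ).rank ≤ D.rank :=
      (Matrix.rank_mul_le_left _ _).trans (Matrix.rank_mul_le_right _ _)
    rw [← hA] at h1
    rw [Module.finrank_fin_fun]
    exact h1
  have h2 : ((Real.sqrt 2 : ℝ) : ℂ) ≠ 0 := by simp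
  rintro ⟨y₀, y₁⟩
  obtain ⟨d, hd⟩ := hD (((Real.sqrt 2 : ℝ) : ℂ) • y₀.ofLp)
  set s : Fin A.rank → ℂ := (((Real.sqrt 2 : ℝ) : ℂ) * κ⁻¹) • y₁.ofLp with hs
  have hUU : ∀ v, Uᴴ *ᵥ (U *ᵥ v) = v := fun v => by
    rw [Matrix.mulVec_mulVec, hU, Matrix.one_mulVec]
  rw [Matrix.mulVecLin_apply] at hd
  refine ⟨(U *ᵥ ((1 / 2 : ℂ) • (s + d)), U *ᵥ ((1 / 2 : ℂ) • (s - d))), Prod.ext ?_ ?_⟩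
  · change ((Real.sqrt 2 : ℝ) : ℂ)⁻¹ • WithLp.toLp 2 (D *ᵥ (Uᴴ *ᵥ (U *ᵥ _ - U *ᵥ _))) = y₀
    rw [← Matrix.mulVec_sub, hUU, ← smul_sub, add_sub_sub_cancel, ← two_smul ℂ d, smul_smul]
    norm_num
    rw [hd, WithLp.toLp_smul, inv_smul_smul₀ h2, WithLp.toLp_ofLp]
  · change (((Real.sqrt 2 : ℝ) : ℂ)⁻¹ * κ) • WithLp.toLp 2 (Uᴴ *ᵥ (U *ᵥ _ + U *ᵥ _)) = y₁
    rw [← Matrix.mulVec_add, hUU, ← smul_add, add_add_sub_cancel, ← two_smul ℂ s, smul_smul]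
    norm_num
    rw [hs, WithLp.toLp_smul, smul_smul, WithLp.toLp_ofLp]
    have : ((Real.sqrt 2 : ℝ) : ℂ)⁻¹ * κ * (((Real.sqrt 2 : ℝ) : ℂ) * κ⁻¹) = 1 := by
      field_simp
    rw [this, one_smul]

/-- The middle factor of a reduced factorization inherits symmetry. -/
theorem conjTranspose_middle_factor {c : ℂ} {U : Matrix ι (Fin r) ℂ}
    {D : Matrix (Fin r) (Fin r) ℂ} (hU : Uᴴ * U = 1)
    (hA : (U * D * Uᴴ)ᴴ = c • (U * D * Uᴴ)) : Dᴴ = c • D := by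
  have h1 : D = Uᴴ * (U * D * Uᴴ) * U := by
    calc D = (Uᴴ * U) * D * (Uᴴ * U) := by rw [hU, Matrix.one_mul, Matrix.mul_one]
      _ = _ := by simp only [Matrix.mul_assoc]
  conv_lhs => rw [h1]
  conv_rhs => rw [h1]
  rw [Matrix.conjTranspose_mul, Matrix.conjTranspose_mul, Matrix.conjTranspose_conjTranspose, hA,
    Matrix.smul_mul, Matrix.mul_smul]
  simp only [Matrix.mul_assoc]

variable {n : ℕ}

/-- The sesquilinear form of a block matrix on jets. -/
theorem star_dotProduct_blocks_mulVec {m : ℕ} (X : Fin m → Fin m → Matrix (Fin n) (Fin n) ℂ)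
    (u v : ℕ → Vec n) :
    (star fun k : Fin m × Fin n => u k.1 k.2) ⬝ᵥ
      (Matrix.of fun r c : Fin m × Fin n => X r.1 c.1 r.2 c.2) *ᵥ
        (fun k : Fin m × Fin n => v k.1 k.2) =
      ∑ i : Fin m, ∑ j : Fin m, inner ℂ (u i) (Matrix.toEuclideanLin (X i j) (v j)) := by
  have h2 : ∀ i j : Fin m, inner ℂ (u i) (Matrix.toEuclideanLin (X i j) (v j)) =
      ∑ k, star (u i k) * ∑ l, X i j k l * v j l := fun i j => by
    rw [← WithLp.toLp_ofLp (x := u i), ← WithLp.toLp_ofLp (x := Matrix.toEuclideanLin (X i j) (v j)),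
      inner_toLp]
    rfl
  simp only [h2, dotProduct, Matrix.mulVec, Fintype.sum_prod_type, Matrix.of_apply, Pi.star_apply]
  refine Finset.sum_congr rfl fun i _ => ?_
  rw [Finset.sum_comm]
  exact Finset.sum_congr rfl fun k _ => Finset.mul_sum _ _ _

theorem star_dotProduct_block_mulVec {m : ℕ} (X : Matrix (Fin n) (Fin n) ℂ) {p q : ℕ} (hp : p < m)
    (hq : q < m) (u v : ℕ → Vec n) :
    (star fun k : Fin m × Fin n => u k.1 k.2) ⬝ᵥ
      (Matrix.of fun r c : Fin m × Fin n =>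
        if (r.1 : ℕ) = p ∧ (c.1 : ℕ) = q then X r.2 c.2 else 0) *ᵥ
        (fun k : Fin m × Fin n => v k.1 k.2) =
      inner ℂ (u p) (Matrix.toEuclideanLin X (v q)) := by
  have h1 := star_dotProduct_blocks_mulVec
    (fun i j : Fin m => if (i : ℕ) = p ∧ (j : ℕ) = q then X else 0) u v
  have h2 : ∀ (i j : Fin m) (k l : Fin n), (if (i : ℕ) = p ∧ (j : ℕ) = q then X else 0) k l =
      if (i : ℕ) = p ∧ (j : ℕ) = q then X k l else 0 := fun i j k l => by split_ifs <;> rfl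
  simp only [h2] at h1
  rw [h1, Fintype.sum_eq_single ⟨p, hp⟩, Fintype.sum_eq_single ⟨q, hq⟩]
  · simp
  · intro j hj
    rw [if_neg fun h => hj (Fin.ext h.2)]
    simp
  · intro i hi
    refine Finset.sum_eq_zero fun j _ => ?_
    rw [if_neg fun h => hi (Fin.ext h.1)]
    simp

end BoundaryMatrix

/-! ### Self-adjointness and skew-adjointness in terms of the form -/

section Adjoint

variable {X : Type*} [NormedAddCommGroup X] [InnerProductSpace ℂ X]

theorem mem_adjoint_iff_bForm (R : Submodule ℂ (X × X)) (g : X × X) :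
    g ∈ R.adjoint ↔ ∀ q ∈ R, bForm 1 g q = 0 := by
  have h : ∀ q : X × X, bForm 1 g q = starRingEnd ℂ (inner ℂ q.1 g.2 - inner ℂ q.2 g.1) :=
    fun q => by rw [map_sub, inner_conj_symm, inner_conj_symm, bForm, one_mul]
  simp only [h, map_eq_zero]
  rw [Submodule.mem_adjoint_iff]
  constructor
  · intro hg q hq
    rw [← neg_eq_zero, neg_sub, hg q.1 q.2 hq]
  · intro hg x y hxy
    rw [← neg_eq_zero, neg_sub, hg (x, y) hxy]

theorem isSelfAdjointRel_iff (R : Submodule ℂ (X × X)) :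
    IsSelfAdjointRel R ↔ ∀ g, g ∈ R ↔ ∀ q ∈ R, bForm 1 g q = 0 := by
  rw [IsSelfAdjointRel, SetLike.ext_iff]
  simp only [mem_adjoint_iff_bForm]

/-- Changing the sign of the second components exchanges the forms for `κ = 1` and `κ = -1`, up to a
sign. -/
theorem isSkewAdjointRel_relNeg_iff (R : Submodule ℂ (X × X)) :
    IsSkewAdjointRel (relNeg R) ↔ ∀ g, g ∈ R ↔ ∀ q ∈ R, bForm (-1) g q = 0 := by
  have hneg : ∀ (T : Submodule ℂ (X × X)) (q : X × X), q ∈ relNeg T ↔ (q.1, -q.2) ∈ T :=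
    fun _ _ => Iff.rfl
  have hb : ∀ g : X × X, (g.1, -g.2) ∈ (relNeg R).adjoint ↔
      ∀ q ∈ R, bForm (-1) (g.1, -g.2) q = 0 := fun g => by
    rw [mem_adjoint_iff_bForm]
    constructor
    · intro h q hq
      have h1 := h (q.1, -q.2) (by rw [hneg, neg_neg]; exact hq)
      simp only [bForm, inner_neg_right, inner_neg_left] at h1 ⊢
      rw [← h1]
      ring
    · intro h q hq
      have h1 := h (q.1, -q.2) ((hneg R q).1 hq)
      simp only [bForm, inner_neg_right, inner_neg_left] at h1 ⊢
      rw [← h1]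
      ring
  rw [IsSkewAdjointRel, SetLike.ext_iff]
  simp only [hneg, hb]
  constructor
  · intro h g
    simpa using h (g.1, -g.2)
  · intro h g
    exact h (g.1, -g.2)

end Adjoint

/-! ### Coefficient sequences -/

section Coefficients

variable {n N : ℕ}

theorem coeff_val (P : Fin (N + 1) → Matrix (Fin n) (Fin n) ℂ) (k : Fin (N + 1)) :
    coeff P k = P k := by
  rw [coeff, dif_pos k.2]

theorem coeff_of_lt (P : Fin (N + 1) → Matrix (Fin n) (Fin n) ℂ) {k : ℕ} (hk : N < k) :
    coeff P k = 0 := by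
  rw [coeff, dif_neg (by omega)]

theorem dag_sum_monomial {ι : Type} (s : Finset ι) (C : ι → Matrix (Fin n) (Fin n) ℂ) (e : ι → ℕ) :
    dag (∑ k ∈ s, Polynomial.monomial (e k) (C k)) =
      ∑ k ∈ s, Polynomial.monomial (e k) ((-1 : ℂ) ^ (e k) • (C k)ᴴ) := by
  ext1 j
  rw [dag_coeff, Polynomial.finsetSum_coeff, Polynomial.finsetSum_coeff, Matrix.conjTranspose_sum,
    Finset.smul_sum]
  refine Finset.sum_congr rfl fun k _ => ?_
  rw [Polynomial.coeff_monomial, Polynomial.coeff_monomial]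
  split_ifs with h
  · rw [h]
  · simp

end Coefficients

/-! ### The skew operator and the matrix `Q` -/

section SkewOperator

variable {a b : ℝ} {n M : ℕ} (J : Fin (M + 1) → Matrix (Fin n) (Fin n) ℂ)

/-- The differential expression `∑ₖ Jₖ Dᵏ`. -/
def polySkew : MatPoly n := ∑ k : Fin (M + 1), Polynomial.monomial (k : ℕ) (J k)

theorem polySkew_coeff (k : ℕ) : (polySkew J).coeff k = coeff J k := by
  rw [polySkew, Polynomial.finsetSum_coeff]
  simp only [Polynomial.coeff_monomial]
  by_cases hk : k < M + 1
  · rw [Fintype.sum_eq_single ⟨k, hk⟩ fun j hj => if_neg fun h => hj (Fin.ext h), if_pos rfl,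
      ← coeff_val J]
  · rw [coeff_of_lt _ (by omega)]
    exact Finset.sum_eq_zero fun j _ => if_neg (by omega)

theorem polySkew_natDegree_le : (polySkew J).natDegree ≤ M := by
  rw [Polynomial.natDegree_le_iff_coeff_eq_zero]
  intro k hk
  rw [polySkew_coeff, coeff_of_lt _ hk]

theorem maximalSkew_eq : maximalSkew a b J = maxOp a b (polySkew J) :=
  adjoint_minimalOp _ _ (dag_sum_monomial _ _ _)

variable {J}

theorem conjTranspose_coeff_skew (hJ : ∀ k, J k = (-1 : ℂ) ^ ((k : ℕ) + 1) • (J k)ᴴ)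
    (k : ℕ) : (coeff J k)ᴴ = (-1 : ℂ) ^ (k + 1) • coeff J k := by
  by_cases hk : k < M + 1
  · rw [coeff, dif_pos hk]
    conv_rhs => rw [hJ]
    rw [smul_smul, ← mul_pow]
    simp
  · rw [coeff_of_lt _ (by omega)]
    simp

theorem dag_polySkew (hJ : ∀ k, J k = (-1 : ℂ) ^ ((k : ℕ) + 1) • (J k)ᴴ) : dag (polySkew J) = -polySkew J := by
  ext1 k
  rw [dag_coeff, Polynomial.coeff_neg, polySkew_coeff, conjTranspose_coeff_skew hJ, smul_smul,
    pow_succ, ← mul_assoc, ← mul_pow]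
  simp

/-- The symmetry of `J_{r+c+1}` contributes the sign `(-1)^(r+c)`, which exchanges the column sign
for the row sign. -/
theorem matQ_isHermitian (hJ : ∀ k, J k = (-1 : ℂ) ^ ((k : ℕ) + 1) • (J k)ᴴ) : (matQ J)ᴴ = matQ J := by
  ext r c
  have h := congrFun (congrFun (conjTranspose_coeff_skew hJ (r.1 + c.1 + 1)) r.2) c.2
  rw [Matrix.conjTranspose_apply, matQ, Matrix.of_apply, Matrix.of_apply, Matrix.smul_apply,
    Matrix.smul_apply, star_smul, add_comm (c.1 : ℕ) r.1]
  rw [Matrix.conjTranspose_apply, Matrix.smul_apply] at h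
  rw [h, smul_smul]
  congr 1
  rw [star_pow, star_neg, star_one, ← pow_add,
    show (c.1 : ℕ) + (r.1 + c.1 + 1 + 1) = r.1 + 2 * (c.1 + 1) by ring, pow_add, pow_mul]
  simp

/-- The concomitant of `∑ₖ Jₖ Dᵏ` is given by the matrix `Q`. -/
theorem concomitant_polySkew (hJ : ∀ k, J k = (-1 : ℂ) ^ ((k : ℕ) + 1) • (J k)ᴴ)
    (u v : ℕ → Vec n) : concomitant M (polySkew J) u v =
    (star fun k : Fin M × Fin n => u k.1 k.2) ⬝ᵥ matQ J *ᵥ fun k : Fin M × Fin n => v k.1 k.2 := by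
  have h1 := star_dotProduct_blocks_mulVec
    (fun i j : Fin M => (-1 : ℂ) ^ (i : ℕ) • coeff J (i + j + 1)) u v
  rw [matQ, h1, concomitant, Finset.sum_range_succ', Finset.range_zero, Finset.sum_empty, add_zero]
  have h2 : ∀ i j : ℕ, inner ℂ (Matrix.toEuclideanLin (coeff J (i + j + 1)) (u i)) (v j) =
      (-1 : ℂ) ^ (i + j) *
        inner ℂ (u i) (Matrix.toEuclideanLin (coeff J (i + j + 1)) (v j)) := fun i j => by
    rw [inner_toEuclideanLin_left, conjTranspose_coeff_skew hJ, map_smul, LinearMap.smul_apply,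
      inner_smul_right, show i + j + 1 + 1 = i + j + 2 by rfl, pow_add]
    norm_num
  set f : ℕ → ℕ → ℂ := fun j i =>
    inner ℂ (u i) (Matrix.toEuclideanLin ((-1 : ℂ) ^ i • coeff J (i + j + 1)) (v j)) with hf
  have h3 : ∀ k ∈ Finset.range M, ∑ j ∈ Finset.range (k + 1), (-1 : ℂ) ^ j *
      inner ℂ (Matrix.toEuclideanLin ((polySkew J).coeff (k + 1)) (u (k + 1 - 1 - j))) (v j) =
      ∑ j ∈ Finset.range (k + 1), f j (k - j) := fun k _ => by
    refine Finset.sum_congr rfl fun j hj => ?_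
    rw [Finset.mem_range] at hj
    have h4 := h2 (k - j) j
    rw [show k - j + j = k by omega] at h4
    rw [polySkew_coeff, Nat.add_sub_cancel, h4, hf]
    simp only
    rw [map_smul, LinearMap.smul_apply, inner_smul_right, show k - j + j = k by omega, ← mul_assoc,
      ← pow_add, show j + k = k - j + 2 * j by omega, pow_add, pow_mul]
    simp
  -- The concomitant sums along antidiagonals; as `J_k = 0` for `k > M`, these fill the whole
  -- square.
  rw [Finset.sum_congr rfl h3, sum_range_antidiagonal, Finset.sum_comm, Finset.sum_range]
  · exact Finset.sum_congr rfl fun i _ => Finset.sum_range _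
  · intro j i hij
    rw [hf]
    simp only
    rw [coeff_of_lt _ (by omega)]
    simp

/-- The graph of the operator is the range of `[1; J]`. Since `J† = -J`, Lagrange's identity is
Green's identity with `κ = -1`, and its boundary terms are the form of `Q` at `b` minus that at `a`.
-/
theorem isBoundaryForm_skew (hJ : ∀ k, J k = (-1 : ℂ) ^ ((k : ℕ) + 1) • (J k)ᴴ)
    (hab : a < b) {V : Matrix (Fin M × Fin n) (Fin (matQ J).rank) ℂ}
    {C : Matrix (Fin (matQ J).rank) (Fin (matQ J).rank) ℂ}
    (hQ : IsReducedFactorization (matQ J) V C) :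
    IsBoundaryForm a b (-1) 1 (polySkew J) (boundaryMatrix V C 1) where
  lt := hab
  sign := Or.inr rfl
  surjective := boundaryMatrix_surjective one_ne_zero hQ
  green φ ψ := by
    have hC : Cᴴ = -(-1 : ℂ) • C := by
      rw [neg_neg]
      refine conjTranspose_middle_factor hQ.1 ?_
      have h := matQ_isHermitian hJ
      rw [one_smul]
      exact (congrArg Matrix.conjTranspose hQ.2).symm.trans (h.trans hQ.2)
    have h := bForm_boundaryMatrix (Or.inr rfl) V hC (smoothTrace a b M φ) (smoothTrace a b M ψ)
    have hVC : V * C * Vᴴ = matQ J := hQ.2.symm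
    simp only [neg_neg, one_mul, hVC] at h
    rw [h]
    have h1 := inner_diffOp_sub_inner_dag hab.le (polySkew_natDegree_le J) φ ψ
    rw [concomitant_polySkew hJ, concomitant_polySkew hJ, dag_polySkew hJ] at h1
    refine Eq.trans ?_ h1
    rw [pairing_apply, bForm]
    simp only [map_one, Module.End.one_apply, map_neg, LinearMap.neg_apply, inner_neg_right]
    ring

end SkewOperator

/-! ### Graphs as ranges of `[1; S]` -/

section One

variable {a b : ℝ} {n : ℕ}

theorem mem_maxOp_one {x y : L2 a b n} : (x, y) ∈ maxOp a b (1 : MatPoly n) ↔ y = x := by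
  have h : (x, x) ∈ maxOp a b (1 : MatPoly n) := fun φ _ => by
    simp only [dag_one, map_one, Module.End.one_apply]
  exact ⟨fun h' => maxOp_unique h' h, fun h' => h' ▸ h⟩

theorem mem_column_one {S : Submodule ℂ (L2 a b n × L2 a b n)} {x : L2 a b n}
    {q : L2 a b n × L2 a b n} : (x, q) ∈ column (maxOp a b 1) S ↔ q.1 = x ∧ q ∈ S := by
  constructor
  · rintro ⟨h₁, h₂⟩
    have h := mem_maxOp_one.1 h₁
    exact ⟨h, by rw [← h] at h₂; exact h₂⟩
  · rintro ⟨rfl, h⟩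
    exact ⟨mem_maxOp_one.2 rfl, h⟩

theorem isCoercive_one (S : Submodule ℂ (L2 a b n × L2 a b n)) :
    IsCoercive (maxOp a b 1) S := by
  refine ⟨1, one_pos, fun x p s h => ?_⟩
  obtain rfl : p = x := mem_maxOp_one.1 h.1
  rw [one_mul]
  exact Real.le_sqrt_of_sq_le (le_add_of_nonneg_right (sq_nonneg _))

theorem rangeRestrict_one {G : Type*} [NormedAddCommGroup G] [InnerProductSpace ℂ G]
    (S : Submodule ℂ (L2 a b n × L2 a b n)) (Γ : Submodule ℂ (L2 a b n × (G × G)))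
    (Θ : Submodule ℂ (G × G)) : rangeRestrict (maxOp a b 1) S Γ Θ = graphRestrict S Γ Θ := by
  ext q
  constructor
  · rintro ⟨x, y, h, hy, hΘ⟩
    obtain ⟨rfl, hq⟩ := mem_column_one.1 h
    exact ⟨hq, y, hy, hΘ⟩
  · rintro ⟨hq, y, hy, hΘ⟩
    exact ⟨q.1, y, mem_column_one.2 ⟨rfl, hq⟩, hy, hΘ⟩

theorem graphNormExtension_one {W : Type*} [NormedAddCommGroup W] [NormedSpace ℂ W]
    (S : Submodule ℂ (L2 a b n × L2 a b n)) (Γ : Submodule ℂ (L2 a b n × W)) :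
    graphNormExtension S Γ = graphNormExtension (column (maxOp a b 1) S) Γ := by
  ext q
  constructor
  · rintro ⟨z, hz, u, v, w, h, hu, hv, hw⟩
    exact ⟨(q.1, z), mem_column_one.2 ⟨rfl, hz⟩, u, fun j => (u j, v j), w,
      fun j => ⟨mem_column_one.2 ⟨rfl, (h j).1⟩, (h j).2⟩, hu, hu.prodMk_nhds hv, hw⟩
  · rintro ⟨z, hz, u, v, w, h, hu, hv, hw⟩
    exact ⟨z.2, hz.2, u, fun j => (v j).2, w, fun j => ⟨(h j).1.2, (h j).2⟩, hu,
      (continuous_snd.tendsto z).comp hv, hw⟩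

end One

/-! ### The boundary triplet and the Dirac structure of the skew operator -/

section SkewTriplet

variable {a b : ℝ} {n M : ℕ} {J : Fin (M + 1) → Matrix (Fin n) (Fin n) ℂ}
  {V : Matrix (Fin M × Fin n) (Fin (matQ J).rank) ℂ}
  {C : Matrix (Fin (matQ J).rank) (Fin (matQ J).rank) ℂ}

theorem skewBoundary_eq : skewBoundary a b J V C =
    extBoundary a b 1 (polySkew J) (boundaryMatrix V C 1) := by
  rw [skewBoundary, maximalSkew_eq, graphNormExtension_one]
  rfl

theorem isSkewBoundaryTriplet (hab : a < b)
    (hJ : ∀ k, J k = (-1 : ℂ) ^ ((k : ℕ) + 1) • (J k)ᴴ)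
    (hQ : IsReducedFactorization (matQ J) V C) :
    IsSkewBoundaryTriplet (maximalSkew a b J) (skewBoundary a b J V C) := by
  have h := isBoundaryForm_skew hJ hab hQ
  rw [skewBoundary_eq, maximalSkew_eq]
  have hm : ∀ {x z : L2 a b n}, (x, z) ∈ maxOp a b (polySkew J) →
      (x, (x, z)) ∈ column (maxOp a b 1) (maxOp a b (polySkew J)) :=
    fun hz => mem_column_one.2 ⟨rfl, hz⟩
  refine ⟨fun x y hy => ?_, fun x z hz => h.existsUnique (hm hz), h.exists_mem,
    fun x z y x' z' y' hz hz' hy hy' => ?_⟩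
  · obtain ⟨q, hq, -⟩ := h.exists_column hy
    exact ⟨q.2, hq.2⟩
  · have h1 := h.bForm_eq (hm hz) (hm hz') hy hy'
    simpa only [bForm, neg_mul, one_mul, sub_neg_eq_add] using h1

theorem isSkewAdjointRel_iff_boundary (hab : a < b)
    (hJ : ∀ k, J k = (-1 : ℂ) ^ ((k : ℕ) + 1) • (J k)ᴴ)
    (hQ : IsReducedFactorization (matQ J) V C)
    (F E : Matrix (Fin (matQ J).rank) (Fin (matQ J).rank) ℂ) :
    IsSkewAdjointRel (relNeg (graphRestrict (maximalSkew a b J) (skewBoundary a b J V C)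
      (kerPair F E))) ↔ F * Eᴴ = -(E * Fᴴ) ∧ (Matrix.fromCols F E).rank = (matQ J).rank := by
  have h := isBoundaryForm_skew hJ hab hQ
  rw [skewBoundary_eq, maximalSkew_eq, ← rangeRestrict_one, isSkewAdjointRel_relNeg_iff,
    h.rangeRestrict_iff (isCoercive_one _), kerPair_lagrangian_iff (Or.inr rfl), neg_one_smul]
  rw [dag_polySkew hJ, dag_one, mul_one, one_mul, neg_one_smul]

end SkewTriplet

/-! ### The operators `P`, `S`, the matrix `A` and the Lagrangian side -/

section EvenOperators

variable {a b : ℝ} {n N : ℕ} (P S : Fin (N + 1) → Matrix (Fin n) (Fin n) ℂ)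

/-- The differential expression `∑ₖ Pₖ D²ᵏ`. -/
def polyEven : MatPoly n := ∑ k : Fin (N + 1), Polynomial.monomial (2 * (k : ℕ)) (P k)

theorem polyEven_eq : polyEven P =
    ∑ k ∈ Finset.range (N + 1), Polynomial.monomial (2 * k) (coeff P k) := by
  rw [Finset.sum_range]
  exact Finset.sum_congr rfl fun k _ => by rw [coeff_val]

theorem dag_polyEven : dag (polyEven P) =
    ∑ k : Fin (N + 1), Polynomial.monomial (2 * (k : ℕ)) (P k)ᴴ := by
  rw [polyEven, dag_sum_monomial]
  simp [pow_mul]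

theorem maximalEven_eq : maximalEven a b P = maxOp a b (polyEven P) :=
  adjoint_minimalOp _ _ (dag_polyEven P)

theorem diffOp_polyEven (φ : Smooth n) (t : ℝ) : (diffOp (polyEven P) φ).1 t =
    ∑ k ∈ Finset.range (N + 1), Matrix.toEuclideanLin (coeff P k) (jet φ t (2 * k)) := by
  rw [polyEven, diffOp_sum_monomial, diffExpr, Finset.sum_range]
  exact Finset.sum_congr rfl fun k _ => by rw [coeff_val]; rfl

/-- The coefficient `∑_{m ≤ p} S_mᴴ P_{p-m}` of order `2p` of `S† P`. -/
def convCoeff (p : ℕ) : Matrix (Fin n) (Fin n) ℂ :=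
  ∑ m ∈ Finset.range (p + 1), (coeff S m)ᴴ * coeff P (p - m)

theorem dag_polyEven_mul : dag (polyEven S) * polyEven P =
    ∑ p ∈ Finset.range (2 * N + 1), Polynomial.monomial (2 * p) (convCoeff P S p) := by
  have h : dag (polyEven S) =
      ∑ k ∈ Finset.range (N + 1), Polynomial.monomial (2 * k) (coeff S k)ᴴ := by
    rw [dag_polyEven, Finset.sum_range]
    exact Finset.sum_congr rfl fun k _ => by rw [coeff_val]
  rw [h, polyEven_eq, Finset.sum_mul_sum]
  simp only [Polynomial.monomial_mul_monomial]
  rw [sum_range_square_eq_sum_antidiagonal]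
  · refine Finset.sum_congr rfl fun p _ => ?_
    rw [convCoeff, map_sum]
    refine Finset.sum_congr rfl fun m hm => ?_
    rw [Finset.mem_range] at hm
    rw [← mul_add, show m + (p - m) = p by omega]
  · rintro i j (hi | hj)
    · simp [coeff_of_lt S hi]
    · simp [coeff_of_lt P hj]

/-- The product `S† P` has only even orders, with coefficients that are Hermitian by assumption, so
it is formally self-adjoint. -/
theorem dag_polyEven_mul_comm (h : SymmetricCoeffs P S) :
    dag (polyEven S) * polyEven P = (1 : ℂ) • (dag (polyEven P) * polyEven S) := by
  have h1 : dag (polyEven P) * polyEven S = dag (dag (polyEven S) * polyEven P) := by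
    rw [dag_mul, dag_dag]
  rw [h1, one_smul, dag_polyEven_mul, dag_sum_monomial]
  refine Finset.sum_congr rfl fun p hp => ?_
  have h2 : (convCoeff P S p)ᴴ = convCoeff P S p := h p (by rw [Finset.mem_range] at hp; omega)
  rw [h2, pow_mul]
  simp

/-- The pairing `⟪S_i u_p, P_j v_q⟫`. -/
def coeffPairing (i j : ℕ) (u v : ℕ → Vec n) (p q : ℕ) : ℂ :=
  inner ℂ (Matrix.toEuclideanLin (coeff S i) (u p)) (Matrix.toEuclideanLin (coeff P j) (v q))

theorem hasDerivAt_coeffPairing (i j : ℕ) (φ ψ : Smooth n) (p q : ℕ) (t : ℝ) :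
    HasDerivAt (fun t => coeffPairing P S i j (jet φ t) (jet ψ t) p q)
      (coeffPairing P S i j (jet φ t) (jet ψ t) (p + 1) q +
        coeffPairing P S i j (jet φ t) (jet ψ t) p (q + 1)) t := by
  have h := (hasDerivAt_toEuclideanLin (coeff S i) (hasDerivAt_jet φ t p)).inner ℂ
    (hasDerivAt_toEuclideanLin (coeff P j) (hasDerivAt_jet ψ t q))
  rw [add_comm] at h
  exact h

/-- The sum of the matrices `M_{lkm}`. -/
def sumM : Matrix (Fin (2 * N) × Fin n) (Fin (2 * N) × Fin n) ℂ :=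
  ∑ l ∈ Finset.Icc 1 N, ∑ k ∈ Finset.range l, ∑ i ∈ Finset.Icc l N, blockM P S l k i

/-- The sesquilinear form of the sum of the matrices `M_{lkm}` on jets. -/
def formM (u v : ℕ → Vec n) : ℂ :=
  (star fun k : Fin (2 * N) × Fin n => u k.1 k.2) ⬝ᵥ
    sumM P S *ᵥ fun k : Fin (2 * N) × Fin n => v k.1 k.2

theorem form_blockM {l k i : ℕ} (hk : k < l) (hl : l ≤ i) (hi : i ≤ N) (u v : ℕ → Vec n) :
    (star fun k : Fin (2 * N) × Fin n => u k.1 k.2) ⬝ᵥ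
      blockM P S l k i *ᵥ (fun k : Fin (2 * N) × Fin n => v k.1 k.2) =
      (-1 : ℂ) ^ k * (coeffPairing P S i (i - l) u v (2 * i - 1 - k) (2 * (i - l) + k) +
        coeffPairing P S (i - l) i u v (2 * (i - l) + k) (2 * i - 1 - k)) := by
  have h : blockM P S l k i =
      (Matrix.of fun r c : Fin (2 * N) × Fin n =>
        if (r.1 : ℕ) = 2 * i - 1 - k ∧ (c.1 : ℕ) = 2 * (i - l) + k then
          ((-1 : ℂ) ^ k • ((coeff S i)ᴴ * coeff P (i - l))) r.2 c.2 else 0) +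
      Matrix.of fun r c : Fin (2 * N) × Fin n =>
        if (r.1 : ℕ) = 2 * (i - l) + k ∧ (c.1 : ℕ) = 2 * i - 1 - k then
          ((-1 : ℂ) ^ k • ((coeff S (i - l))ᴴ * coeff P i)) r.2 c.2 else 0 := by
    ext r c
    rw [blockM, Matrix.of_apply, Matrix.add_apply, Matrix.of_apply, Matrix.of_apply]
    split_ifs with h₁ h₂ h₂
    -- The two blocks never coincide: that would force `2 l - 1 = 2 k`.
    · omega
    · rw [add_zero]
    · rw [zero_add]
    · rw [add_zero]
  rw [h, Matrix.add_mulVec, dotProduct_add,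
    star_dotProduct_block_mulVec _ (by omega) (by omega),
    star_dotProduct_block_mulVec _ (by omega) (by omega), map_smul, map_smul,
    LinearMap.smul_apply, LinearMap.smul_apply, inner_smul_right, inner_smul_right, ← mul_add,
    toEuclideanLin_mul_apply, toEuclideanLin_mul_apply, ← inner_toEuclideanLin_left,
    ← inner_toEuclideanLin_left]
  rfl

theorem formM_eq (u v : ℕ → Vec n) : formM P S u v =
    ∑ l ∈ Finset.Icc 1 N, ∑ k ∈ Finset.range l, ∑ i ∈ Finset.Icc l N,
      (-1 : ℂ) ^ k * (coeffPairing P S i (i - l) u v (2 * i - 1 - k) (2 * (i - l) + k) +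
        coeffPairing P S (i - l) i u v (2 * (i - l) + k) (2 * i - 1 - k)) := by
  simp only [formM, sumM, Matrix.sum_mulVec, dotProduct_sum]
  refine Finset.sum_congr rfl fun l _ => Finset.sum_congr rfl fun k hk =>
    Finset.sum_congr rfl fun i hi => ?_
  rw [Finset.mem_Icc] at hi
  exact form_blockM P S (Finset.mem_range.1 hk) hi.1 hi.2 u v

/-- Modulo exact derivatives, each `⟪S_i φ^(2i), P_j ψ^(2j)⟫` can be brought to equal orders `i + j`
in both slots by moving `|i - j|` derivatives across. The terms differentiated on the way are the
blocks of `M_{lkm}` with `l = |i - j|`; pairs with `i = j` contribute none. -/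
theorem hasDerivAt_formM (φ ψ : Smooth n) (t : ℝ) :
    HasDerivAt (fun t => formM P S (jet φ t) (jet ψ t))
      (∑ i ∈ Finset.range (N + 1), ∑ j ∈ Finset.range (N + 1),
        (coeffPairing P S i j (jet φ t) (jet ψ t) (2 * i) (2 * j) -
          (-1) ^ (i + j) * coeffPairing P S i j (jet φ t) (jet ψ t) (i + j) (i + j))) t := by
  rw [sum_range_square_eq_sum_Icc]
  · simp only [formM_eq]
    have h : ∀ l ∈ Finset.Icc 1 N, ∀ i ∈ Finset.Icc l N,
        (coeffPairing P S i (i - l) (jet φ t) (jet ψ t) (2 * i) (2 * (i - l)) -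
            (-1) ^ (i + (i - l)) *
              coeffPairing P S i (i - l) (jet φ t) (jet ψ t) (i + (i - l)) (i + (i - l)) +
          (coeffPairing P S (i - l) i (jet φ t) (jet ψ t) (2 * (i - l)) (2 * i) -
            (-1) ^ (i - l + i) *
              coeffPairing P S (i - l) i (jet φ t) (jet ψ t) (i - l + i) (i - l + i))) =
        ∑ k ∈ Finset.range l, (-1 : ℂ) ^ k *
          ((coeffPairing P S i (i - l) (jet φ t) (jet ψ t) (2 * i - 1 - k + 1) (2 * (i - l) + k) +
            coeffPairing P S i (i - l) (jet φ t) (jet ψ t) (2 * i - 1 - k) (2 * (i - l) + k + 1)) +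
          (coeffPairing P S (i - l) i (jet φ t) (jet ψ t) (2 * (i - l) + k + 1) (2 * i - 1 - k) +
            coeffPairing P S (i - l) i (jet φ t) (jet ψ t) (2 * (i - l) + k)
              (2 * i - 1 - k + 1))) := by
      intro l hl i hi
      rw [Finset.mem_Icc] at hl hi
      have h1 := sum_telescope (fun p q => coeffPairing P S i (i - l) (jet φ t) (jet ψ t) p q)
        (2 * i) (2 * (i - l)) l (by omega)
      have h2 := sum_telescope (fun p q => coeffPairing P S (i - l) i (jet φ t) (jet ψ t) q p)
        (2 * i) (2 * (i - l)) l (by omega)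
      have h3 : (-1 : ℂ) ^ (i + (i - l)) = (-1) ^ l := by
        rw [show i + (i - l) = 2 * (i - l) + l by omega, pow_add, pow_mul]
        simp
      simp only [show 2 * i - l = i + (i - l) by omega,
        show 2 * (i - l) + l = i + (i - l) by omega, ← h3] at h1 h2
      rw [add_comm (i - l) i, ← h1, ← h2, ← Finset.sum_add_distrib]
      refine Finset.sum_congr rfl fun k hk => ?_
      rw [Finset.mem_range] at hk
      rw [show 2 * i - 1 - k + 1 = 2 * i - k by omega]
      ring
    rw [Finset.sum_congr rfl fun l hl => Finset.sum_congr rfl (h l hl)]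
    have h4 : ∀ l ∈ Finset.Icc 1 N, ∀ k ∈ Finset.range l, ∀ i ∈ Finset.Icc l N, HasDerivAt
        (fun t => (-1 : ℂ) ^ k *
          (coeffPairing P S i (i - l) (jet φ t) (jet ψ t) (2 * i - 1 - k) (2 * (i - l) + k) +
            coeffPairing P S (i - l) i (jet φ t) (jet ψ t) (2 * (i - l) + k) (2 * i - 1 - k))) _ t :=
      fun l _ k _ i _ => ((hasDerivAt_coeffPairing P S i (i - l) φ ψ (2 * i - 1 - k)
        (2 * (i - l) + k) t).add (hasDerivAt_coeffPairing P S (i - l) i φ ψ (2 * (i - l) + k)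
        (2 * i - 1 - k) t)).const_mul ((-1 : ℂ) ^ k)
    have h5 := HasDerivAt.fun_sum fun l hl => HasDerivAt.fun_sum fun k hk =>
      HasDerivAt.fun_sum (h4 l hl k hk)
    refine h5.congr_deriv ?_
    exact Finset.sum_congr rfl fun l _ => Finset.sum_comm
  · intro i
    rw [← two_mul, pow_mul]
    simp

/-- The part of the pairing of `S` and `P` which is not an exact derivative is Hermitian. -/
theorem sum_coeffPairing_eq (u v : ℕ → Vec n) :
    ∑ i ∈ Finset.range (N + 1), ∑ j ∈ Finset.range (N + 1),
        (-1 : ℂ) ^ (i + j) * coeffPairing P S i j u v (i + j) (i + j) =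
      ∑ p ∈ Finset.range (2 * N + 1),
        (-1) ^ p * inner ℂ (u p) (Matrix.toEuclideanLin (convCoeff P S p) (v p)) := by
  rw [sum_range_square_eq_sum_antidiagonal]
  · refine Finset.sum_congr rfl fun p _ => ?_
    rw [convCoeff, map_sum, LinearMap.sum_apply, inner_sum, Finset.mul_sum]
    refine Finset.sum_congr rfl fun m hm => ?_
    rw [Finset.mem_range] at hm
    rw [show m + (p - m) = p by omega, coeffPairing, toEuclideanLin_mul_apply,
      inner_toEuclideanLin_left]
  · rintro i j (hi | hj)
    · simp [coeffPairing, coeff_of_lt S hi]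
    · simp [coeffPairing, coeff_of_lt P hj]

theorem conj_sum_coeffPairing (h : SymmetricCoeffs P S) (u v : ℕ → Vec n) :
    starRingEnd ℂ (∑ i ∈ Finset.range (N + 1), ∑ j ∈ Finset.range (N + 1),
        (-1 : ℂ) ^ (i + j) * coeffPairing P S i j v u (i + j) (i + j)) =
      ∑ i ∈ Finset.range (N + 1), ∑ j ∈ Finset.range (N + 1),
        (-1 : ℂ) ^ (i + j) * coeffPairing P S i j u v (i + j) (i + j) := by
  rw [sum_coeffPairing_eq, sum_coeffPairing_eq, map_sum]
  refine Finset.sum_congr rfl fun p hp => ?_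
  have h2 : (convCoeff P S p)ᴴ = convCoeff P S p := h p (by rw [Finset.mem_range] at hp; omega)
  rw [map_mul, inner_conj_symm, inner_toEuclideanLin_left, h2]
  simp

theorem sum_coeffPairing_jet (φ ψ : Smooth n) (t : ℝ) :
    ∑ i ∈ Finset.range (N + 1), ∑ j ∈ Finset.range (N + 1),
      coeffPairing P S i j (jet φ t) (jet ψ t) (2 * i) (2 * j) =
      inner ℂ ((diffOp (polyEven S) φ).1 t) ((diffOp (polyEven P) ψ).1 t) := by
  rw [diffOp_polyEven, diffOp_polyEven, sum_inner]
  exact Finset.sum_congr rfl fun i _ => (inner_sum _ _ _).symm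

/-- Subtract the conjugate with the roles of `φ` and `ψ` exchanged: the remainder of equal orders is
Hermitian by the symmetry condition, so it drops out. -/
theorem hasDerivAt_formM_sub (h : SymmetricCoeffs P S) (φ ψ : Smooth n) (t : ℝ) :
    HasDerivAt (fun t => formM P S (jet φ t) (jet ψ t) -
        starRingEnd ℂ (formM P S (jet ψ t) (jet φ t)))
      (inner ℂ ((diffOp (polyEven S) φ).1 t) ((diffOp (polyEven P) ψ).1 t) -
        inner ℂ ((diffOp (polyEven P) φ).1 t) ((diffOp (polyEven S) ψ).1 t)) t := by
  have h1 := hasDerivAt_formM P S φ ψ t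
  have h2 := Complex.conjCLE.toContinuousLinearMap.hasFDerivAt.comp_hasDerivAt t
    (hasDerivAt_formM P S ψ φ t)
  refine (h1.sub h2).congr_deriv ?_
  simp only [Finset.sum_sub_distrib, sum_coeffPairing_jet]
  change _ - starRingEnd ℂ _ = _
  rw [map_sub, conj_sum_coeffPairing P S h, inner_conj_symm]
  ring

theorem form_matA (u v : ℕ → Vec n) :
    (star fun k : Fin (2 * N) × Fin n => u k.1 k.2) ⬝ᵥ
      matA P S *ᵥ (fun k : Fin (2 * N) × Fin n => v k.1 k.2) =
      starRingEnd ℂ (formM P S v u) - formM P S u v := by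
  have h : matA P S = (sumM P S)ᴴ - sumM P S := by
    rw [matA, matB, Matrix.conjTranspose_conjTranspose]
    rfl
  rw [h, Matrix.sub_mulVec, dotProduct_sub, formM, formM, starRingEnd_apply, Matrix.star_dotProduct,
    Matrix.star_mulVec, ← Matrix.dotProduct_mulVec, dotProduct_comm,
    Matrix.conjTranspose_conjTranspose, dotProduct_comm]

theorem matA_conjTranspose : (matA P S)ᴴ = -matA P S := by
  rw [matA, Matrix.conjTranspose_sub, Matrix.conjTranspose_conjTranspose, neg_sub]

variable {P S}

/-- Integrating the exact derivative gives minus the form of `A` at `b` plus that at `a`. The sign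
agrees with the `-I` in the second row of the boundary matrix. -/
theorem isBoundaryForm_range (hab : a < b) (h : SymmetricCoeffs P S)
    {U : Matrix (Fin (2 * N) × Fin n) (Fin (matA P S).rank) ℂ}
    {D : Matrix (Fin (matA P S).rank) (Fin (matA P S).rank) ℂ}
    (hA : IsReducedFactorization (matA P S) U D) :
    IsBoundaryForm a b 1 (polyEven P) (polyEven S) (boundaryMatrix U D (-1)) where
  lt := hab
  sign := Or.inl rfl
  surjective := boundaryMatrix_surjective (neg_ne_zero.2 one_ne_zero) hA
  green φ ψ := by
    have hD : Dᴴ = -(1 : ℂ) • D := by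
      refine conjTranspose_middle_factor hA.1 ?_
      rw [neg_one_smul]
      exact (congrArg Matrix.conjTranspose hA.2).symm.trans
        ((matA_conjTranspose P S).trans (congrArg Neg.neg hA.2))
    have hUD : U * D * Uᴴ = matA P S := hA.2.symm
    have hform : ∀ t, (star fun k : Fin (2 * N) × Fin n => jet φ t k.1 k.2) ⬝ᵥ
        matA P S *ᵥ (fun k : Fin (2 * N) × Fin n => jet ψ t k.1 k.2) = _ := fun t =>
      form_matA P S (jet φ t) (jet ψ t)
    have hE := bForm_boundaryMatrix (Or.inl rfl) U hD (smoothTrace a b (2 * N) φ)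
      (smoothTrace a b (2 * N) ψ)
    rw [hUD] at hE
    refine Eq.trans ?_ hE.symm
    change _ = -1 * ((star fun k : Fin (2 * N) × Fin n => jet φ b k.1 k.2) ⬝ᵥ
        matA P S *ᵥ (fun k : Fin (2 * N) × Fin n => jet ψ b k.1 k.2) -
      (star fun k : Fin (2 * N) × Fin n => jet φ a k.1 k.2) ⬝ᵥ
        matA P S *ᵥ (fun k : Fin (2 * N) × Fin n => jet ψ a k.1 k.2))
    have hi := intervalIntegral.integral_eq_sub_of_hasDerivAt (a := a) (b := b)
      (fun t _ => hasDerivAt_formM_sub P S h φ ψ t)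
      ((((smooth_continuous _).inner (smooth_continuous _)).sub
        ((smooth_continuous _).inner (smooth_continuous _))).intervalIntegrable _ _)
    rw [intervalIntegral.integral_sub
      (((smooth_continuous _).inner (smooth_continuous _)).intervalIntegrable _ _)
      (((smooth_continuous _).inner (smooth_continuous _)).intervalIntegrable _ _),
      ← inner_toL2_toL2 a b hab.le, ← inner_toL2_toL2 a b hab.le] at hi
    rw [hform, hform, pairing_apply, bForm, one_mul, hi]
    ring

variable {U : Matrix (Fin (2 * N) × Fin n) (Fin (matA P S).rank) ℂ}
  {D : Matrix (Fin (matA P S).rank) (Fin (matA P S).rank) ℂ}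

theorem rangeBoundary_eq : rangeBoundary a b P S U D =
    extBoundary a b (polyEven P) (polyEven S) (boundaryMatrix U D (-1)) := by
  rw [rangeBoundary, maximalEven_eq, maximalEven_eq]
  rfl

theorem isRangeBoundaryTriplet (hab : a < b) (hsymm : SymmetricCoeffs P S)
    (hA : IsReducedFactorization (matA P S) U D) :
    IsRangeBoundaryTriplet (maximalEven a b P) (maximalEven a b S)
      (rangeBoundary a b P S U D) := by
  have h := isBoundaryForm_range hab hsymm hA
  rw [rangeBoundary_eq, maximalEven_eq, maximalEven_eq]
  refine ⟨fun x y hy => ?_, fun x q hq => h.existsUnique hq, h.exists_mem,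
    fun x p s y x' p' s' y' hz hz' hy hy' => ?_⟩
  · obtain ⟨q, hq, -⟩ := h.exists_column hy
    exact ⟨q, hq⟩
  · have h1 := h.bForm_eq hz hz' hy hy'
    simpa only [bForm, one_mul] using h1

theorem isSelfAdjointRel_iff_boundary (hab : a < b)
    (hc : IsCoercive (maximalEven a b P) (maximalEven a b S)) (hsymm : SymmetricCoeffs P S)
    (hA : IsReducedFactorization (matA P S) U D)
    (K L : Matrix (Fin (matA P S).rank) (Fin (matA P S).rank) ℂ) :
    IsSelfAdjointRel (rangeRestrict (maximalEven a b P) (maximalEven a b S)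
      (rangeBoundary a b P S U D) (kerPair K L)) ↔
      K * Lᴴ = L * Kᴴ ∧ (Matrix.fromCols K L).rank = (matA P S).rank := by
  have h := isBoundaryForm_range hab hsymm hA
  rw [maximalEven_eq, maximalEven_eq] at hc
  rw [rangeBoundary_eq, maximalEven_eq, maximalEven_eq, isSelfAdjointRel_iff,
    h.rangeRestrict_iff hc (dag_polyEven_mul_comm P S hsymm), kerPair_lagrangian_iff (Or.inl rfl),
    one_smul]

end EvenOperators

end ImplicitPHS

end

theorem proposition4p1 {n N M : ℕ} {a b : ℝ} (hab : a < b)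
    (P S : Fin (N + 1) → Matrix (Fin n) (Fin n) ℂ)
    (J : Fin (M + 1) → Matrix (Fin n) (Fin n) ℂ)
    (hcoercive : ImplicitPHS.IsCoercive
      (ImplicitPHS.maximalEven a b P) (ImplicitPHS.maximalEven a b S))
    (hsymm : ImplicitPHS.SymmetricCoeffs P S)
    (hH : ImplicitPHS.IsSymmetricRel (ImplicitPHS.relH a b P S))
    (hJ : ∀ k, J k = (-1 : ℂ) ^ ((k : ℕ) + 1) • (J k)ᴴ)
    (U : Matrix (Fin (2 * N) × Fin n) (Fin (ImplicitPHS.matA P S).rank) ℂ)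
    (D : Matrix (Fin (ImplicitPHS.matA P S).rank) (Fin (ImplicitPHS.matA P S).rank) ℂ)
    (hA : ImplicitPHS.IsReducedFactorization (ImplicitPHS.matA P S) U D)
    (V : Matrix (Fin M × Fin n) (Fin (ImplicitPHS.matQ J).rank) ℂ)
    (C : Matrix (Fin (ImplicitPHS.matQ J).rank) (Fin (ImplicitPHS.matQ J).rank) ℂ)
    (hQ : ImplicitPHS.IsReducedFactorization (ImplicitPHS.matQ J) V C) :
    ImplicitPHS.IsRangeBoundaryTriplet (ImplicitPHS.maximalEven a b P)
        (ImplicitPHS.maximalEven a b S) (ImplicitPHS.rangeBoundary a b P S U D) ∧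
    ImplicitPHS.IsSkewBoundaryTriplet (ImplicitPHS.maximalSkew a b J)
        (ImplicitPHS.skewBoundary a b J V C) ∧
    ∀ (K L : Matrix (Fin (ImplicitPHS.matA P S).rank) (Fin (ImplicitPHS.matA P S).rank) ℂ)
      (F E : Matrix (Fin (ImplicitPHS.matQ J).rank) (Fin (ImplicitPHS.matQ J).rank) ℂ),
      ImplicitPHS.IsGeneralizedPHS
          (ImplicitPHS.relNeg (ImplicitPHS.graphRestrict (ImplicitPHS.maximalSkew a b J)
            (ImplicitPHS.skewBoundary a b J V C) (ImplicitPHS.kerPair F E)))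
          (ImplicitPHS.rangeRestrict (ImplicitPHS.maximalEven a b P)
            (ImplicitPHS.maximalEven a b S) (ImplicitPHS.rangeBoundary a b P S U D)
            (ImplicitPHS.kerPair K L)) ↔
        (F * Eᴴ = -(E * Fᴴ) ∧ (Matrix.fromCols F E).rank = (ImplicitPHS.matQ J).rank) ∧
        (K * Lᴴ = L * Kᴴ ∧ (Matrix.fromCols K L).rank = (ImplicitPHS.matA P S).rank) := by
  refine ⟨ImplicitPHS.isRangeBoundaryTriplet hab hsymm hA,
    ImplicitPHS.isSkewBoundaryTriplet hab hJ hQ, fun K L F E => ?_⟩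
  rw [ImplicitPHS.IsGeneralizedPHS, ImplicitPHS.isSkewAdjointRel_iff_boundary hab hJ hQ,
    ImplicitPHS.isSelfAdjointRel_iff_boundary hab hcoercive hsymm hA]
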